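/- **Setting.** Let $\mathbb M=\mathbb R^d$, let $\mathcal P_2(\mathbb M)$ be the set of Borel probability measures on $\mathbb M$ with finite second moment, $W_2$ the Wasserstein distance, $\Gamma_0(m,\nu)$ the set of optimal couplings of $m$ and $\nu$ for the cost $|x-y|^2$, and $T_m\mathcal P_2(\mathbb M)$ the closure of $\nabla C_c^\infty(\mathbb M)$ in $L^2(m)=L^2(m;\mathbb R^d)$, with orthogonal projection $\pi_m$. A concave modulus is a concave, continuous, nondecreasing, subadditive $\rho:[0,\infty)\to[0,\infty)$ with $\rho(0)=0$. *First order.* For $U:\mathcal P_2(\mathbb M)\to\mathbb R$, $\partial_\bullet U[m]$ is the set of $\zeta\in L^2(m)$ such that $U[\nu]-U[m]\ge\inf_{\gamma\in\Gamma_0(m,\nu)}\int\zeta(x)\cdot(y-x)\,\gamma(dx,dy)+o(W_2(m,\nu))$, and $\partial^\bullet U[m]=-\partial_\bullet(-U)[m]$. $U$ is differentiable at $m$ if both sets are nonempty; $\nabla_wU[m]$ is the element of minimal norm of $\partial_\bullet U[m]$, and $\zeta\cdot(U[m]):=\langle\nabla_wU[m];\zeta\rangle_m$. *Hessian.* Suppose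 that $U$ is differentiable near $m$ and that $\nu\mapsto\zeta\cdot(U[\nu])$ is differentiable at $m$ for all $\zeta\in C_c^\infty(\mathbb M;\mathbb M)$. $U$ has a Hessian at $m$ if the form $(\zeta_1,\zeta_2)\mapsto\zeta_1\cdot(\zeta_2\cdot(U[m]))-(\nabla\zeta_2\,\zeta_1)\cdot(U[m])$ on $\nabla C_c^\infty(\mathbb M)$ extends to a bounded bilinear form on $T_m\mathcal P_2(\mathbb M)$, denoted $\mathrm{Hess}\,U[m]$. *Second order.* $U$ is twice differentiable at $m$ if it is differentiable near $m$, the gradients $\nabla_wU[\nu]$ for $\nu$ near $m$ have continuous representatives with $|\nabla_wU[\nu](x)|\le C_m(1+|x|)$, and there are bounded Borel maps $\tilde A[m]:\mathbb M\to\mathbb R^{d\times d}$, $B_m:\mathbb M^2\to\mathbb R^{d\times d}$, a concave modulus $\rho$ and $\epsilon_2\ge0$ with $\epsilon_2(t)\to0$ as $t\to0^+$ such that, for every $\nu$ at which $U$ is differentiable, every $\gamma\in\Gamma_0(m,\nu)$ and all $x,y\in\mathbb M$, $$\Bigl|\nabla_wU[\nu](y)-\nabla_wU[m](x)-\tilde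 A[m](x)(y-x)-\int B_m(x,a)(b-a)\,\gamma(da,db)\Bigr|\le|x-y|\rho(|x-y|)+W_2(m,\nu)\,\epsilon_2(W_2(m,\nu)).$$ Then $\nabla_w^2U[m]$ is obtained from $B_m$ by projecting, for each $x$, the rows of $a\mapsto B_m(x,a)$ onto $T_m\mathcal P_2(\mathbb M)$. With $\zeta_i$ the Wasserstein gradient of $m\mapsto\int x_i\,m(dx)$, set $$\triangle_wU[m]=\sum_{i=1}^d\mathrm{Hess}\,U[m](\zeta_i,\zeta_i),\qquad \triangle_{w,\epsilon}U[m]=\triangle_wU[m]+\epsilon\sum_{i=1}^d\int\langle\tilde A[m](x)\zeta_i(x),\zeta_i(x)\rangle\,m(dx).$$ **Statement.** Let $d\ge0$ and $k\ge1$, and let $\Phi:\mathbb M^k\to\mathbb R$ be a symmetric $C^2$ function (invariant under permutations of its $k$ arguments) such that $\nabla^2\Phi$ is bounded, uniformly continuous and has a concave modulus of continuity. Put $F_\Phi[m]=\frac1k\int_{\mathbb M^k}\Phi(x_1,\dots,x_k)\,m(dx_1)\cdots m(dx_k)$ (and likewise $F_\Theta$ for other functions $\Theta$ on $\mathbb M^k$),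 $$A_m(x_1)=\int_{\mathbb M^{k-1}}\nabla_{x_1}\Phi(x_1,\dots,x_k)\,m(dx_2)\cdots m(dx_k),$$ $$A_{mm}(x_1,x_2)=(k-1)\int_{\mathbb M^{k-2}}\nabla^2_{x_2x_1}\Phi(x_1,\dots,x_k)\,m(dx_3)\cdots m(dx_k),$$ where $\nabla^2_{x_2x_1}\Phi$ is the derivative in $x_2$ of $\nabla_{x_1}\Phi$; for $k=1$ this means $A_m=\nabla\Phi$ and $A_{mm}=0$, and for $k=2$, $A_{mm}=\nabla^2_{x_2x_1}\Phi$. Then: 1. for every $m\in\mathcal P_2(\mathbb M)$, $F_\Phi$ is twice differentiable at $m$ and has a Hessian at $m$, $\nabla_wF_\Phi[m]=A_m$ $m$-a.e., and $\nabla_w^2F_\Phi[m](x,\cdot)=A_{mm}(x,\cdot)$ $m$-a.e. for $m$-a.e. $x$; 2. $\triangle_wF_\Phi=F_{\Theta_0}$ on $\mathcal P_2(\mathbb M)$; 3. for every $\epsilon>0$, $\triangle_{w,\epsilon}F_\Phi=F_{\Theta_\epsilon}$ on $\mathcal P_2(\mathbb M)$, where $$\Theta_\epsilon=(1+\epsilon)\sum_{j=1}^k\triangle_{x_j}\Phi+\sum_{j\ne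 n}\sum_{l=1}^d\frac{\partial^2\Phi}{\partial(x_n)_l\,\partial(x_j)_l},$$ the second sum running over ordered pairs of distinct $j,n\in\{1,\dots,k\}$. -/

import Mathlib

open MeasureTheory Set Filter Topology
open scoped ENNReal RealInnerProductSpace ContDiff

noncomputable section

/-! ### The Wasserstein space `P₂(ℝᵈ)` -/

/-- The space `𝕄 = ℝᵈ` with its Euclidean norm. -/
abbrev M (d : ℕ) : Type := EuclideanSpace ℝ (Fin d)

/-- Borel probability measures on `ℝᵈ` with finite second moment. -/
def P2 (d : ℕ) : Type :=
  {m : Measure (M d) // IsProbabilityMeasure m ∧ ∫⁻ x, ‖x‖ₑ ^ 2 ∂m < ⊤}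

instance {d : ℕ} (m : P2 d) : IsProbabilityMeasure m.1 := m.2.1

/-- `Γ(m, ν)`: the measures on `𝕄²` with marginals `m` and `ν`. -/
def couplings {d : ℕ} (m ν : P2 d) : Set (Measure (M d × M d)) :=
  {γ | γ.map Prod.fst = m.1 ∧ γ.map Prod.snd = ν.1}

/-- `∫ |x - y|² γ(dx, dy)`. -/
def quadCost {d : ℕ} (γ : Measure (M d × M d)) : ℝ≥0∞ :=
  ∫⁻ p, ‖p.1 - p.2‖ₑ ^ 2 ∂γ

/-- `W₂²(m, ν)`, as an extended nonnegative real (it is always finite on `P2 d`). -/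
def W2sq {d : ℕ} (m ν : P2 d) : ℝ≥0∞ := ⨅ γ ∈ couplings m ν, quadCost γ

/-- The Wasserstein distance `W₂(m, ν)`. -/
def W2 {d : ℕ} (m ν : P2 d) : ℝ := √(W2sq m ν).toReal

/-- `Γ₀(m, ν)`: the optimal couplings. -/
def optCouplings {d : ℕ} (m ν : P2 d) : Set (Measure (M d × M d)) :=
  {γ | γ ∈ couplings m ν ∧ quadCost γ = W2sq m ν}

/-- The Hilbert space `L²(m)` of vector fields. -/
abbrev L2 {d : ℕ} (m : P2 d) : Type := Lp (M d) 2 m.1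

/-- `C_c^∞(𝕄, E)`. -/
def IsTest {d : ℕ} {E : Type*} [NormedAddCommGroup E] [NormedSpace ℝ E] (f : M d → E) : Prop :=
  ContDiff ℝ ∞ f ∧ HasCompactSupport f

/-- `T_m P₂(𝕄)`: the closure of `∇ C_c^∞(𝕄)` in `L²(m)`
(the gradients already form a linear subspace, so taking the span adds nothing). -/
def tangent {d : ℕ} (m : P2 d) : Submodule ℝ (L2 m) :=
  (Submodule.span ℝ {z : L2 m | ∃ φ : M d → ℝ, IsTest φ ∧ z =ᵐ[m.1] gradient φ}).topologicalClosure

instance {d : ℕ} (m : P2 d) : CompleteSpace (tangent m) := by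
  unfold tangent
  infer_instance

/-- The orthogonal projection `π_m` of a vector field onto `T_m P₂(𝕄)`, for `f ∈ L²(m)`. -/
def projTangent {d : ℕ} (m : P2 d) (f : M d → M d) : L2 m :=
  open Classical in
  if h : MemLp f 2 m.1 then (tangent m).starProjection h.toLp else 0

/-! ### First order Wasserstein calculus -/

/-- `∂_• U[m]`: the fields `ζ ∈ L²(m)` such that, as `W₂(m, ν) → 0`,
`U[ν] - U[m] ≥ inf_{γ ∈ Γ₀(m, ν)} ∫ ζ(x) · (y - x) γ(dx, dy) + o(W₂(m, ν))`. -/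
def subdiff {d : ℕ} (U : P2 d → ℝ) (m : P2 d) : Set (L2 m) :=
  {ζ | ∀ ε > 0, ∃ δ > 0, ∀ ν : P2 d, W2 m ν < δ →
    sInf ((fun γ : Measure (M d × M d) => ∫ p, ⟪ζ p.1, p.2 - p.1⟫ ∂γ) '' optCouplings m ν)
      - ε * W2 m ν ≤ U ν - U m}

/-- `∂^• U[m] = -∂_• (-U)[m]`. -/
def superdiff {d : ℕ} (U : P2 d → ℝ) (m : P2 d) : Set (L2 m) :=
  {ζ | -ζ ∈ subdiff (fun ν => -U ν) m}

/-- `U` is differentiable at `m`. -/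
def WDifferentiableAt {d : ℕ} (U : P2 d → ℝ) (m : P2 d) : Prop :=
  (subdiff U m).Nonempty ∧ (superdiff U m).Nonempty

/-- `ζ` is an element of minimal norm of `∂_• U[m]`. -/
def IsWGrad {d : ℕ} (U : P2 d → ℝ) (m : P2 d) (ζ : L2 m) : Prop :=
  ζ ∈ subdiff U m ∧ ∀ ξ ∈ subdiff U m, ‖ζ‖ ≤ ‖ξ‖

/-- The Wasserstein gradient `∇_w U[m]`. -/
def wGrad {d : ℕ} (U : P2 d → ℝ) (m : P2 d) : L2 m :=
  open Classical in
  if h : ∃ ζ, IsWGrad U m ζ then h.choose else 0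

/-- `dU[m](ζ) = ζ · (U[m]) = ⟨∇_w U[m]; ζ⟩_m`. -/
def wDeriv {d : ℕ} (U : P2 d → ℝ) (m : P2 d) (ζ : M d → M d) : ℝ :=
  ∫ x, ⟪wGrad U m x, ζ x⟫ ∂m.1

/-! ### The Wasserstein Hessian -/

/-- `ζ₁ · (ζ₂ · (U[m])) - (∇ζ₂ ζ₁) · (U[m])`. -/
def barHess {d : ℕ} (U : P2 d → ℝ) (m : P2 d) (ζ₁ ζ₂ : M d → M d) : ℝ :=
  wDeriv (fun ν => wDeriv U ν ζ₂) m ζ₁ - wDeriv U m (fun x => fderiv ℝ ζ₂ x (ζ₁ x))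

/-- `U` has the Hessian `H` at `m`: `U` is differentiable near `m`, the maps
`ν ↦ ζ · (U[ν])` are differentiable at `m`, and `H` is the bounded bilinear form on `T_m P₂(𝕄)`
which is `barHess` on `∇ C_c^∞(𝕄)`. -/
def HasWHess {d : ℕ} (U : P2 d → ℝ) (m : P2 d) (H : tangent m →L[ℝ] tangent m →L[ℝ] ℝ) : Prop :=
  (∃ r > 0, ∀ ν, W2 m ν < r → WDifferentiableAt U ν) ∧
  (∀ ζ : M d → M d, IsTest ζ → WDifferentiableAt (fun ν => wDeriv U ν ζ) m) ∧
  ∀ φ₁ φ₂ : M d → ℝ, IsTest φ₁ → IsTest φ₂ → ∀ z₁ z₂ : tangent m,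
    (z₁ : L2 m) =ᵐ[m.1] gradient φ₁ → (z₂ : L2 m) =ᵐ[m.1] gradient φ₂ →
    H z₁ z₂ = barHess U m (gradient φ₁) (gradient φ₂)

/-- `Hess U[m]`. -/
def wHess {d : ℕ} (U : P2 d → ℝ) (m : P2 d) : tangent m →L[ℝ] tangent m →L[ℝ] ℝ :=
  open Classical in
  if h : ∃ H, HasWHess U m H then h.choose else 0

/-! ### Twice differentiability -/

/-- A concave modulus on `[0, ∞)`. -/
structure IsConcaveModulus (ρ : ℝ → ℝ) : Prop where
  nonneg : ∀ t, 0 ≤ t → 0 ≤ ρ t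
  zero : ρ 0 = 0
  cont : ContinuousOn ρ (Ici 0)
  mono : MonotoneOn ρ (Ici 0)
  subadd : ∀ s t, 0 ≤ s → 0 ≤ t → ρ (s + t) ≤ ρ s + ρ t
  concave : ConcaveOn ℝ (Ici 0) ρ

/-- The second order expansion of `U` at `m` with bounded Borel coefficients `Ã = At` and
`A_{mm} = Amm`. Here `G ν` is the representative of `∇_w U[ν]` which is used pointwise; it is
continuous and of linear growth for `ν` near `m`, and for all `x, y` and all `γ ∈ Γ₀(m, ν)`
`|∇_w U[ν](y) - ∇_w U[m](x) - P_γ[m](x, y)| ≤ |x - y| ρ(|x - y|) + W₂(m, ν) ε₂(W₂(m, ν))`,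
`P_γ[m](x, y) = Ã(x) (y - x) + ∫ A_{mm}(x, a) (b - a) γ(da, db)`. -/
def HasSecondOrderExpansion {d : ℕ} (U : P2 d → ℝ) (m : P2 d)
    (At : M d → M d →L[ℝ] M d) (Amm : M d → M d → M d →L[ℝ] M d) : Prop :=
  Measurable At ∧ (∃ C, ∀ x, ‖At x‖ ≤ C) ∧
  Measurable (fun p : M d × M d => Amm p.1 p.2) ∧ (∃ C, ∀ x a, ‖Amm x a‖ ≤ C) ∧
  ∃ (G : P2 d → M d → M d) (ρ ε₂ : ℝ → ℝ),
    (∀ ν, WDifferentiableAt U ν → wGrad U ν =ᵐ[ν.1] G ν) ∧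
    (∃ r > 0, ∃ C : ℝ, ∀ ν, W2 m ν < r →
      WDifferentiableAt U ν ∧ Continuous (G ν) ∧ ∀ x, ‖G ν x‖ ≤ C * (1 + ‖x‖)) ∧
    IsConcaveModulus ρ ∧
    (∀ t, 0 ≤ t → 0 ≤ ε₂ t) ∧ Tendsto ε₂ (𝓝[>] 0) (𝓝 0) ∧
    ∀ ν, WDifferentiableAt U ν → ∀ γ ∈ optCouplings m ν, ∀ x y : M d,
      ‖G ν y - G m x - (At x (y - x) + ∫ p, Amm x p.1 (p.2 - p.1) ∂γ)‖
        ≤ ‖x - y‖ * ρ ‖x - y‖ + W2 m ν * ε₂ (W2 m ν)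

/-- `U` is twice differentiable at `m`. -/
def TwiceWDifferentiableAt {d : ℕ} (U : P2 d → ℝ) (m : P2 d) : Prop :=
  ∃ (At : M d → M d →L[ℝ] M d) (Amm : M d → M d → M d →L[ℝ] M d),
    HasSecondOrderExpansion U m At Amm

/-- The coefficient `Ã[m]` of a twice differentiable `U`. -/
def wAt {d : ℕ} (U : P2 d → ℝ) (m : P2 d) : M d → M d →L[ℝ] M d :=
  open Classical in
  if h : TwiceWDifferentiableAt U m then h.choose else 0

/-- A coefficient `A_{mm}` of a twice differentiable `U`, before projection. -/
def wAmm {d : ℕ} (U : P2 d → ℝ) (m : P2 d) : M d → M d → M d →L[ℝ] M d :=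
  open Classical in
  if h : TwiceWDifferentiableAt U m then h.choose_spec.choose else 0

/-- The `i`-th row of the matrix of `L`. -/
def matRow {d : ℕ} (L : M d →L[ℝ] M d) (i : Fin d) : M d :=
  WithLp.toLp 2 (fun j => L (EuclideanSpace.single j 1) i)

/-- The second order Wasserstein gradient `∇_w² U[m] = π_m(A_{mm})`, given through its rows: for
every `x`, the projection onto `T_m P₂(𝕄)` of the `i`-th row of `a ↦ A_{mm}(x, a)`. -/
def wGrad2 {d : ℕ} (U : P2 d → ℝ) (m : P2 d) (x : M d) (i : Fin d) : L2 m :=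
  projTangent m (fun a => matRow (wAmm U m x a) i)

/-- The `i`-th moment `m ↦ ∫ x_i m(dx)`. -/
def moment {d : ℕ} (i : Fin d) (m : P2 d) : ℝ := ∫ x, x i ∂m.1

/-- `ζ_i`, the Wasserstein gradient of the `i`-th moment, as an element of `T_m P₂(𝕄)` (it lies in
that space, so that the projection only serves to change its type). -/
def momentGrad {d : ℕ} (i : Fin d) (m : P2 d) : tangent m :=
  (tangent m).orthogonalProjectionOnto (wGrad (moment i) m)

/-- The Wasserstein Laplacian `△_w U[m] = ∑ᵢ Hess U[m](ζ_i, ζ_i)`. -/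
def wLaplacian {d : ℕ} (U : P2 d → ℝ) (m : P2 d) : ℝ :=
  ∑ i : Fin d, wHess U m (momentGrad i m) (momentGrad i m)

/-- The perturbed operator
`△_{w,ε} U[m] = ∑ᵢ (Hess U[m](ζ_i, ζ_i) + ε ∫ ⟨Ã[m](x) ζ_i(x), ζ_i(x)⟩ m(dx))`. -/
def wLaplacianEps {d : ℕ} (ε : ℝ) (U : P2 d → ℝ) (m : P2 d) : ℝ :=
  ∑ i : Fin d, (wHess U m (momentGrad i m) (momentGrad i m)
    + ε * ∫ x, ⟪wAt U m x ((momentGrad i m : L2 m) x), (momentGrad i m : L2 m) x⟫ ∂m.1)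

/-! ### Symmetric functions and `k`-polynomials -/

/-- `Φ` is a symmetric `C²` function on `𝕄ᵏ` whose Hessian is bounded, uniformly continuous, and has
a concave modulus of continuity for the Euclidean distance of `𝕄ᵏ`. (The norm used on the Hessian
is immaterial, since the space of matrices is finite dimensional.) -/
structure IsSymTwo {d k : ℕ} (Φ : (Fin k → M d) → ℝ) : Prop where
  symm : ∀ (σ : Equiv.Perm (Fin k)) (x : Fin k → M d), Φ (fun i => x (σ i)) = Φ x
  contDiff : ContDiff ℝ 2 Φ
  bounded : ∃ C, ∀ x, ‖fderiv ℝ (fderiv ℝ Φ) x‖ ≤ C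
  uniformCont : UniformContinuous (fderiv ℝ (fderiv ℝ Φ))
  modulus : ∃ ρ, IsConcaveModulus ρ ∧ ∀ x y : Fin k → M d,
    ‖fderiv ℝ (fderiv ℝ Φ) y - fderiv ℝ (fderiv ℝ Φ) x‖ ≤ ρ √(∑ i, ‖x i - y i‖ ^ 2)

/-- `F_Φ[m] = (1/k) ∫ Φ(x₁, …, x_k) m(dx₁) ⋯ m(dx_k)`. -/
def kPoly {d k : ℕ} (Φ : (Fin k → M d) → ℝ) (m : P2 d) : ℝ :=
  (1 / (k : ℝ)) * ∫ x, Φ x ∂(Measure.pi fun _ : Fin k => m.1)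

/-- `∇_{x_j} Φ(x)`. -/
def partialGrad {d k : ℕ} (Φ : (Fin k → M d) → ℝ) (j : Fin k) (x : Fin k → M d) : M d :=
  gradient (fun z => Φ (Function.update x j z)) (x j)

/-- `∇²_{x_n x_j} Φ(x)`, the derivative in `x_n` of `∇_{x_j} Φ`; its matrix has the entries
`∂²Φ / ∂(x_n)_b ∂(x_j)_a` in row `a` and column `b`. -/
def partialHess {d k : ℕ} (Φ : (Fin k → M d) → ℝ) (n j : Fin k) (x : Fin k → M d) :
    M d →L[ℝ] M d :=
  fderiv ℝ (fun z => partialGrad Φ j (Function.update x n z)) (x n)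

/-- `A_m(x₁) = ∫ ∇_{x₁} Φ(x₁, x₂, …, x_k) m(dx₂) ⋯ m(dx_k)`, which is `∇Φ(x₁)` for `k = 1`
(the value for `k = 0` is irrelevant). -/
def gradField {d : ℕ} : {k : ℕ} → ((Fin k → M d) → ℝ) → P2 d → M d → M d
  | 0, _, _, _ => 0
  | n + 1, Φ, m, x₁ =>
    ∫ y : Fin n → M d, partialGrad Φ 0 (Fin.cons x₁ y) ∂(Measure.pi fun _ : Fin n => m.1)

/-- `A_{mm}(x₁, x₂) = (k - 1) ∫ ∇²_{x₂ x₁} Φ(x₁, x₂, x₃, …, x_k) m(dx₃) ⋯ m(dx_k)`, which is `0` for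
`k = 1` and `∇²_{x₂ x₁} Φ(x₁, x₂)` for `k = 2`. -/
def hessField {d : ℕ} : {k : ℕ} → ((Fin k → M d) → ℝ) → P2 d → M d → M d → M d →L[ℝ] M d
  | 0, _, _, _, _ => 0
  | 1, _, _, _, _ => 0
  | n + 2, Φ, m, x₁, x₂ =>
    ((n : ℝ) + 1) • ∫ y : Fin n → M d, partialHess Φ 1 0 (Fin.cons x₁ (Fin.cons x₂ y))
      ∂(Measure.pi fun _ : Fin n => m.1)

/-- `∑_l ∂²Φ / ∂(x_n)_l ∂(x_j)_l`; this is `△_{x_j} Φ` for `n = j` and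
`div_{x_n} ∇_{x_j} Φ` in general. -/
def divGrad {d k : ℕ} (Φ : (Fin k → M d) → ℝ) (n j : Fin k) (x : Fin k → M d) : ℝ :=
  ∑ l : Fin d, partialHess Φ n j x (EuclideanSpace.single l 1) l

/-- `Θ_ε = (1 + ε) ∑_j △_{x_j} Φ + ∑_{j ≠ n} div_{x_n} ∇_{x_j} Φ`. -/
def thetaFun {d k : ℕ} (ε : ℝ) (Φ : (Fin k → M d) → ℝ) (x : Fin k → M d) : ℝ :=
  (1 + ε) * ∑ j, divGrad Φ j j x
    + ∑ j, ∑ n ∈ Finset.univ.filter (fun n => n ≠ j), divGrad Φ n j x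

end

noncomputable section

/-! ### Couplings -/

variable {d : ℕ}

/-! Every expansion on the Wasserstein space comes from a pointwise Taylor expansion on $\mathbb
M^k$ integrated over independent copies of one optimal coupling $\gamma\in\Gamma_0(m,\nu)$.
Integrals against powers of $m$ and of $\nu$ both lift to the same power of $\gamma$, and
permutation symmetry of $\Phi$ turns the partial derivatives into multiples of a single one. For
$\Phi$ itself the Taylor remainder is at most $B(\sum_i|y_i-x_i|)^2$, hence $O(W_2^2)$ after
integration, and the $k$ equal linear terms cancel the factor $1/k$ and leave $A_m$
(`HessModulus.abs_kPoly_expansion_le`). For $\nabla_{x_1}\Phi$ the remainder is $N\,r(N)$ with $N$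
the total displacement and $r$ a bounded concave modulus. Splitting off the displacement of the
first variable, then using Cauchy–Schwarz and Jensen for the rest, gives the second order expansion
with coefficients `diagField` and `hessField` (`HessModulus.norm_gradField_expansion_le`).

The gradient, the coefficients and the Hessian are defined by choice, so uniqueness must be proved
as well. For the gradient, push $m$ forward by $\mathrm{id}+t\nabla\varphi$: for small $t$ the only
optimal couplings sit on the graph, because $\varphi$ is semiconvex
(`eq_perturb_of_mem_optCouplings`). Testing with $\pm\varphi$ shows that any subgradient differs
from a field giving a two-sided expansion by a vector orthogonal to $T_m\mathcal P_2$
(`HasWExpansion.sub_mem_orthogonal`). The field $A_m$ is an average of gradients of linear growth,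
hence tangent, and Pythagoras makes it the unique element of minimal norm
(`HasWExpansion.isWGrad_iff`).

For the second order coefficients, a small atom added at $y$ determines the chosen representative of
the gradient at $y$ for every $y$ (`HessModulus.eq_gradField_of_expansion`). Then $\tilde A$ is the
derivative of $A_m$, read off along the diagonal coupling. Comparing two expansions along the graph
couplings shows that $B_m(x,\cdot)$ is determined up to fields orthogonal to gradients
(`HessModulus.integral_sub_hessField_eq_zero`). The rows of $A_{mm}(x,\cdot)$ are tangent, so
projection recovers them.

For the Hessian, $\nu\mapsto\zeta\cdot(F_\Phi[\nu])$ has the gradient $\nabla\langle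
A_m,\zeta\rangle$ plus a nonlocal term coming from the dependence of $A_\nu$ on $\nu$
(`HessModulus.hasWExpansion_wDeriv`). Subtracting $(\nabla\zeta_2\,\zeta_1)\cdot(F_\Phi[m])$ removes
every derivative of the test fields. What remains is a multiplication operator plus an integral
operator, both bounded on $L^2(m)$ (`HessModulus.barHess_eq`). The constant fields $e_i$ are limits
of gradients of test functions, so the form can be evaluated there. The sums over $i$ become traces,
and symmetry identifies these with the diagonal and off-diagonal sums in $\Theta_\epsilon$. -/

lemma isProbabilityMeasure_of_mem_couplings {m ν : P2 d} {γ : Measure (M d × M d)}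
    (h : γ ∈ couplings m ν) : IsProbabilityMeasure γ := by
  refine ⟨?_⟩
  have h1 : γ.map Prod.fst univ = 1 := by rw [h.1]; exact measure_univ
  rwa [Measure.map_apply measurable_fst MeasurableSet.univ, preimage_univ] at h1

lemma measurePreserving_fst_coupling {m ν : P2 d} {γ : Measure (M d × M d)}
    (h : γ ∈ couplings m ν) : MeasurePreserving Prod.fst γ m.1 := ⟨measurable_fst, h.1⟩

lemma measurePreserving_snd_coupling {m ν : P2 d} {γ : Measure (M d × M d)}
    (h : γ ∈ couplings m ν) : MeasurePreserving Prod.snd γ ν.1 := ⟨measurable_snd, h.2⟩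

lemma prod_mem_couplings (m ν : P2 d) : m.1.prod ν.1 ∈ couplings m ν := by
  constructor
  · simp [Measure.map_fst_prod]
  · simp [Measure.map_snd_prod]

/-- The cost is the supremum over $n$ of the integrals of the bounded continuous functions
$\min(|x-y|^2,n)$, by monotone convergence, and each of these is weakly continuous in the measure.
-/
lemma lowerSemicontinuous_quadCost :
    LowerSemicontinuous fun γ : ProbabilityMeasure (M d × M d) => quadCost γ.toMeasure := by
  let c (n : ℕ) : BoundedContinuousFunction (M d × M d) NNReal :=
    BoundedContinuousFunction.mkOfBound
      ⟨fun p => min (‖p.1 - p.2‖₊ ^ 2) n, by fun_prop⟩ n (fun p q => by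
        simp only [ContinuousMap.coe_mk, NNReal.dist_eq]
        have h1 : ((min (‖p.1 - p.2‖₊ ^ 2) n : NNReal) : ℝ) ≤ n := by
          exact_mod_cast min_le_right _ _
        have h2 : ((min (‖q.1 - q.2‖₊ ^ 2) n : NNReal) : ℝ) ≤ n := by
          exact_mod_cast min_le_right _ _
        rw [abs_le]
        constructor <;> linarith [NNReal.coe_nonneg (min (‖p.1 - p.2‖₊ ^ 2) n),
          NNReal.coe_nonneg (min (‖q.1 - q.2‖₊ ^ 2) n)])
  have hc : ∀ n p, c n p = min (‖p.1 - p.2‖₊ ^ 2) n := fun n p => rfl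
  have key : ∀ γ : ProbabilityMeasure (M d × M d),
      quadCost γ.toMeasure = ⨆ n, ∫⁻ p, c n p ∂γ.toMeasure := by
    intro γ
    rw [← lintegral_iSup (fun n => (c n).continuous.measurable.coe_nnreal_ennreal)]
    · refine lintegral_congr fun p => ?_
      apply le_antisymm
      · obtain ⟨n, hn⟩ := exists_nat_ge (‖p.1 - p.2‖₊ ^ 2)
        refine le_iSup_of_le n ?_
        rw [hc, min_eq_left hn]
        simp [enorm_eq_nnnorm]
      · refine iSup_le fun n => ?_
        rw [hc, enorm_eq_nnnorm]
        exact_mod_cast min_le_left _ _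
    · intro i j hij p
      simp only [hc]
      norm_cast
      exact min_le_min le_rfl (by exact_mod_cast hij)
  simp_rw [key]
  refine lowerSemicontinuous_iSup fun n => ?_
  exact (ProbabilityMeasure.continuous_lintegral_boundedContinuousFunction
    (X := M d × M d) (c n)).lowerSemicontinuous

/-- Optimal couplings exist. -/
theorem optCouplings_nonempty (m ν : P2 d) : (optCouplings m ν).Nonempty := by
  let S : Set (ProbabilityMeasure (M d × M d)) := {γ | γ.toMeasure ∈ couplings m ν}
  have hS : IsClosed S := by
    let m' : ProbabilityMeasure (M d) := ⟨m.1, inferInstance⟩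
    let ν' : ProbabilityMeasure (M d) := ⟨ν.1, inferInstance⟩
    have : S = {γ | γ.map continuous_fst.aemeasurable = m'} ∩
        {γ | γ.map continuous_snd.aemeasurable = ν'} := by
      ext γ
      simp only [S, couplings, mem_ofPred_eq, mem_inter_iff, ← ProbabilityMeasure.toMeasure_injective.eq_iff]
      rfl
    rw [this]
    exact (isClosed_eq (ProbabilityMeasure.continuous_map continuous_fst) continuous_const).inter
      (isClosed_eq (ProbabilityMeasure.continuous_map continuous_snd) continuous_const)
  -- All elements of `S` have the same two marginals, each of them tight on its own. So `S` is
  -- tight, and Prokhorov's theorem applies.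
  have hcomp : IsCompact S := by
    rw [← hS.closure_eq]
    apply isCompact_closure_of_isTightMeasureSet
    apply IsTightMeasureSet.prodMk
    · refine (isTightMeasureSet_singleton (μ := m.1)).subset ?_
      rintro _ ⟨_, ⟨γ, hγ, rfl⟩, rfl⟩
      exact hγ.1
    · refine (isTightMeasureSet_singleton (μ := ν.1)).subset ?_
      rintro _ ⟨_, ⟨γ, hγ, rfl⟩, rfl⟩
      exact hγ.2
  have hne : S.Nonempty := ⟨⟨m.1.prod ν.1, inferInstance⟩, prod_mem_couplings m ν⟩
  obtain ⟨γ, hγ, hmin⟩ :=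
    (lowerSemicontinuous_quadCost.lowerSemicontinuousOn S).exists_isMinOn hne hcomp
  refine ⟨γ.toMeasure, hγ, le_antisymm ?_ ?_⟩
  · refine le_iInf₂ fun γ' hγ' => ?_
    have := isProbabilityMeasure_of_mem_couplings hγ'
    exact hmin (a := ⟨γ', this⟩) hγ'
  · exact iInf₂_le γ.toMeasure hγ

/-! ### Moments and the cost -/

lemma memLp_id (m : P2 d) : MemLp (fun x : M d => x) 2 m.1 := by
  refine ⟨by fun_prop, ?_⟩
  rw [eLpNorm_lt_top_iff_lintegral_rpow_enorm_lt_top (by norm_num) (by norm_num)]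
  simpa using m.2.2

lemma memLp_fst_coupling {m ν : P2 d} {γ : Measure (M d × M d)} (h : γ ∈ couplings m ν) :
    MemLp (fun p : M d × M d => p.1) 2 γ :=
  (memLp_id m).comp_measurePreserving (measurePreserving_fst_coupling h)

lemma memLp_snd_coupling {m ν : P2 d} {γ : Measure (M d × M d)} (h : γ ∈ couplings m ν) :
    MemLp (fun p : M d × M d => p.2) 2 γ :=
  (memLp_id ν).comp_measurePreserving (measurePreserving_snd_coupling h)

lemma memLp_sub_coupling {m ν : P2 d} {γ : Measure (M d × M d)} (h : γ ∈ couplings m ν) :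
    MemLp (fun p : M d × M d => p.2 - p.1) 2 γ :=
  (memLp_snd_coupling h).sub (memLp_fst_coupling h)

lemma integrable_sub_coupling {m ν : P2 d} {γ : Measure (M d × M d)} (h : γ ∈ couplings m ν) :
    Integrable (fun p : M d × M d => p.2 - p.1) γ :=
  have := isProbabilityMeasure_of_mem_couplings h
  (memLp_sub_coupling h).integrable (by norm_num)

lemma integrable_norm_sub_sq_coupling {m ν : P2 d} {γ : Measure (M d × M d)}
    (h : γ ∈ couplings m ν) : Integrable (fun p : M d × M d => ‖p.2 - p.1‖ ^ 2) γ :=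
  (memLp_sub_coupling h).integrable_norm_pow (by norm_num)

lemma toReal_quadCost {m ν : P2 d} {γ : Measure (M d × M d)} (h : γ ∈ couplings m ν) :
    quadCost γ = ENNReal.ofReal (∫ p, ‖p.2 - p.1‖ ^ 2 ∂γ) := by
  rw [ofReal_integral_eq_lintegral_ofReal (integrable_norm_sub_sq_coupling h)
    (ae_of_all _ fun p => by positivity), quadCost]
  refine lintegral_congr fun p => ?_
  rw [ENNReal.ofReal_pow (norm_nonneg _), ofReal_norm, ← enorm_neg, neg_sub]

lemma W2_nonneg (m ν : P2 d) : 0 ≤ W2 m ν := Real.sqrt_nonneg _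

lemma W2_sq_eq {m ν : P2 d} {γ : Measure (M d × M d)} (h : γ ∈ optCouplings m ν) :
    ∫ p, ‖p.2 - p.1‖ ^ 2 ∂γ = W2 m ν ^ 2 := by
  rw [W2, Real.sq_sqrt ENNReal.toReal_nonneg, ← h.2, toReal_quadCost h.1, ENNReal.toReal_ofReal]
  exact integral_nonneg fun p => by positivity

lemma W2_sq_le {m ν : P2 d} {γ : Measure (M d × M d)} (h : γ ∈ couplings m ν) :
    W2 m ν ^ 2 ≤ ∫ p, ‖p.2 - p.1‖ ^ 2 ∂γ := by
  rw [W2, Real.sq_sqrt ENNReal.toReal_nonneg]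
  refine ENNReal.toReal_le_of_le_ofReal (integral_nonneg fun p => by positivity) ?_
  rw [← toReal_quadCost h]
  exact iInf₂_le γ h

lemma mem_optCouplings_of_le {m ν : P2 d} {γ : Measure (M d × M d)} (h : γ ∈ couplings m ν)
    (hle : ∫ p, ‖p.2 - p.1‖ ^ 2 ∂γ ≤ W2 m ν ^ 2) : γ ∈ optCouplings m ν := by
  refine ⟨h, le_antisymm ?_ (iInf₂_le γ h)⟩
  rw [toReal_quadCost h]
  rw [W2, Real.sq_sqrt ENNReal.toReal_nonneg] at hle
  exact ENNReal.ofReal_le_of_le_toReal hle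

/-! ### Cauchy–Schwarz and Jensen along couplings, and the diagonal coupling -/

lemma integral_mul_le_sqrt_mul_sqrt {Ω : Type*} [MeasurableSpace Ω] {μ : Measure Ω} {f g : Ω → ℝ}
    (hf : MemLp f 2 μ) (hg : MemLp g 2 μ) (hf0 : ∀ x, 0 ≤ f x) (hg0 : ∀ x, 0 ≤ g x) :
    ∫ x, f x * g x ∂μ ≤ √(∫ x, f x ^ 2 ∂μ) * √(∫ x, g x ^ 2 ∂μ) := by
  have := integral_mul_le_Lp_mul_Lq_of_nonneg (μ := μ) (p := 2) (q := 2)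
    (Real.holderConjugate_iff.2 ⟨by norm_num, by norm_num⟩)
    (ae_of_all _ hf0) (ae_of_all _ hg0) (by simpa using hf) (by simpa using hg)
  simpa [Real.sqrt_eq_rpow] using this

lemma integrable_inner_of_memLp {Ω E : Type*} [MeasurableSpace Ω] {μ : Measure Ω}
    [NormedAddCommGroup E] [InnerProductSpace ℝ E] {f g : Ω → E} (hf : MemLp f 2 μ)
    (hg : MemLp g 2 μ) : Integrable (fun x => ⟪f x, g x⟫) μ :=
  (hf.norm.integrable_mul hg.norm).mono' (hf.1.inner hg.1)
    (ae_of_all _ fun _ => norm_inner_le_norm _ _)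

lemma integral_norm_sub_le_W2 {m ν : P2 d} {γ : Measure (M d × M d)} (h : γ ∈ optCouplings m ν) :
    ∫ p, ‖p.2 - p.1‖ ∂γ ≤ W2 m ν := by
  have := isProbabilityMeasure_of_mem_couplings h.1
  have h1 := integral_mul_le_sqrt_mul_sqrt (memLp_sub_coupling h.1).norm
    (memLp_const (μ := γ) (1 : ℝ)) (fun _ => norm_nonneg _) (fun _ => zero_le_one)
  simpa [W2_sq_eq h, Real.sqrt_sq (W2_nonneg m ν)] using h1

/-- Jensen's inequality for a concave modulus along an optimal coupling. -/
lemma integral_modulus_le {ρ : ℝ → ℝ} (hρ : IsConcaveModulus ρ) {Ω : Type*} [MeasurableSpace Ω]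
    {μ : Measure Ω} [IsProbabilityMeasure μ] {f : Ω → ℝ} (hf : Integrable f μ)
    (hf0 : ∀ x, 0 ≤ f x) (hi : Integrable (fun x => ρ (f x)) μ) {w : ℝ} (hw : ∫ x, f x ∂μ ≤ w) :
    ∫ x, ρ (f x) ∂μ ≤ ρ w := by
  have h0 : 0 ≤ ∫ x, f x ∂μ := integral_nonneg hf0
  exact (hρ.concave.le_map_integral hρ.cont isClosed_Ici (ae_of_all _ hf0) hf hi).trans
    (hρ.mono h0 (h0.trans hw) hw)

/-- Inserted into an expansion at `ν = m`, this coupling kills every term that involves the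
displacement of the measure and isolates the dependence on the point. -/
def diagCoupling (m : P2 d) : Measure (M d × M d) := m.1.map fun x => (x, x)

lemma diagCoupling_mem (m : P2 d) : diagCoupling m ∈ optCouplings m m := by
  have h : diagCoupling m ∈ couplings m m := by
    constructor
    · rw [diagCoupling, Measure.map_map (by fun_prop) (by fun_prop)]; exact Measure.map_id
    · rw [diagCoupling, Measure.map_map (by fun_prop) (by fun_prop)]; exact Measure.map_id
  refine mem_optCouplings_of_le h ?_
  rw [diagCoupling, integral_map (by fun_prop) (by fun_prop)]
  simp [sq_nonneg]

lemma W2_self (m : P2 d) : W2 m m = 0 := by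
  have h := W2_sq_eq (diagCoupling_mem m)
  rw [diagCoupling, integral_map (by fun_prop) (by fun_prop)] at h
  simpa using h.symm

end

noncomputable section

/-! ### Vector fields in the tangent space -/

section Tangent

variable {d : ℕ}

lemma norm_sub_sq_eq_integral {m : P2 d} {z w : L2 m} {f g : M d → M d}
    (hz : z =ᵐ[m.1] f) (hw : w =ᵐ[m.1] g) :
    ‖z - w‖ ^ 2 = ∫ x, ‖f x - g x‖ ^ 2 ∂m.1 := by
  rw [← real_inner_self_eq_norm_sq, L2.inner_def]
  refine integral_congr_ae ?_
  filter_upwards [hz, hw, Lp.coeFn_sub z w] with x h1 h2 h3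
  rw [real_inner_self_eq_norm_sq, h3, Pi.sub_apply, h1, h2]

lemma inner_L2_eq_integral {m : P2 d} {z w : L2 m} {f g : M d → M d}
    (hz : z =ᵐ[m.1] f) (hw : w =ᵐ[m.1] g) : ⟪z, w⟫ = ∫ x, ⟪f x, g x⟫ ∂m.1 := by
  rw [L2.inner_def]
  refine integral_congr_ae ?_
  filter_upwards [hz, hw] with x h1 h2
  rw [h1, h2]

lemma inner_gradient_apply (f : M d → ℝ) (x v : M d) : ⟪gradient f x, v⟫ = fderiv ℝ f x v := by
  rw [gradient, InnerProductSpace.toDual_symm_apply]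

lemma continuous_gradient {f : M d → ℝ} (hf : ContDiff ℝ 1 f) : Continuous (gradient f) :=
  (InnerProductSpace.toDual ℝ (M d)).symm.continuous.comp (hf.continuous_fderiv (by norm_num))

lemma norm_gradient (f : M d → ℝ) (x : M d) : ‖gradient f x‖ = ‖fderiv ℝ f x‖ := by
  rw [gradient, LinearIsometryEquiv.norm_map]

lemma IsTest.gradient {φ : M d → ℝ} (hφ : IsTest φ) : IsTest (gradient φ) := by
  constructor
  · exact (InnerProductSpace.toDual ℝ (M d)).symm.toContinuousLinearEquiv.contDiff.comp
      (hφ.1.fderiv_right (m := ∞) (by simp))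
  · exact (hφ.2.fderiv (𝕜 := ℝ)).comp_left (g := (InnerProductSpace.toDual ℝ (M d)).symm)
      (map_zero _)

lemma IsTest.exists_bound {E : Type*} [NormedAddCommGroup E] [NormedSpace ℝ E] {f : M d → E}
    (hf : IsTest f) : ∃ C, 0 ≤ C ∧ ∀ x, ‖f x‖ ≤ C := by
  obtain ⟨C, hC⟩ := hf.2.exists_bound_of_continuous hf.1.continuous
  exact ⟨C, (norm_nonneg _).trans (hC 0), hC⟩

lemma IsTest.fderiv {E : Type*} [NormedAddCommGroup E] [NormedSpace ℝ E] {f : M d → E}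
    (hf : IsTest f) : IsTest (fderiv ℝ f) :=
  ⟨hf.1.fderiv_right (m := ∞) (by simp), hf.2.fderiv (𝕜 := ℝ)⟩

/-- The gradients of compactly supported `C¹` functions are uniform limits of gradients of test
functions. -/
lemma exists_isTest_norm_gradient_sub_le {g : M d → ℝ} (hg : ContDiff ℝ 1 g)
    (hc : HasCompactSupport g) {ε : ℝ} (hε : 0 < ε) :
    ∃ φ : M d → ℝ, IsTest φ ∧ ∀ x, ‖gradient φ x - gradient g x‖ ≤ ε := by
  have hcont : Continuous (fderiv ℝ g) := hg.continuous_fderiv (by norm_num)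
  have huc : UniformContinuous (fderiv ℝ g) :=
    (hc.fderiv (𝕜 := ℝ)).uniformContinuous_of_continuous hcont
  obtain ⟨δ, hδ, hδ'⟩ := Metric.uniformContinuous_iff.1 huc ε hε
  let b : ContDiffBump (0 : M d) := ⟨δ / 2, δ, half_pos hδ, half_lt_self hδ⟩
  -- The derivative of the mollification is then the mollification of `fderiv ℝ g`, so uniform
  -- continuity of the latter with the bump radius `δ` gives the uniform bound.
  have hL : (ContinuousLinearMap.lsmul ℝ ℝ : ℝ →L[ℝ] ℝ →L[ℝ] ℝ).precompR (M d)
      = (ContinuousLinearMap.lsmul ℝ ℝ : ℝ →L[ℝ] (M d →L[ℝ] ℝ) →L[ℝ] (M d →L[ℝ] ℝ)) := by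
    ext a f
    simp [ContinuousLinearMap.precompR_apply]
  refine ⟨convolution (b.normed volume) g (ContinuousLinearMap.lsmul ℝ ℝ) volume, ⟨?_, ?_⟩, ?_⟩
  · exact b.hasCompactSupport_normed.contDiff_convolution_left _ b.contDiff_normed
      hg.continuous.locallyIntegrable
  · exact b.hasCompactSupport_normed.convolution _ hc
  · intro x
    have h1 := hc.hasFDerivAt_convolution_right (ContinuousLinearMap.lsmul ℝ ℝ : ℝ →L[ℝ] ℝ →L[ℝ] ℝ)
      ((b.continuous_normed (μ := (volume : Measure (M d)))).locallyIntegrable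
        (μ := (volume : Measure (M d)))) hg x
    rw [hL] at h1
    rw [gradient, gradient, ← map_sub, LinearIsometryEquiv.norm_map, h1.fderiv, ← dist_eq_norm]
    exact b.dist_normed_convolution_le hcont.aestronglyMeasurable fun y hy => (hδ' hy).le

/-- Cut off by $h_n(x)=\chi(s_nx)\,g(x)$ with $s_n\to0$. The function $g$ may grow quadratically,
but on the support of $\nabla\chi(s_n\cdot)$ one has $s_n|x|\le2$, so $s_n\,g\,\nabla\chi(s_n\cdot)$
grows only linearly, uniformly in $n$. The finite second moment then permits dominated convergence.
-/
lemma exists_hasCompactSupport_integral_le {g : M d → ℝ} (hg : ContDiff ℝ 1 g) {C : ℝ}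
    (hC : ∀ x, ‖gradient g x‖ ≤ C * (1 + ‖x‖)) (m : P2 d) {ε : ℝ} (hε : 0 < ε) :
    ∃ h : M d → ℝ, ContDiff ℝ 1 h ∧ HasCompactSupport h ∧
      ∫ x, ‖gradient h x - gradient g x‖ ^ 2 ∂m.1 < ε := by
  have hC0 : 0 ≤ C := by simpa using (norm_nonneg _).trans (hC 0)
  let χ : ContDiffBump (0 : M d) := ⟨1, 2, one_pos, one_lt_two⟩
  have hχc : ContDiff ℝ 1 χ := χ.contDiff
  obtain ⟨K, hK⟩ := (χ.hasCompactSupport.fderiv (𝕜 := ℝ)).exists_bound_of_continuous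
    (hχc.continuous_fderiv (by norm_num))
  have hK0 : 0 ≤ K := (norm_nonneg _).trans (hK 0)
  have hgrow : ∀ x, |g x| ≤ |g 0| + C * (1 + ‖x‖) * ‖x‖ := by
    intro x
    have := (convex_closedBall (0 : M d) ‖x‖).norm_image_sub_le_of_norm_fderiv_le (𝕜 := ℝ) (f := g)
      (C := C * (1 + ‖x‖)) (fun y _ => hg.differentiable (by norm_num) y)
      (fun y hy => by
        rw [← norm_gradient]
        refine (hC y).trans ?_
        have : ‖y‖ ≤ ‖x‖ := by simpa using hy
        gcongr) (x := 0) (y := x) (by simp) (by simp)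
    rw [sub_zero, Real.norm_eq_abs] at this
    have h2 := abs_sub_abs_le_abs_sub (g x) (g 0)
    linarith
  let s : ℕ → ℝ := fun n => ((n : ℝ) + 1)⁻¹
  have hs0 : ∀ n, 0 < s n := fun n => by positivity
  have hs1 : ∀ n, s n ≤ 1 := fun n => inv_le_one_of_one_le₀ (by simp)
  have hslim : Tendsto s atTop (𝓝 0) := by
    simpa [s] using tendsto_one_div_add_atTop_nhds_zero_nat (𝕜 := ℝ)
  let h : ℕ → M d → ℝ := fun n x => χ (s n • x) * g x
  have hd : ∀ n x, fderiv ℝ (h n) x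
      = χ (s n • x) • fderiv ℝ g x + (g x * s n) • fderiv ℝ χ (s n • x) := by
    intro n x
    have h1 : HasFDerivAt (fun x => χ (s n • x)) (s n • fderiv ℝ χ (s n • x)) x := by
      have := ((hχc.differentiable (by norm_num)) (s n • x)).hasFDerivAt.comp x
        ((hasFDerivAt_id x).const_smul (s n))
      refine this.congr_fderiv ?_
      ext v
      simp
    have : HasFDerivAt (h n) _ x := h1.mul (hg.differentiable (by norm_num) x).hasFDerivAt
    rw [this.fderiv, smul_smul]
  have hcd : ∀ n, ContDiff ℝ 1 (h n) := fun n =>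
    (hχc.comp (contDiff_id.const_smul (s n))).mul hg
  have hcs : ∀ n, HasCompactSupport (h n) := fun n =>
    (χ.hasCompactSupport.comp_smul (hs0 n).ne').mul_right
  have hbound : ∀ n x, ‖gradient (h n) x - gradient g x‖
      ≤ (C + K * (|g 0| + 2 * C)) * (1 + ‖x‖) := by
    intro n x
    rw [gradient, gradient, ← map_sub, LinearIsometryEquiv.norm_map, hd]
    have e1 : χ (s n • x) • fderiv ℝ g x + (g x * s n) • fderiv ℝ χ (s n • x) - fderiv ℝ g x
        = (χ (s n • x) - 1) • fderiv ℝ g x + (g x * s n) • fderiv ℝ χ (s n • x) := by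
      rw [sub_smul, one_smul]; abel
    rw [e1]
    have a1 : ‖(χ (s n • x) - 1) • fderiv ℝ g x‖ ≤ C * (1 + ‖x‖) := by
      rw [norm_smul, ← norm_gradient]
      have : ‖χ (s n • x) - 1‖ ≤ 1 := by
        rw [Real.norm_eq_abs, abs_le]
        constructor <;> linarith [χ.nonneg (x := s n • x), χ.le_one (x := s n • x)]
      calc _ ≤ 1 * (C * (1 + ‖x‖)) := by gcongr; exact hC x
        _ = _ := one_mul _
    have a2 : ‖(g x * s n) • fderiv ℝ χ (s n • x)‖ ≤ K * (|g 0| + 2 * C) * (1 + ‖x‖) := by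
      by_cases hx : s n * ‖x‖ ≤ 2
      · rw [norm_smul, Real.norm_eq_abs, abs_mul, abs_of_pos (hs0 n)]
        have : |g x| * s n ≤ (|g 0| + 2 * C) * (1 + ‖x‖) := by
          calc |g x| * s n ≤ (|g 0| + C * (1 + ‖x‖) * ‖x‖) * s n := by
                have := hgrow x; have := hs0 n; gcongr
            _ = |g 0| * s n + C * (1 + ‖x‖) * (s n * ‖x‖) := by ring
            _ ≤ |g 0| * 1 + C * (1 + ‖x‖) * 2 := by have := hs1 n; gcongr
            _ ≤ (|g 0| + 2 * C) * (1 + ‖x‖) := by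
                nlinarith [mul_nonneg (abs_nonneg (g 0)) (norm_nonneg x)]
        calc |g x| * s n * ‖fderiv ℝ χ (s n • x)‖
            ≤ ((|g 0| + 2 * C) * (1 + ‖x‖)) * K := by
              have := hK (s n • x); gcongr
          _ = _ := by ring
      · have hz : fderiv ℝ χ (s n • x) = 0 := by
          have : s n • x ∉ tsupport (χ : M d → ℝ) := by
            rw [χ.tsupport_eq]
            simp only [Metric.mem_closedBall, dist_zero_right, norm_smul, Real.norm_eq_abs,
              abs_of_pos (hs0 n)]
            exact hx
          by_contra hne
          exact this (support_fderiv_subset ℝ hne)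
        rw [hz, smul_zero, norm_zero]
        positivity
    calc _ ≤ _ := norm_add_le _ _
      _ ≤ C * (1 + ‖x‖) + K * (|g 0| + 2 * C) * (1 + ‖x‖) := add_le_add a1 a2
      _ = _ := by ring
  have hpt : ∀ x, Tendsto (fun n => ‖gradient (h n) x - gradient g x‖ ^ 2) atTop (𝓝 0) := by
    intro x
    have t0 : Tendsto (fun n => s n • x) atTop (𝓝 0) := by
      simpa using hslim.smul_const x
    have t1 : Tendsto (fun n => χ (s n • x)) atTop (𝓝 1) := by
      have h1 : χ (0 : M d) = 1 := χ.one_of_mem_closedBall (by simp [χ])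
      rw [← h1]
      exact (hχc.continuous.tendsto 0).comp t0
    have t2 : Tendsto (fun n => fderiv ℝ χ (s n • x)) atTop (𝓝 (fderiv ℝ χ 0)) :=
      ((hχc.continuous_fderiv (by norm_num)).tendsto 0).comp t0
    have t3 : Tendsto (fun n => fderiv ℝ (h n) x) atTop (𝓝 (fderiv ℝ g x)) := by
      have := (t1.smul_const (fderiv ℝ g x)).add ((hslim.const_mul (g x)).smul t2)
      simp only [hd]
      simpa using this
    have t4 : Tendsto (fun n => ‖fderiv ℝ (h n) x - fderiv ℝ g x‖ ^ 2) atTop (𝓝 0) := by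
      have := ((t3.sub_const (fderiv ℝ g x)).norm).pow 2
      simpa using this
    refine t4.congr fun n => ?_
    rw [gradient, gradient, ← map_sub, LinearIsometryEquiv.norm_map]
  have hint : Tendsto (fun n => ∫ x, ‖gradient (h n) x - gradient g x‖ ^ 2 ∂m.1) atTop
      (𝓝 (∫ _, (0 : ℝ) ∂m.1)) := by
    refine tendsto_integral_of_dominated_convergence
      (fun x => ((C + K * (|g 0| + 2 * C)) * (1 + ‖x‖)) ^ 2) ?_ ?_ ?_ ?_
    · intro n
      exact (((continuous_gradient (hcd n)).sub
        (continuous_gradient hg)).norm.pow 2).aestronglyMeasurable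
    · have : MemLp (fun x : M d => (C + K * (|g 0| + 2 * C)) * (1 + ‖x‖)) 2 m.1 :=
        ((memLp_const (1 : ℝ)).add (memLp_id m).norm).const_mul _
      exact this.integrable_sq
    · intro n
      refine ae_of_all _ fun x => ?_
      rw [Real.norm_eq_abs, abs_of_nonneg (by positivity)]
      have := hbound n x
      gcongr
    · exact ae_of_all _ hpt
  rw [integral_zero] at hint
  obtain ⟨n, hn⟩ := (hint.eventually (gt_mem_nhds hε)).exists
  exact ⟨h n, hcd n, hcs n, hn⟩

/-- A continuous gradient of linear growth is approximated in `L²(m)` by gradients of test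
functions. -/
theorem mem_closure_gradient_isTest {g : M d → ℝ} (hg : ContDiff ℝ 1 g) {C : ℝ}
    (hC : ∀ x, ‖gradient g x‖ ≤ C * (1 + ‖x‖)) {m : P2 d} {z : L2 m}
    (hz : z =ᵐ[m.1] gradient g) :
    z ∈ closure {z : L2 m | ∃ φ : M d → ℝ, IsTest φ ∧ z =ᵐ[m.1] gradient φ} := by
  rw [Metric.mem_closure_iff]
  intro ε hε
  obtain ⟨h, hh, hhc, hlt⟩ := exists_hasCompactSupport_integral_le hg hC m
    (ε := (ε / 2) ^ 2) (by positivity)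
  obtain ⟨φ, hφ, hle⟩ := exists_isTest_norm_gradient_sub_le hh hhc (half_pos hε)
  have memφ : MemLp (gradient φ) 2 m.1 := by
    obtain ⟨B, -, hB⟩ := hφ.gradient.exists_bound
    exact MemLp.of_bound hφ.gradient.1.continuous.aestronglyMeasurable B (ae_of_all _ hB)
  have memh : MemLp (gradient h) 2 m.1 := by
    obtain ⟨B, hB⟩ := (hhc.fderiv (𝕜 := ℝ)).exists_bound_of_continuous
      (hh.continuous_fderiv (by norm_num))
    exact MemLp.of_bound (continuous_gradient hh).aestronglyMeasurable B
      (ae_of_all _ fun x => by rw [norm_gradient]; exact hB x)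
  refine ⟨memφ.toLp, ⟨φ, hφ, memφ.coeFn_toLp⟩, ?_⟩
  have d1 : ‖memh.toLp - z‖ < ε / 2 := by
    refine lt_of_pow_lt_pow_left₀ 2 (by positivity) ?_
    rwa [norm_sub_sq_eq_integral memh.coeFn_toLp hz]
  have d2 : ‖memφ.toLp - memh.toLp‖ ≤ ε / 2 := by
    refine (sq_le_sq₀ (norm_nonneg _) (by positivity)).1 ?_
    rw [norm_sub_sq_eq_integral memφ.coeFn_toLp memh.coeFn_toLp]
    calc ∫ x, ‖gradient φ x - gradient h x‖ ^ 2 ∂m.1 ≤ ∫ _, (ε / 2) ^ 2 ∂m.1 := by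
          refine integral_mono ((memφ.sub memh).integrable_norm_pow (by norm_num))
            (integrable_const _) fun x => ?_
          have := hle x
          dsimp only
          gcongr
      _ = (ε / 2) ^ 2 := by simp
  rw [dist_comm, dist_eq_norm]
  calc ‖memφ.toLp - z‖ = ‖(memφ.toLp - memh.toLp) + (memh.toLp - z)‖ := by congr 1; abel
    _ ≤ _ := norm_add_le _ _
    _ < ε := by linarith

theorem mem_tangent_of_gradient {g : M d → ℝ} (hg : ContDiff ℝ 1 g) {C : ℝ}
    (hC : ∀ x, ‖gradient g x‖ ≤ C * (1 + ‖x‖)) {m : P2 d} {z : L2 m}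
    (hz : z =ᵐ[m.1] gradient g) : z ∈ tangent m := by
  have := mem_closure_gradient_isTest hg hC hz
  rw [tangent, ← SetLike.mem_coe, Submodule.topologicalClosure_coe]
  exact closure_mono Submodule.subset_span this

lemma mem_orthogonal_tangent {m : P2 d} {η : L2 m}
    (h : ∀ φ : M d → ℝ, IsTest φ → ∫ x, ⟪gradient φ x, η x⟫ ∂m.1 = 0) : η ∈ (tangent m)ᗮ := by
  rw [tangent, Submodule.orthogonal_closure, Submodule.mem_orthogonal]
  intro u hu
  induction hu using Submodule.span_induction with
  | mem z hz =>
    obtain ⟨φ, hφ, hz⟩ := hz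
    rw [inner_L2_eq_integral hz (EventuallyEq.refl _ _), h φ hφ]
  | zero => simp
  | add a b _ _ ha hb => rw [inner_add_left, ha, hb, add_zero]
  | smul c a _ ha => rw [real_inner_smul_left, ha, mul_zero]

/-- The tangent space is stable under averaging. -/
theorem mem_tangent_of_integral {Ω : Type*} [MeasurableSpace Ω] {μ : Measure Ω} [SFinite μ]
    {m : P2 d} {F : Ω → M d → M d} (hF : Measurable (Function.uncurry F)) {b : Ω → ℝ}
    {c : M d → ℝ} (hb : Integrable b μ) (hc : MemLp c 2 m.1)
    (hbound : ∀ t a, ‖F t a‖ ≤ b t * c a)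
    (hmem : ∀ t, ∃ z ∈ tangent m, z =ᵐ[m.1] F t) {z : L2 m}
    (hz : z =ᵐ[m.1] fun a => ∫ t, F t a ∂μ) : z ∈ tangent m := by
  -- Membership in a closed subspace is tested against its orthogonal complement, and Fubini moves
  -- the test inside the average. This avoids any Bochner integral with values in `L2 m`.
  rw [← Submodule.orthogonal_orthogonal (tangent m), Submodule.mem_orthogonal]
  intro η hη
  rw [inner_L2_eq_integral (EventuallyEq.refl _ _) hz]
  have hηm : MemLp (fun a => η a) 2 m.1 := Lp.memLp η
  have e1 : ∀ a, ⟪η a, ∫ t, F t a ∂μ⟫ = ∫ t, ⟪η a, F t a⟫ ∂μ := by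
    intro a
    rw [integral_inner]
    refine (hb.mul_const (c a)).mono' ?_ (ae_of_all _ fun t => hbound t a)
    exact (hF.comp (measurable_id.prodMk measurable_const)).aestronglyMeasurable
  simp_rw [e1]
  rw [integral_integral_swap]
  · have e2 : ∀ t, ∫ a, ⟪η a, F t a⟫ ∂m.1 = 0 := by
      intro t
      obtain ⟨w, hw, hwF⟩ := hmem t
      rw [← inner_L2_eq_integral (EventuallyEq.refl _ _) hwF, real_inner_comm]
      exact (Submodule.mem_orthogonal _ _).1 hη w hw
    simp [e2]
  · have h1 : Integrable (fun a => ‖η a‖ * c a) m.1 := hηm.norm.integrable_mul hc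
    refine (h1.mul_prod hb).mono' ?_ (ae_of_all _ fun p => ?_)
    · refine AEStronglyMeasurable.inner ?_ ?_
      · exact hηm.1.comp_fst
      · exact (hF.comp measurable_swap).aestronglyMeasurable
    · refine (norm_inner_le_norm _ _).trans ?_
      calc ‖η p.1‖ * ‖F p.2 p.1‖ ≤ ‖η p.1‖ * (b p.2 * c p.1) := by
            gcongr; exact hbound _ _
        _ = _ := by ring

end Tangent

end

noncomputable section

/-! ### First order expansions -/

section FirstOrder

variable {d : ℕ}

lemma finite_secondMoment_of_memLp {Ω : Type*} [MeasurableSpace Ω] {μ : Measure Ω}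
    {T : Ω → M d} (hT : MemLp T 2 μ) : ∫⁻ x, ‖T x‖ₑ ^ 2 ∂μ < ⊤ := by
  have := (eLpNorm_lt_top_iff_lintegral_rpow_enorm_lt_top (by norm_num) (by norm_num)).1 hT.2
  simpa using this

/-- The image of a measure of `P₂(ℝᵈ)` under a square integrable map. -/
def P2.push (m : P2 d) (T : M d → M d) (hTm : Measurable T) (hT : MemLp T 2 m.1) : P2 d :=
  ⟨m.1.map T, Measure.isProbabilityMeasure_map hTm.aemeasurable, by
    rw [lintegral_map (by fun_prop) hTm]
    exact finite_secondMoment_of_memLp hT⟩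

/-- The map `x ↦ x + t ∇φ(x)`. -/
def perturb (φ : M d → ℝ) (t : ℝ) (x : M d) : M d := x + t • gradient φ x

lemma continuous_perturb {φ : M d → ℝ} (hφ : IsTest φ) (t : ℝ) : Continuous (perturb φ t) :=
  continuous_id.add ((hφ.gradient.1.continuous).const_smul t)

lemma IsTest.memLp {f : M d → M d} (hf : IsTest f) (m : P2 d) : MemLp f 2 m.1 := by
  obtain ⟨B, -, hB⟩ := hf.exists_bound
  exact MemLp.of_bound hf.1.continuous.aestronglyMeasurable B (ae_of_all _ hB)

lemma memLp_perturb {φ : M d → ℝ} (hφ : IsTest φ) (t : ℝ) (m : P2 d) :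
    MemLp (perturb φ t) 2 m.1 :=
  (memLp_id m).add ((hφ.gradient.memLp m).const_smul t)

/-- The image of `m` under `x ↦ x + t ∇φ(x)`. -/
def P2.pushGradient (m : P2 d) {φ : M d → ℝ} (hφ : IsTest φ) (t : ℝ) : P2 d :=
  m.push (perturb φ t) (continuous_perturb hφ t).measurable (memLp_perturb hφ t m)

lemma graph_mem_couplings (m : P2 d) (T : M d → M d) (hTm : Measurable T)
    (hT : MemLp T 2 m.1) : m.1.map (fun x => (x, T x)) ∈ couplings m (m.push T hTm hT) := by
  constructor
  · rw [Measure.map_map measurable_fst (by fun_prop)]; exact Measure.map_id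
  · rw [Measure.map_map measurable_snd (by fun_prop)]; rfl

lemma integral_graph (m : P2 d) {φ : M d → ℝ} (hφ : IsTest φ) (t : ℝ) :
    ∫ p, ‖p.2 - p.1‖ ^ 2 ∂(m.1.map fun x => (x, perturb φ t x))
      = t ^ 2 * ∫ x, ‖gradient φ x‖ ^ 2 ∂m.1 := by
  have := (continuous_perturb hφ t).measurable
  rw [integral_map (by fun_prop) (by fun_prop), ← integral_const_mul]
  refine integral_congr_ae (ae_of_all _ fun x => ?_)
  simp [perturb, norm_smul, mul_pow]

lemma W2_pushGradient_le (m : P2 d) {φ : M d → ℝ} (hφ : IsTest φ) {t : ℝ} (ht : 0 ≤ t) :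
    W2 m (m.pushGradient hφ t) ≤ t * √(∫ x, ‖gradient φ x‖ ^ 2 ∂m.1) := by
  have h := W2_sq_le (graph_mem_couplings m (perturb φ t) (continuous_perturb hφ t).measurable
    (memLp_perturb hφ t m))
  rw [integral_graph m hφ] at h
  have h0 : 0 ≤ ∫ x, ‖gradient φ x‖ ^ 2 ∂m.1 := integral_nonneg fun x => by positivity
  refine (sq_le_sq₀ (W2_nonneg _ _) (by positivity)).1 ?_
  rw [mul_pow, Real.sq_sqrt h0]
  exact h

/-- Both bounds come from a bound on the second derivative. The one-sided inequality is
semiconvexity of `φ`, which is what forces optimality of the map $\mathrm{id}+t\nabla\varphi$. -/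
lemma exists_lipschitz_gradient_of_isTest {φ : M d → ℝ} (hφ : IsTest φ) :
    ∃ L, 0 ≤ L ∧ (∀ x y, ‖gradient φ x - gradient φ y‖ ≤ L * ‖x - y‖) ∧
      ∀ x y, φ x - φ y - ⟪gradient φ y, x - y⟫ ≥ - (L * ‖x - y‖ ^ 2) := by
  obtain ⟨L, hL0, hL⟩ := hφ.gradient.fderiv.exists_bound
  have hlip : ∀ x y, ‖gradient φ x - gradient φ y‖ ≤ L * ‖x - y‖ := fun x y =>
    convex_univ.norm_image_sub_le_of_norm_fderiv_le
      (fun z _ => hφ.gradient.1.differentiable (by simp) z) (fun z _ => hL z)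
      (mem_univ y) (mem_univ x)
  refine ⟨L, hL0, hlip, fun x y => ?_⟩
  have h1 := (convex_segment y x).norm_image_sub_le_of_norm_fderiv_le' (𝕜 := ℝ) (f := φ)
    (φ := fderiv ℝ φ y) (C := L * ‖x - y‖) (fun z _ => hφ.1.differentiable (by simp) z)
    (fun z hz => by
      have h2 : ‖fderiv ℝ φ z - fderiv ℝ φ y‖ = ‖gradient φ z - gradient φ y‖ := by
        rw [gradient, gradient, ← map_sub, LinearIsometryEquiv.norm_map]
      rw [h2]
      refine (hlip z y).trans ?_
      have := norm_sub_le_of_mem_segment hz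
      gcongr) (left_mem_segment ℝ y x) (right_mem_segment ℝ y x)
  rw [inner_gradient_apply]
  have := neg_abs_le (φ x - φ y - fderiv ℝ φ y (x - y))
  rw [Real.norm_eq_abs] at h1
  nlinarith

/-- For small `t`, every optimal coupling between `m` and its image under `id + t ∇φ` is
concentrated on the graph of that map. -/
theorem eq_perturb_of_mem_optCouplings {φ : M d → ℝ} (hφ : IsTest φ) :
    ∃ t₀ > 0, ∀ t, 0 < t → t < t₀ → ∀ m : P2 d, ∀ γ ∈ optCouplings m (m.pushGradient hφ t),
      ∀ᵐ p ∂γ, p.2 = perturb φ t p.1 := by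
  obtain ⟨L, hL0, hlip, hconv⟩ := exists_lipschitz_gradient_of_isTest hφ
  -- This ensures `2 * t * L < 1`, which makes `perturb φ t` injective and keeps the coefficient `1
  -- - 2 * t * L` positive below.
  refine ⟨1 / (2 * (L + 1)), by positivity, fun t ht htt m γ hγ => ?_⟩
  have htL : 2 * t * L < 1 := by
    rw [lt_div_iff₀ (by positivity)] at htt
    nlinarith
  have hTc := continuous_perturb hφ t
  have hTinj : Function.Injective (perturb φ t) := by
    intro x y hxy
    have h1 : x - y = -(t • (gradient φ x - gradient φ y)) := by
      rw [perturb, perturb] at hxy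
      rw [smul_sub, neg_sub, sub_eq_sub_iff_add_eq_add, hxy, add_comm]
    have h2 : ‖x - y‖ ≤ t * (L * ‖x - y‖) := by
      calc ‖x - y‖ = t * ‖gradient φ x - gradient φ y‖ := by
            conv_lhs => rw [h1]
            rw [norm_neg, norm_smul, Real.norm_eq_abs, abs_of_pos ht]
        _ ≤ _ := by gcongr; exact hlip x y
    have : ‖x - y‖ ≤ 0 := by nlinarith [norm_nonneg (x - y)]
    exact sub_eq_zero.1 (norm_le_zero_iff.1 this)
  -- `S` is a measurable left inverse of `perturb φ t`. The goal becomes `p.1 = S p.2` almost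
  -- everywhere.
  obtain ⟨S, hS, hST⟩ := (hTc.measurableEmbedding hTinj).exists_measurable_extend
    measurable_id (fun _ => ⟨0⟩)
  have hST' : ∀ x, S (perturb φ t x) = x := fun x => congrFun hST x
  have := isProbabilityMeasure_of_mem_couplings hγ.1
  have hfst := measurePreserving_fst_coupling hγ.1
  have hsnd := measurePreserving_snd_coupling hγ.1
  have hTS : ∀ᵐ p ∂γ, perturb φ t (S p.2) = p.2 := by
    refine hsnd.quasiMeasurePreserving.ae (p := fun y => perturb φ t (S y) = y) ?_
    change ∀ᵐ y ∂(m.1.map (perturb φ t)), perturb φ t (S y) = y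
    refine (ae_map_iff hTc.measurable.aemeasurable (measurableSet_eq_fun
      (f := fun y => perturb φ t (S y)) (hTc.measurable.comp hS) measurable_id)).2 ?_
    exact ae_of_all _ fun x => by rw [hST']; rfl
  have hSmem : MemLp (fun p : M d × M d => S p.2) 2 γ := by
    have h1 : MemLp S 2 (m.pushGradient hφ t).1 := by
      change MemLp S 2 (m.1.map (perturb φ t))
      rw [memLp_map_measure_iff hS.aestronglyMeasurable hTc.measurable.aemeasurable, hST]
      exact memLp_id m
    exact h1.comp_measurePreserving hsnd
  have hsub : MemLp (fun p : M d × M d => p.1 - S p.2) 2 γ := (memLp_fst_coupling hγ.1).sub hSmem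
  obtain ⟨B, hB0, hB⟩ := hφ.exists_bound
  have hi1 : Integrable (fun p : M d × M d => φ p.1) γ :=
    Integrable.of_bound (hφ.1.continuous.comp continuous_fst).aestronglyMeasurable B
      (ae_of_all _ fun p => hB _)
  have hi2 : Integrable (fun p : M d × M d => φ (S p.2)) γ :=
    Integrable.of_bound (hφ.1.continuous.measurable.comp
      (hS.comp measurable_snd)).aestronglyMeasurable B (ae_of_all _ fun p => hB _)
  have hi3 : Integrable (fun p : M d × M d => ‖p.2 - S p.2‖ ^ 2) γ :=
    ((memLp_snd_coupling hγ.1).sub hSmem).integrable_norm_pow (by norm_num)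
  have hi4 : Integrable (fun p : M d × M d => ‖p.1 - S p.2‖ ^ 2) γ :=
    hsub.integrable_norm_pow (by norm_num)
  -- Expand the square around `S p.2` and use semiconvexity. Upon integration the terms in `φ`
  -- cancel, since `p.1` and `S p.2` both have law `m`, and `‖p.2 - S p.2‖ ^ 2` integrates to the
  -- cost of the graph, which is at least the squared distance. Only
  -- $\int|p_1-S(p_2)|^2\,d\gamma\le0$ survives.
  have hpt : ∀ᵐ p ∂γ, (1 - 2 * t * L) * ‖p.1 - S p.2‖ ^ 2 - 2 * t * (φ p.1 - φ (S p.2))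
      + ‖p.2 - S p.2‖ ^ 2 ≤ ‖p.2 - p.1‖ ^ 2 := by
    filter_upwards [hTS] with p hp
    have e1 : p.2 - S p.2 = t • gradient φ (S p.2) := by
      nth_rw 1 [← hp]; simp [perturb]
    have e2 : p.2 - p.1 = t • gradient φ (S p.2) - (p.1 - S p.2) := by
      rw [← e1]; abel
    rw [e2, norm_sub_sq_real (t • gradient φ (S p.2)), e1, real_inner_smul_left]
    have := hconv p.1 (S p.2)
    nlinarith
  have hint := integral_mono_ae (((hi4.const_mul (1 - 2 * t * L)).sub
    ((hi1.sub hi2).const_mul (2 * t))).add hi3) (integrable_norm_sub_sq_coupling hγ.1) hpt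
  have E1 : ∫ p, φ p.1 ∂γ = ∫ x, φ x ∂m.1 := by
    rw [← hγ.1.1, integral_map measurable_fst.aemeasurable
      hφ.1.continuous.aestronglyMeasurable]
  have E2 : ∫ p, φ (S p.2) ∂γ = ∫ x, φ x ∂m.1 := by
    have : ∫ p, φ (S p.2) ∂γ = ∫ y, φ (S y) ∂(γ.map Prod.snd) :=
      (integral_map measurable_snd.aemeasurable
        (hφ.1.continuous.measurable.comp hS).aestronglyMeasurable).symm
    rw [this, hγ.1.2]
    change ∫ y, φ (S y) ∂(m.1.map (perturb φ t)) = _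
    have h2 := integral_map (μ := m.1) hTc.measurable.aemeasurable
      (f := fun y => φ (S y)) (hφ.1.continuous.measurable.comp hS).aestronglyMeasurable
    rw [h2]
    simp_rw [hST']
  have E3 : ∫ p, ‖p.2 - S p.2‖ ^ 2 ∂γ = t ^ 2 * ∫ x, ‖gradient φ x‖ ^ 2 ∂m.1 := by
    have hm : Measurable fun y => ‖y - S y‖ ^ 2 := by fun_prop
    have : ∫ p, ‖p.2 - S p.2‖ ^ 2 ∂γ = ∫ y, ‖y - S y‖ ^ 2 ∂(γ.map Prod.snd) :=
      (integral_map measurable_snd.aemeasurable hm.aestronglyMeasurable).symm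
    rw [this, hγ.1.2]
    change ∫ y, ‖y - S y‖ ^ 2 ∂(m.1.map (perturb φ t)) = _
    rw [integral_map hTc.measurable.aemeasurable hm.aestronglyMeasurable,
      ← integral_const_mul]
    refine integral_congr_ae (ae_of_all _ fun x => ?_)
    dsimp only
    rw [hST']
    simp [perturb, norm_smul, mul_pow]
  have E4 := W2_sq_le (graph_mem_couplings m (perturb φ t) hTc.measurable
    (memLp_perturb hφ t m))
  rw [integral_graph m hφ] at E4
  have E5 := W2_sq_eq hγ
  rw [integral_add' ((hi4.const_mul _).sub ((hi1.sub hi2).const_mul _)) hi3,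
    integral_sub' (hi4.const_mul _) ((hi1.sub hi2).const_mul _), integral_const_mul,
    integral_const_mul, integral_sub' hi1 hi2, E1, E2, E3, E5] at hint
  have hzero : ∫ p, ‖p.1 - S p.2‖ ^ 2 ∂γ = 0 := by
    refine le_antisymm ?_ (integral_nonneg fun p => by positivity)
    have h3 : W2 m (m.pushGradient hφ t) ^ 2 ≤ t ^ 2 * ∫ x, ‖gradient φ x‖ ^ 2 ∂m.1 := E4
    have : (1 - 2 * t * L) * ∫ p, ‖p.1 - S p.2‖ ^ 2 ∂γ ≤ 0 := by linarith
    by_contra hcon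
    push Not at hcon
    nlinarith
  rw [integral_eq_zero_iff_of_nonneg (fun p => by positivity) hi4] at hzero
  filter_upwards [hzero, hTS] with p h1 h2
  have h3 : p.1 = S p.2 := by
    have : ‖p.1 - S p.2‖ ^ 2 = 0 := h1
    exact sub_eq_zero.1 (norm_eq_zero.1 (pow_eq_zero_iff (two_ne_zero) |>.1 this))
  rw [h3, h2]

lemma integral_of_ae_eq_graph {m ν : P2 d} {γ : Measure (M d × M d)} (hγ : γ ∈ couplings m ν)
    {T : M d → M d} (hT : ∀ᵐ p ∂γ, p.2 = T p.1) {E : Type*} [NormedAddCommGroup E]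
    [NormedSpace ℝ E] (h : M d → M d → E)
    (hm : AEStronglyMeasurable (fun x => h x (T x)) m.1) :
    ∫ p, h p.1 p.2 ∂γ = ∫ x, h x (T x) ∂m.1 := by
  rw [← hγ.1] at hm ⊢
  rw [integral_map measurable_fst.aemeasurable hm]
  refine integral_congr_ae ?_
  filter_upwards [hT] with p hp
  rw [hp]

/-- `U[ν] - U[m] = ∫ G(x) · (y - x) γ(dx, dy) + o(W₂(m, ν))` for all optimal couplings. -/
def HasWExpansion (U : P2 d → ℝ) (m : P2 d) (G : M d → M d) : Prop :=
  ∀ ε > 0, ∃ δ > 0, ∀ ν : P2 d, W2 m ν < δ → ∀ γ ∈ optCouplings m ν,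
    |U ν - U m - ∫ p, ⟪G p.1, p.2 - p.1⟫ ∂γ| ≤ ε * W2 m ν

lemma HasWExpansion.congr {U : P2 d → ℝ} {m : P2 d} {G G' : M d → M d}
    (h : HasWExpansion U m G) (hG : G =ᵐ[m.1] G') : HasWExpansion U m G' := by
  intro ε hε
  obtain ⟨δ, hδ, H⟩ := h ε hε
  refine ⟨δ, hδ, fun ν hν γ hγ => ?_⟩
  have : ∫ p, ⟪G' p.1, p.2 - p.1⟫ ∂γ = ∫ p, ⟪G p.1, p.2 - p.1⟫ ∂γ := by
    refine integral_congr_ae ?_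
    filter_upwards [(measurePreserving_fst_coupling hγ.1).quasiMeasurePreserving.ae hG] with p hp
    rw [hp]
  rw [this]
  exact H ν hν γ hγ

lemma HasWExpansion.neg {U : P2 d → ℝ} {m : P2 d} {G : M d → M d}
    (h : HasWExpansion U m G) : HasWExpansion (fun ν => - U ν) m (-G) := by
  intro ε hε
  obtain ⟨δ, hδ, H⟩ := h ε hε
  refine ⟨δ, hδ, fun ν hν γ hγ => ?_⟩
  rw [← abs_neg]
  convert H ν hν γ hγ using 2
  simp only [Pi.neg_apply, inner_neg_left, integral_neg]
  ring

lemma HasWExpansion.mem_subdiff {U : P2 d → ℝ} {m : P2 d} {z : L2 m}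
    (h : HasWExpansion U m z) : z ∈ subdiff U m := by
  intro ε hε
  obtain ⟨δ, hδ, H⟩ := h ε hε
  refine ⟨δ, hδ, fun ν hν => ?_⟩
  obtain ⟨γ, hγ⟩ := optCouplings_nonempty m ν
  -- A real `sInf` of a set unbounded below is `0` by convention, so a lower bound is required; the
  -- expansion supplies one uniformly over all optimal couplings.
  have hbdd : BddBelow ((fun γ : Measure (M d × M d) => ∫ p, ⟪z p.1, p.2 - p.1⟫ ∂γ) ''
      optCouplings m ν) := by
    refine ⟨U ν - U m - ε * W2 m ν, ?_⟩
    rintro _ ⟨γ', hγ', rfl⟩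
    have := (abs_le.1 (H ν hν γ' hγ')).2
    linarith
  have h1 := csInf_le hbdd (mem_image_of_mem _ hγ)
  have h2 := (abs_le.1 (H ν hν γ hγ)).1
  beta_reduce at h1
  linarith

/-- Move `m` along $\mathrm{id}+t\nabla\varphi$. Every optimal coupling then lies on the graph, so
the infimum in the definition of `subdiff` runs over the single value
$t\langle\xi,\nabla\varphi\rangle$. Compare with the two-sided expansion, divide by $t$ and let the
error tend to zero. -/
lemma integral_inner_gradient_le {U : P2 d → ℝ} {m : P2 d} {z ξ : L2 m}
    (h : HasWExpansion U m z) (hξ : ξ ∈ subdiff U m) {φ : M d → ℝ} (hφ : IsTest φ) :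
    ∫ x, ⟪ξ x, gradient φ x⟫ ∂m.1 ≤ ∫ x, ⟪z x, gradient φ x⟫ ∂m.1 := by
  obtain ⟨t₀, ht₀, hgraph⟩ := eq_perturb_of_mem_optCouplings hφ
  set K := √(∫ x, ‖gradient φ x‖ ^ 2 ∂m.1) with hK
  have hK0 : 0 ≤ K := Real.sqrt_nonneg _
  have key : ∀ ε > 0, ∫ x, ⟪ξ x, gradient φ x⟫ ∂m.1
      ≤ ∫ x, ⟪z x, gradient φ x⟫ ∂m.1 + 2 * ε * K := by
    intro ε hε
    obtain ⟨δ₁, hδ₁, H₁⟩ := h ε hε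
    obtain ⟨δ₂, hδ₂, H₂⟩ := hξ ε hε
    obtain ⟨t, ht, htlt⟩ : ∃ t, 0 < t ∧ t < min t₀ (min δ₁ δ₂ / (K + 1)) :=
      exists_between (lt_min ht₀ (div_pos (lt_min hδ₁ hδ₂) (by positivity)))
    have hW := W2_pushGradient_le m hφ ht.le
    rw [← hK] at hW
    have hsmall : W2 m (m.pushGradient hφ t) < min δ₁ δ₂ := by
      have := (lt_div_iff₀ (by positivity)).1 (lt_of_lt_of_le htlt (min_le_right _ _))
      nlinarith
    have hg := hgraph t ht (lt_of_lt_of_le htlt (min_le_left _ _)) m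
    have hcomp : ∀ w : L2 m, ∀ γ ∈ optCouplings m (m.pushGradient hφ t),
        ∫ p, ⟪w p.1, p.2 - p.1⟫ ∂γ = t * ∫ x, ⟪w x, gradient φ x⟫ ∂m.1 := by
      intro w γ hγ
      rw [integral_of_ae_eq_graph hγ.1 (hg γ hγ) (fun x y => ⟪w x, y - x⟫)
        ((Lp.aestronglyMeasurable w).inner (((continuous_perturb hφ t).sub
          continuous_id).aestronglyMeasurable)), ← integral_const_mul]
      refine integral_congr_ae (ae_of_all _ fun x => ?_)
      simp [perturb, real_inner_smul_right]
    obtain ⟨γ, hγ⟩ := optCouplings_nonempty m (m.pushGradient hφ t)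
    have himg : (fun γ : Measure (M d × M d) => ∫ p, ⟪ξ p.1, p.2 - p.1⟫ ∂γ) ''
        optCouplings m (m.pushGradient hφ t) = {t * ∫ x, ⟪ξ x, gradient φ x⟫ ∂m.1} := by
      apply Subset.antisymm
      · rintro _ ⟨γ', hγ', rfl⟩
        exact hcomp ξ γ' hγ'
      · rintro _ rfl
        exact ⟨γ, hγ, hcomp ξ γ hγ⟩
    have h1 := (abs_le.1 (H₁ _ (hsmall.trans_le (min_le_left _ _)) γ hγ)).2
    have h2 := H₂ _ (hsmall.trans_le (min_le_right _ _))
    rw [himg, csInf_singleton] at h2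
    rw [hcomp z γ hγ] at h1
    have h3 : t * ∫ x, ⟪ξ x, gradient φ x⟫ ∂m.1
        ≤ t * (∫ x, ⟪z x, gradient φ x⟫ ∂m.1 + 2 * ε * K) := by nlinarith
    exact le_of_mul_le_mul_left h3 ht
  refine le_of_forall_pos_le_add fun η hη => ?_
  have := key (η / (2 * (K + 1))) (by positivity)
  refine this.trans ?_
  gcongr
  rw [mul_div_assoc', div_mul_eq_mul_div, div_le_iff₀ (by positivity)]
  nlinarith

lemma IsTest.neg {φ : M d → ℝ} (hφ : IsTest φ) : IsTest (-φ) :=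
  ⟨hφ.1.neg, hφ.2.neg⟩

lemma gradient_neg_apply (φ : M d → ℝ) (x : M d) : gradient (-φ) x = - gradient φ x := by
  rw [gradient, gradient, fderiv_neg, map_neg]

theorem HasWExpansion.sub_mem_orthogonal {U : P2 d → ℝ} {m : P2 d} {z ξ : L2 m}
    (h : HasWExpansion U m z) (hξ : ξ ∈ subdiff U m) : ξ - z ∈ (tangent m)ᗮ := by
  refine mem_orthogonal_tangent fun φ hφ => ?_
  have hle := integral_inner_gradient_le h hξ hφ
  have hge := integral_inner_gradient_le h hξ hφ.neg
  simp only [gradient_neg_apply, inner_neg_right, integral_neg] at hge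
  have hi : ∀ w : L2 m, Integrable (fun x => ⟪w x, gradient φ x⟫) m.1 := fun w =>
    integrable_inner_of_memLp (Lp.memLp w) (hφ.gradient.memLp m)
  have : ∫ x, ⟪gradient φ x, (ξ - z) x⟫ ∂m.1
      = ∫ x, ⟪ξ x, gradient φ x⟫ ∂m.1 - ∫ x, ⟪z x, gradient φ x⟫ ∂m.1 := by
    rw [← integral_sub (hi ξ) (hi z)]
    refine integral_congr_ae ?_
    filter_upwards [Lp.coeFn_sub ξ z] with x hx
    rw [hx, Pi.sub_apply, real_inner_comm, inner_sub_left]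
  rw [this]
  linarith

theorem HasWExpansion.wDifferentiableAt {U : P2 d → ℝ} {m : P2 d} {z : L2 m}
    (h : HasWExpansion U m z) : WDifferentiableAt U m := by
  refine ⟨⟨z, h.mem_subdiff⟩, ⟨z, ?_⟩⟩
  have : HasWExpansion (fun ν => - U ν) m (-z : L2 m) :=
    h.neg.congr (Lp.coeFn_neg z).symm
  exact this.mem_subdiff

/-- For every subgradient `ξ`, the difference `ξ - z` is orthogonal to the tangent vector `z`, so
$\|\xi\|^2=\|z\|^2+\|\xi-z\|^2$. -/
theorem HasWExpansion.isWGrad_iff {U : P2 d → ℝ} {m : P2 d} {z : L2 m}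
    (h : HasWExpansion U m z) (hz : z ∈ tangent m) {ξ : L2 m} : IsWGrad U m ξ ↔ ξ = z := by
  have hpy : ∀ ξ ∈ subdiff U m, ‖ξ‖ ^ 2 = ‖z‖ ^ 2 + ‖ξ - z‖ ^ 2 := by
    intro ξ hξ
    have h0 := (Submodule.mem_orthogonal _ _).1 (h.sub_mem_orthogonal hξ) z hz
    have := norm_add_sq_real z (ξ - z)
    rw [h0] at this
    simpa using this
  constructor
  · rintro ⟨hξ, hmin⟩
    have h1 := hpy ξ hξ
    have h2 := hmin z h.mem_subdiff
    have h3 : ‖ξ - z‖ ^ 2 ≤ 0 := by nlinarith [norm_nonneg ξ, norm_nonneg z]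
    exact sub_eq_zero.1 (norm_eq_zero.1 (pow_eq_zero_iff two_ne_zero |>.1
      (le_antisymm h3 (by positivity))))
  · rintro rfl
    refine ⟨h.mem_subdiff, fun ξ hξ => (sq_le_sq₀ (norm_nonneg _) (norm_nonneg _)).1 ?_⟩
    rw [hpy ξ hξ]
    exact le_add_of_nonneg_right (by positivity)

theorem HasWExpansion.wGrad_eq {U : P2 d → ℝ} {m : P2 d} {z : L2 m}
    (h : HasWExpansion U m z) (hz : z ∈ tangent m) : wGrad U m = z := by
  have hex : ∃ ζ, IsWGrad U m ζ := ⟨z, (h.isWGrad_iff hz).2 rfl⟩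
  rw [wGrad, dif_pos hex]
  exact (h.isWGrad_iff hz).1 hex.choose_spec

end FirstOrder

end

noncomputable section

/-! ### Calculus of functions on `(ℝᵈ)ᵏ` -/

section Calculus

variable {d k : ℕ}

/-! ### Operations on concave moduli -/

lemma IsConcaveModulus.comp_const_mul_nonneg {ρ : ℝ → ℝ} (h : IsConcaveModulus ρ) {c : ℝ}
    (hc : 0 ≤ c) : IsConcaveModulus fun t => c * ρ t where
  nonneg t ht := mul_nonneg hc (h.nonneg t ht)
  zero := by rw [h.zero, mul_zero]
  cont := continuousOn_const.mul h.cont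
  mono s hs t ht hst := mul_le_mul_of_nonneg_left (h.mono hs ht hst) hc
  subadd s t hs ht := by rw [← mul_add]; exact mul_le_mul_of_nonneg_left (h.subadd s t hs ht) hc
  concave := h.concave.smul hc

lemma IsConcaveModulus.min_const {ρ : ℝ → ℝ} (h : IsConcaveModulus ρ) {c : ℝ}
    (hc : 0 ≤ c) : IsConcaveModulus fun t => min (ρ t) c where
  nonneg t ht := le_min (h.nonneg t ht) hc
  zero := by rw [h.zero, min_eq_left hc]
  cont := fun t ht => (h.cont t ht).inf continuousWithinAt_const
  mono s hs t ht hst := min_le_min (h.mono hs ht hst) le_rfl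
  subadd s t hs ht := by
    have h1 := h.subadd s t hs ht
    have h2 := h.nonneg s hs
    have h3 := h.nonneg t ht
    simp only [min_def]
    split_ifs <;> linarith
  concave := h.concave.inf (concaveOn_const c (convex_Ici 0))

lemma IsConcaveModulus.le_two_mul {ρ : ℝ → ℝ} (h : IsConcaveModulus ρ) {t : ℝ} (ht : 0 ≤ t) :
    ρ (2 * t) ≤ 2 * ρ t := by
  rw [two_mul, two_mul]; exact h.subadd t t ht ht

lemma IsConcaveModulus.tendsto_zero {ρ : ℝ → ℝ} (h : IsConcaveModulus ρ) {c : ℝ} (hc : 0 ≤ c) :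
    Tendsto (fun t => ρ (c * t)) (𝓝[>] 0) (𝓝 0) := by
  have h1 : Tendsto ρ (𝓝[Ici 0] 0) (𝓝 0) := by
    have := h.cont 0 self_mem_Ici
    rwa [ContinuousWithinAt, h.zero] at this
  refine h1.comp (tendsto_nhdsWithin_iff.2 ⟨?_, ?_⟩)
  · have : Tendsto (fun t : ℝ => c * t) (𝓝 0) (𝓝 (c * 0)) := tendsto_id.const_mul c
    rw [mul_zero] at this
    exact this.mono_left nhdsWithin_le_nhds
  · filter_upwards [self_mem_nhdsWithin] with t ht
    exact mul_nonneg hc (le_of_lt ht)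

/-- `T ↦` the vector representing the restriction of `T` to the `j`-th factor. -/
def gradProj (d k : ℕ) (j : Fin k) : ((Fin k → M d) →L[ℝ] ℝ) →L[ℝ] M d where
  toFun T := (InnerProductSpace.toDual ℝ (M d)).symm
    (T.comp (ContinuousLinearMap.single ℝ (fun _ : Fin k => M d) j))
  map_add' S T := by rw [ContinuousLinearMap.add_comp, map_add]
  map_smul' c T := by rw [ContinuousLinearMap.smul_comp, map_smulₛₗ]; rfl
  cont := (InnerProductSpace.toDual ℝ (M d)).symm.continuous.comp
    (continuous_id.clm_comp continuous_const)

lemma inner_gradProj (j : Fin k) (T : (Fin k → M d) →L[ℝ] ℝ) (v : M d) :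
    ⟪gradProj d k j T, v⟫ = T (Pi.single j v) := by
  change ⟪(InnerProductSpace.toDual ℝ (M d)).symm (T.comp
    (ContinuousLinearMap.single ℝ (fun _ : Fin k => M d) j)), v⟫ = _
  rw [InnerProductSpace.toDual_symm_apply]
  simp

lemma norm_gradProj_le (j : Fin k) (T : (Fin k → M d) →L[ℝ] ℝ) : ‖gradProj d k j T‖ ≤ ‖T‖ := by
  have h := inner_gradProj j T (gradProj d k j T)
  rw [real_inner_self_eq_norm_sq] at h
  have h2 := (le_abs_self _).trans (T.le_opNorm (Pi.single j (gradProj d k j T)))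
  rw [Pi.norm_single] at h2
  by_contra hcon
  push Not at hcon
  nlinarith [norm_nonneg T]

/-! ### Partial gradients and Hessian blocks as restrictions of the full derivatives -/

lemma partialGrad_eq {Φ : (Fin k → M d) → ℝ} (hΦ : Differentiable ℝ Φ) (j : Fin k)
    (x : Fin k → M d) : partialGrad Φ j x = gradProj d k j (fderiv ℝ Φ x) := by
  refine ext_inner_right ℝ fun v => ?_
  rw [partialGrad, inner_gradient_apply, inner_gradProj]
  have h1 := hasFDerivAt_update (𝕜 := ℝ) x (i := j) (x j)
  have h2 : HasFDerivAt Φ (fderiv ℝ Φ x) (Function.update x j (x j)) := by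
    rw [Function.update_eq_self]; exact (hΦ x).hasFDerivAt
  have h3 : HasFDerivAt (fun z => Φ (Function.update x j z)) _ (x j) := h2.comp (x j) h1
  rw [h3.fderiv, ContinuousLinearMap.comp_apply]
  congr 1
  funext i
  by_cases hij : i = j
  · subst hij; simp
  · simp [Pi.single_eq_of_ne hij]

lemma hasFDerivAt_partialGrad {Φ : (Fin k → M d) → ℝ} (hΦ : ContDiff ℝ 2 Φ) (j : Fin k)
    (x : Fin k → M d) :
    HasFDerivAt (partialGrad Φ j) ((gradProj d k j).comp (fderiv ℝ (fderiv ℝ Φ) x)) x := by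
  have h1 : partialGrad Φ j = fun x => gradProj d k j (fderiv ℝ Φ x) :=
    funext fun x => partialGrad_eq (hΦ.differentiable (by norm_num)) j x
  rw [h1]
  have h2 : ContDiff ℝ 1 (fderiv ℝ Φ) := hΦ.fderiv_right (by norm_num)
  have h3 : HasFDerivAt (𝕜 := ℝ) (gradProj d k j) (gradProj d k j) (fderiv ℝ Φ x) :=
    ContinuousLinearMap.hasFDerivAt (gradProj d k j)
  exact h3.comp x (h2.differentiable (by norm_num) x).hasFDerivAt

lemma partialHess_apply {Φ : (Fin k → M d) → ℝ} (hΦ : ContDiff ℝ 2 Φ) (n j : Fin k)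
    (x : Fin k → M d) (v : M d) :
    partialHess Φ n j x v = gradProj d k j (fderiv ℝ (fderiv ℝ Φ) x (Pi.single n v)) := by
  rw [partialHess]
  have h1 := hasFDerivAt_update (𝕜 := ℝ) x (i := n) (x n)
  have h2 : HasFDerivAt (partialGrad Φ j)
      ((gradProj d k j).comp (fderiv ℝ (fderiv ℝ Φ) x)) (Function.update x n (x n)) := by
    rw [Function.update_eq_self]; exact hasFDerivAt_partialGrad hΦ j x
  have h3 : HasFDerivAt (fun z => partialGrad Φ j (Function.update x n z)) _ (x n) :=
    h2.comp (x n) h1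
  rw [h3.fderiv, ContinuousLinearMap.comp_apply, ContinuousLinearMap.comp_apply]
  congr 2
  ext i
  by_cases hij : i = n
  · subst hij; simp
  · simp [Pi.single_eq_of_ne hij]

lemma fderiv_partialGrad_apply {Φ : (Fin k → M d) → ℝ} (hΦ : ContDiff ℝ 2 Φ) (j : Fin k)
    (x h : Fin k → M d) :
    gradProj d k j (fderiv ℝ (fderiv ℝ Φ) x h) = ∑ n, partialHess Φ n j x (h n) := by
  simp_rw [partialHess_apply hΦ]
  rw [← map_sum, ← map_sum, Finset.univ_sum_single]

lemma continuous_partialGrad {Φ : (Fin k → M d) → ℝ} (hΦ : ContDiff ℝ 2 Φ) (j : Fin k) :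
    Continuous (partialGrad Φ j) :=
  continuous_iff_continuousAt.2 fun x => (hasFDerivAt_partialGrad hΦ j x).continuousAt

lemma norm_partialHess_le {Φ : (Fin k → M d) → ℝ} (hΦ : ContDiff ℝ 2 Φ) (n j : Fin k)
    (x : Fin k → M d) : ‖partialHess Φ n j x‖ ≤ ‖fderiv ℝ (fderiv ℝ Φ) x‖ := by
  refine ContinuousLinearMap.opNorm_le_bound _ (by positivity) fun v => ?_
  rw [partialHess_apply hΦ]
  refine (norm_gradProj_le _ _).trans ?_
  refine (ContinuousLinearMap.le_opNorm _ _).trans ?_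
  rw [Pi.norm_single]

lemma continuous_partialHess {Φ : (Fin k → M d) → ℝ} (hΦ : ContDiff ℝ 2 Φ) (n j : Fin k) :
    Continuous (partialHess Φ n j) := by
  have hc : Continuous (fderiv ℝ (fderiv ℝ Φ)) :=
    (hΦ.fderiv_right (m := 1) (by norm_num)).continuous_fderiv (by norm_num)
  have h : partialHess Φ n j = fun x => (gradProj d k j).comp ((fderiv ℝ (fderiv ℝ Φ) x).comp
      (ContinuousLinearMap.single ℝ (fun _ : Fin k => M d) n)) := by
    funext x
    refine ContinuousLinearMap.ext fun v => ?_
    rw [partialHess_apply hΦ]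
    simp
  rw [h]
  exact continuous_const.clm_comp (hc.clm_comp continuous_const)

/-- Changing the coordinate `σ j` and then relabelling by `σ` is the same as relabelling and then
changing the coordinate `j`. -/
lemma partialGrad_perm {Φ : (Fin k → M d) → ℝ}
    (hs : ∀ (σ : Equiv.Perm (Fin k)) (x : Fin k → M d), Φ (fun i => x (σ i)) = Φ x)
    (σ : Equiv.Perm (Fin k)) (j : Fin k) (x : Fin k → M d) :
    partialGrad Φ (σ j) x = partialGrad Φ j (fun i => x (σ i)) := by
  unfold partialGrad
  congr 1
  funext z
  rw [← hs σ (Function.update x (σ j) z),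
    Function.update_comp_eq_of_injective' x σ.injective j z]

lemma partialHess_perm {Φ : (Fin k → M d) → ℝ}
    (hs : ∀ (σ : Equiv.Perm (Fin k)) (x : Fin k → M d), Φ (fun i => x (σ i)) = Φ x)
    (σ : Equiv.Perm (Fin k)) (n j : Fin k) (x : Fin k → M d) :
    partialHess Φ (σ n) (σ j) x = partialHess Φ n j (fun i => x (σ i)) := by
  unfold partialHess
  congr 1
  funext z
  rw [partialGrad_perm hs, Function.update_comp_eq_of_injective' x σ.injective n z]

lemma norm_le_sum_norm (h : Fin k → M d) : ‖h‖ ≤ ∑ i, ‖h i‖ := by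
  refine (pi_norm_le_iff_of_nonneg (Finset.sum_nonneg fun i _ => norm_nonneg _)).2 fun i => ?_
  exact Finset.single_le_sum (f := fun i => ‖h i‖) (fun i _ => norm_nonneg _) (Finset.mem_univ i)

/-- A bounded concave modulus of continuity `r ≤ B` of the Hessian, which is bounded by `B`. -/
structure HessModulus (Φ : (Fin k → M d) → ℝ) (r : ℝ → ℝ) (B : ℝ) : Prop where
  contDiff : ContDiff ℝ 2 Φ
  symm : ∀ (σ : Equiv.Perm (Fin k)) (x : Fin k → M d), Φ (fun i => x (σ i)) = Φ x
  modulus : IsConcaveModulus r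
  nonneg : 0 ≤ B
  r_le : ∀ t, r t ≤ B
  hess_le : ∀ x, ‖fderiv ℝ (fderiv ℝ Φ) x‖ ≤ B
  hess_sub_le : ∀ x y : Fin k → M d,
    ‖fderiv ℝ (fderiv ℝ Φ) y - fderiv ℝ (fderiv ℝ Φ) x‖ ≤ r (∑ i, ‖y i - x i‖)

theorem IsSymTwo.exists_hessModulus {Φ : (Fin k → M d) → ℝ} (hΦ : IsSymTwo Φ) :
    ∃ r B, HessModulus Φ r B := by
  obtain ⟨C, hC⟩ := hΦ.bounded
  obtain ⟨ρ, hρ, hmod⟩ := hΦ.modulus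
  have hC0 : 0 ≤ C := (norm_nonneg (fderiv ℝ (fderiv ℝ Φ) 0)).trans (hC 0)
  -- Two Hessians bounded by `C` differ by at most `2 * C`, so truncating there costs nothing and
  -- makes the modulus bounded, as needed to integrate its square. The Euclidean distance is
  -- dominated by the sum of the norms, which is additive over the factors.
  refine ⟨fun t => min (ρ t) (2 * C), 2 * C, hΦ.contDiff, hΦ.symm, hρ.min_const (by positivity),
    by positivity, fun t => min_le_right _ _, fun x => (hC x).trans (by linarith),
    fun x y => le_min ?_ ?_⟩
  · refine (hmod x y).trans (hρ.mono (Real.sqrt_nonneg _)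
      (Finset.sum_nonneg fun i _ => norm_nonneg _) ?_)
    refine Real.sqrt_le_iff.2 ⟨Finset.sum_nonneg fun i _ => norm_nonneg _, ?_⟩
    simp_rw [norm_sub_rev (x _)]
    exact Finset.sum_sq_le_sq_sum_of_nonneg fun i _ => norm_nonneg _
  · refine (norm_sub_le (fderiv ℝ (fderiv ℝ Φ) y) (fderiv ℝ (fderiv ℝ Φ) x)).trans ?_
    linarith [hC x, hC y]

namespace HessModulus

variable {Φ : (Fin k → M d) → ℝ} {r : ℝ → ℝ} {B : ℝ}

lemma r_mono (h : HessModulus Φ r B) {s t : ℝ} (hs : 0 ≤ s) (hst : s ≤ t) : r s ≤ r t :=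
  h.modulus.mono hs (hs.trans hst) hst

lemma sum_norm_segment_le {x y z : Fin k → M d} (hz : z ∈ segment ℝ x y) :
    ∑ i, ‖z i - x i‖ ≤ ∑ i, ‖y i - x i‖ := by
  obtain ⟨t, ht, rfl⟩ := (segment_eq_image' ℝ x y) ▸ hz
  refine Finset.sum_le_sum fun i _ => ?_
  have : (x + t • (y - x)) i - x i = t • (y i - x i) := by simp
  rw [this, norm_smul, Real.norm_eq_abs, abs_of_nonneg ht.1]
  exact mul_le_of_le_one_left (norm_nonneg _) ht.2

/-- First order Taylor expansion of `∇_{x_j} Φ`. -/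
lemma norm_partialGrad_taylor_le (h : HessModulus Φ r B) (j : Fin k) (x y : Fin k → M d) :
    ‖partialGrad Φ j y - partialGrad Φ j x - ∑ n, partialHess Φ n j x (y n - x n)‖
      ≤ (∑ i, ‖y i - x i‖) * r (∑ i, ‖y i - x i‖) := by
  have hN : 0 ≤ ∑ i, ‖y i - x i‖ := Finset.sum_nonneg fun i _ => norm_nonneg _
  have h1 := (convex_segment x y).norm_image_sub_le_of_norm_hasFDerivWithin_le' (𝕜 := ℝ)
    (f := partialGrad Φ j) (φ := (gradProj d k j).comp (fderiv ℝ (fderiv ℝ Φ) x))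
    (C := r (∑ i, ‖y i - x i‖))
    (fun z _ => (hasFDerivAt_partialGrad h.contDiff j z).hasFDerivWithinAt)
    (fun z hz => by
      rw [← ContinuousLinearMap.comp_sub]
      refine ContinuousLinearMap.opNorm_le_bound _ (h.modulus.nonneg _ hN) fun v => ?_
      refine (norm_gradProj_le _ _).trans ((ContinuousLinearMap.le_opNorm _ _).trans ?_)
      gcongr
      refine (h.hess_sub_le x z).trans (h.r_mono (Finset.sum_nonneg fun i _ => norm_nonneg _) ?_)
      exact sum_norm_segment_le hz)
    (left_mem_segment ℝ x y) (right_mem_segment ℝ x y)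
  rw [ContinuousLinearMap.comp_apply, fderiv_partialGrad_apply h.contDiff] at h1
  refine h1.trans ?_
  rw [mul_comm]
  have := h.modulus.nonneg _ hN
  gcongr
  exact norm_le_sum_norm (y - x)

lemma norm_partialGrad_sub_le (h : HessModulus Φ r B) (j : Fin k) (x y : Fin k → M d) :
    ‖partialGrad Φ j y - partialGrad Φ j x‖ ≤ B * ∑ i, ‖y i - x i‖ := by
  have h1 := convex_univ.norm_image_sub_le_of_norm_hasFDerivWithin_le (𝕜 := ℝ)
    (f := partialGrad Φ j) (C := B)
    (fun z _ => (hasFDerivAt_partialGrad h.contDiff j z).hasFDerivWithinAt)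
    (fun z _ => by
      refine ContinuousLinearMap.opNorm_le_bound _ h.nonneg fun v => ?_
      refine (norm_gradProj_le _ _).trans ((ContinuousLinearMap.le_opNorm _ _).trans ?_)
      gcongr
      exact h.hess_le z) (mem_univ x) (mem_univ y)
  refine h1.trans ?_
  have := h.nonneg
  gcongr
  exact norm_le_sum_norm (y - x)

lemma fderiv_apply_eq_sum (h : HessModulus Φ r B) (x v : Fin k → M d) :
    fderiv ℝ Φ x v = ∑ j, ⟪partialGrad Φ j x, v j⟫ := by
  simp_rw [partialGrad_eq (h.contDiff.differentiable (by norm_num)), inner_gradProj]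
  rw [← map_sum, Finset.univ_sum_single]

/-- First order Taylor expansion of `Φ`. -/
lemma abs_taylor_le (h : HessModulus Φ r B) (x y : Fin k → M d) :
    |Φ y - Φ x - ∑ j, ⟪partialGrad Φ j x, y j - x j⟫| ≤ B * (∑ i, ‖y i - x i‖) ^ 2 := by
  have hB := h.nonneg
  have hd : ∀ z, ‖fderiv ℝ Φ z - fderiv ℝ Φ x‖ ≤ B * ‖z - x‖ := fun z =>
    convex_univ.norm_image_sub_le_of_norm_fderiv_le
      (fun z _ => (h.contDiff.fderiv_right (m := 1) (by norm_num)).differentiable (by norm_num) z)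
      (fun z _ => h.hess_le z) (mem_univ x) (mem_univ z)
  have h1 := (convex_segment x y).norm_image_sub_le_of_norm_fderiv_le' (𝕜 := ℝ)
    (f := Φ) (φ := fderiv ℝ Φ x) (C := B * ∑ i, ‖y i - x i‖)
    (fun z _ => h.contDiff.differentiable (by norm_num) z)
    (fun z hz => by
      refine (hd z).trans ?_
      gcongr
      exact (norm_le_sum_norm (z - x)).trans (sum_norm_segment_le hz))
    (left_mem_segment ℝ x y) (right_mem_segment ℝ x y)
  rw [h.fderiv_apply_eq_sum] at h1
  refine (h1.trans ?_)
  rw [sq, mul_assoc]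
  gcongr
  exact norm_le_sum_norm (y - x)

end HessModulus

end Calculus

end

noncomputable section

/-! ### Integration over products of copies of a measure -/

section PiIntegral

variable {Ω Ω' E : Type*} [MeasurableSpace Ω] [MeasurableSpace Ω'] [NormedAddCommGroup E]
  {n k : ℕ}

lemma memLp_sum_norm_pi {μ : Measure Ω} [IsProbabilityMeasure μ] {u : Ω → E} (hu : MemLp u 2 μ) :
    MemLp (fun p : Fin k → Ω => ∑ i, ‖u (p i)‖) 2 (Measure.pi fun _ : Fin k => μ) :=
  memLp_finsetSum _ fun i _ =>
    (hu.comp_measurePreserving (measurePreserving_eval (fun _ : Fin k => μ) i)).norm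

/-- One factor `k` comes from Cauchy–Schwarz for the sum and the other from the `k` equal marginal
integrals. -/
lemma integral_sum_norm_sq_pi_le {μ : Measure Ω} [IsProbabilityMeasure μ] {u : Ω → E}
    (hu : MemLp u 2 μ) :
    ∫ p, (∑ i, ‖u (p i)‖) ^ 2 ∂(Measure.pi fun _ : Fin k => μ)
      ≤ (k : ℝ) ^ 2 * ∫ x, ‖u x‖ ^ 2 ∂μ := by
  have hi : ∀ i : Fin k, Integrable (fun p : Fin k → Ω => ‖u (p i)‖ ^ 2)
      (Measure.pi fun _ : Fin k => μ) := fun i =>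
    (hu.comp_measurePreserving (measurePreserving_eval (fun _ : Fin k => μ) i)).integrable_norm_pow
      (by norm_num)
  calc ∫ p, (∑ i, ‖u (p i)‖) ^ 2 ∂(Measure.pi fun _ : Fin k => μ)
      ≤ ∫ p, (k : ℝ) * ∑ i, ‖u (p i)‖ ^ 2 ∂(Measure.pi fun _ : Fin k => μ) := by
        refine integral_mono (memLp_sum_norm_pi hu).integrable_sq
          ((integrable_finsetSum _ fun i _ => hi i).const_mul _) fun p => ?_
        have := sq_sum_le_card_mul_sum_sq (s := Finset.univ) (f := fun i : Fin k => ‖u (p i)‖)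
        simpa using this
    _ = (k : ℝ) * ∑ i : Fin k, ∫ x, ‖u x‖ ^ 2 ∂μ := by
        rw [integral_const_mul, integral_finsetSum _ fun i _ => hi i]
        congr 1
        refine Finset.sum_congr rfl fun i _ => ?_
        exact integral_comp_eval (μ := fun _ : Fin k => μ) (f := fun x => ‖u x‖ ^ 2)
          (hu.1.norm.pow 2)
    _ = _ := by simp; ring

lemma integral_sum_norm_pi {μ : Measure Ω} [IsProbabilityMeasure μ] {u : Ω → E}
    (hu : Integrable u μ) :
    ∫ p, (∑ i, ‖u (p i)‖) ∂(Measure.pi fun _ : Fin k => μ) = k * ∫ x, ‖u x‖ ∂μ := by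
  rw [integral_finsetSum _ fun i _ =>
    (integrable_comp_eval (μ := fun _ : Fin k => μ) (i := i) hu).norm]
  have : ∀ i : Fin k, ∫ p, ‖u (p i)‖ ∂(Measure.pi fun _ : Fin k => μ) = ∫ x, ‖u x‖ ∂μ := fun i =>
    integral_comp_eval (μ := fun _ : Fin k => μ) (f := fun x => ‖u x‖) hu.1.norm
  simp [this]

variable [NormedSpace ℝ E]

lemma integral_pi_comp_perm (μ : Measure Ω) [IsProbabilityMeasure μ] (σ : Equiv.Perm (Fin k))
    (f : (Fin k → Ω) → E) :
    ∫ x, f (fun i => x (σ i)) ∂(Measure.pi fun _ : Fin k => μ)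
      = ∫ x, f x ∂(Measure.pi fun _ : Fin k => μ) := by
  have h := measurePreserving_piCongrLeft (fun _ : Fin k => μ) σ.symm
  rw [← h.integral_comp' f]
  refine integral_congr_ae (ae_of_all _ fun x => ?_)
  refine congrArg f (funext fun i => ?_)
  have := Equiv.piCongrLeft_apply_apply (P := fun _ : Fin k => Ω) σ.symm x (σ i)
  rw [Equiv.symm_apply_apply] at this
  exact this.symm

/-- With `μ` a coupling and `f` one of its two projections, this writes integrals over powers of `m`
and of `ν` on one common product space. -/
lemma integral_pi_comp_map (μ : Measure Ω) [IsProbabilityMeasure μ] {f : Ω → Ω'}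
    (hf : Measurable f) {g : (Fin k → Ω') → E}
    (hg : AEStronglyMeasurable g (Measure.pi fun _ : Fin k => μ.map f)) :
    ∫ x, g (fun i => f (x i)) ∂(Measure.pi fun _ : Fin k => μ)
      = ∫ y, g y ∂(Measure.pi fun _ : Fin k => μ.map f) := by
  have := Measure.isProbabilityMeasure_map (μ := μ) hf.aemeasurable
  have h := Measure.pi_map_pi (μ := fun _ : Fin k => μ) (f := fun _ => f)
    (fun _ => hf.aemeasurable)
  rw [← h] at hg ⊢
  have hm : Measurable fun (x : Fin k → Ω) i => f (x i) :=
    measurable_pi_lambda _ fun i => hf.comp (measurable_pi_apply i)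
  rw [integral_map hm.aemeasurable hg]

lemma measurePreserving_cons (μ : Measure Ω) [IsProbabilityMeasure μ] :
    MeasurePreserving (fun p : Ω × (Fin n → Ω) => (Fin.cons p.1 p.2 : Fin (n + 1) → Ω))
      (μ.prod (Measure.pi fun _ : Fin n => μ)) (Measure.pi fun _ : Fin (n + 1) => μ) := by
  have h := (measurePreserving_piFinSuccAbove (fun _ : Fin (n + 1) => μ) 0).symm
  convert h using 1
  funext p
  change _ = Fin.insertNth (α := fun _ => Ω) 0 p.1 p.2
  rw [Fin.insertNth_zero']

lemma integral_pi_succ (μ : Measure Ω) [IsProbabilityMeasure μ] {f : (Fin (n + 1) → Ω) → E}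
    (hf : Integrable f (Measure.pi fun _ : Fin (n + 1) => μ)) :
    ∫ x, f x ∂(Measure.pi fun _ : Fin (n + 1) => μ)
      = ∫ a, ∫ y, f (Fin.cons a y) ∂(Measure.pi fun _ : Fin n => μ) ∂μ := by
  have h := measurePreserving_cons (n := n) μ
  have hi := h.integrable_comp_of_integrable hf
  rw [← integral_prod (fun p : Ω × (Fin n → Ω) => f (Fin.cons p.1 p.2)) hi, ← h.map_eq,
    integral_map h.measurable.aemeasurable (by rw [h.map_eq]; exact hf.1)]

end PiIntegral

/-! ### The fields `A_m` and `A_{mm}` -/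

section Fields

variable {d n k : ℕ}

lemma continuous_finCons {X : Type*} [TopologicalSpace X] {E : Type*} [TopologicalSpace E]
    {f : X → E} {g : X → Fin n → E} (hf : Continuous f) (hg : Continuous g) :
    Continuous fun x => (Fin.cons (f x) (g x) : Fin (n + 1) → E) := by
  refine continuous_pi fun i => ?_
  refine Fin.cases ?_ (fun j => ?_) i
  · simpa using hf
  · simp only [Fin.cons_succ]
    exact (continuous_apply j).comp hg

lemma continuous_cons (x : M d) :
    Continuous fun a : Fin n → M d => (Fin.cons x a : Fin (n + 1) → M d) :=
  continuous_finCons continuous_const continuous_id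

lemma sum_norm_cons_sub_cons (x y : M d) (a b : Fin n → M d) :
    ∑ i, ‖(Fin.cons y b : Fin (n + 1) → M d) i - (Fin.cons x a : Fin (n + 1) → M d) i‖
      = ‖y - x‖ + ∑ i, ‖b i - a i‖ := by
  rw [Fin.sum_univ_succ]
  simp

lemma sum_norm_cons (x : M d) (a : Fin n → M d) :
    ∑ i, ‖(Fin.cons x a : Fin (n + 1) → M d) i‖ = ‖x‖ + ∑ i, ‖a i‖ := by
  rw [Fin.sum_univ_succ]
  simp

/-- `Ã[m](x) = ∫ ∇²_{x₁ x₁} Φ(x, x₂, …, x_k) m(dx₂) ⋯ m(dx_k)`. -/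
def diagField (Φ : (Fin (n + 1) → M d) → ℝ) (m : P2 d) (x : M d) : M d →L[ℝ] M d :=
  ∫ y : Fin n → M d, partialHess Φ 0 0 (Fin.cons x y) ∂(Measure.pi fun _ : Fin n => m.1)

namespace HessModulus

lemma norm_partialGrad_le {Φ : (Fin k → M d) → ℝ} {r : ℝ → ℝ} {B : ℝ} (h : HessModulus Φ r B)
    (j : Fin k) (x : Fin k → M d) :
    ‖partialGrad Φ j x‖ ≤ ‖partialGrad Φ j 0‖ + B * ∑ i, ‖x i‖ := by
  have h1 := h.norm_partialGrad_sub_le j 0 x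
  have h2 := norm_le_norm_add_norm_sub (partialGrad Φ j 0) (partialGrad Φ j x)
  rw [norm_sub_rev] at h2
  simp only [Pi.zero_apply, sub_zero] at h1
  linarith

lemma norm_hess_le {Φ : (Fin k → M d) → ℝ} {r : ℝ → ℝ} {B : ℝ} (h : HessModulus Φ r B)
    (i j : Fin k) (x : Fin k → M d) : ‖partialHess Φ i j x‖ ≤ B :=
  (norm_partialHess_le h.contDiff i j x).trans (h.hess_le x)

variable {Φ : (Fin (n + 1) → M d) → ℝ} {r : ℝ → ℝ} {B : ℝ}

lemma memLp_partialGrad_cons (h : HessModulus Φ r B) (j : Fin (n + 1)) (x : M d) {Ω : Type*}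
    [MeasurableSpace Ω] {μ : Measure Ω} [IsProbabilityMeasure μ] {u : Ω → M d} (hu : MemLp u 2 μ)
    (hum : Measurable u) :
    MemLp (fun p : Fin n → Ω => partialGrad Φ j (Fin.cons x fun i => u (p i))) 2
      (Measure.pi fun _ : Fin n => μ) := by
  have h1 : MemLp (fun p : Fin n → Ω => ‖partialGrad Φ j 0‖ + B * (‖x‖ + ∑ i, ‖u (p i)‖)) 2
      (Measure.pi fun _ : Fin n => μ) :=
    by
      have h2 : MemLp (fun p : Fin n → Ω => ∑ i, ‖u (p i)‖) 2 (Measure.pi fun _ : Fin n => μ) :=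
        memLp_sum_norm_pi hu
      have h3 : MemLp (fun p : Fin n → Ω => ‖x‖ + ∑ i, ‖u (p i)‖) 2
        (Measure.pi fun _ : Fin n => μ) := (memLp_const ‖x‖).add h2
      have h4 : MemLp (fun p : Fin n → Ω => B * (‖x‖ + ∑ i, ‖u (p i)‖)) 2
        (Measure.pi fun _ : Fin n => μ) := h3.const_mul B
      exact (memLp_const ‖partialGrad Φ j 0‖).add h4
  refine h1.of_le ?_ (ae_of_all _ fun p => ?_)
  · refine Measurable.aestronglyMeasurable ?_
    have hc : Continuous fun a : Fin n → M d => partialGrad Φ j (Fin.cons x a) :=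
      (continuous_partialGrad h.contDiff j).comp (continuous_cons x)
    exact hc.measurable.comp (by fun_prop : Measurable fun p : Fin n → Ω => fun i => u (p i))
  · refine (h.norm_partialGrad_le j _).trans ?_
    rw [sum_norm_cons]
    exact le_abs_self _

lemma gradField_eq_of_map (h : HessModulus Φ r B) {m : P2 d} {Ω : Type*} [MeasurableSpace Ω]
    {μ : Measure Ω} [IsProbabilityMeasure μ] {u : Ω → M d} (hu : Measurable u)
    (hm : μ.map u = m.1) (x : M d) :
    gradField Φ m x = ∫ p, partialGrad Φ 0 (Fin.cons x fun i => u (p i))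
      ∂(Measure.pi fun _ : Fin n => μ) := by
  have hc : Continuous fun a : Fin n → M d => partialGrad Φ 0 (Fin.cons x a) :=
    (continuous_partialGrad h.contDiff 0).comp (continuous_cons x)
  rw [integral_pi_comp_map μ hu (g := fun a => partialGrad Φ 0 (Fin.cons x a))
    hc.aestronglyMeasurable, hm]
  rfl

lemma integrable_partialHess (h : HessModulus Φ r B) (i j : Fin (n + 1)) {Ω : Type*}
    [MeasurableSpace Ω] {μ : Measure Ω} [IsProbabilityMeasure μ] {X : Ω → Fin (n + 1) → M d}
    (hX : Measurable X) : Integrable (fun p => partialHess Φ i j (X p)) μ :=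
  Integrable.of_bound ((continuous_partialHess h.contDiff i j).measurable.comp
    hX).aestronglyMeasurable B (ae_of_all _ fun _ => h.norm_hess_le i j _)

lemma integrable_partialHess_apply (h : HessModulus Φ r B) (i j : Fin (n + 1)) {Ω : Type*}
    [MeasurableSpace Ω] {μ : Measure Ω} {X : Ω → Fin (n + 1) → M d} (hX : Measurable X)
    {v : Ω → M d} (hv : Integrable v μ) :
    Integrable (fun p => partialHess Φ i j (X p) (v p)) μ := by
  refine (hv.norm.const_mul B).mono' ?_ (ae_of_all _ fun p => ?_)
  · have hc : Continuous fun q : (Fin (n + 1) → M d) × M d => partialHess Φ i j q.1 q.2 :=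
      ((continuous_partialHess h.contDiff i j).comp continuous_fst).clm_apply continuous_snd
    exact (hc.measurable.comp_aemeasurable
      (hX.aemeasurable.prodMk hv.1.aemeasurable)).aestronglyMeasurable
  · refine (ContinuousLinearMap.le_opNorm _ _).trans ?_
    gcongr
    exact h.norm_hess_le i j _

lemma measurable_cons {Ω : Type*} [MeasurableSpace Ω] {f : Ω → M d} {g : Ω → Fin n → M d}
    (hf : Measurable f) (hg : Measurable g) :
    Measurable fun t => (Fin.cons (f t) (g t) : Fin (n + 1) → M d) := by
  have hc : Continuous fun q : M d × (Fin n → M d) => (Fin.cons q.1 q.2 : Fin (n + 1) → M d) :=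
    continuous_finCons continuous_fst continuous_snd
  exact hc.measurable.comp (hf.prodMk hg)

lemma diagField_eq_of_map (h : HessModulus Φ r B) {m : P2 d} {Ω : Type*} [MeasurableSpace Ω]
    {μ : Measure Ω} [IsProbabilityMeasure μ] {u : Ω → M d} (hu : Measurable u)
    (hm : μ.map u = m.1) (x : M d) :
    diagField Φ m x = ∫ p, partialHess Φ 0 0 (Fin.cons x fun i => u (p i))
      ∂(Measure.pi fun _ : Fin n => μ) := by
  have hc : Continuous fun a : Fin n → M d => partialHess Φ 0 0 (Fin.cons x a) :=
    (continuous_partialHess h.contDiff 0 0).comp (continuous_cons x)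
  rw [integral_pi_comp_map μ hu (g := fun a => partialHess Φ 0 0 (Fin.cons x a))
    hc.aestronglyMeasurable, hm]
  rfl

lemma cons_comp_swap {E : Type*} (x : E) (a : Fin (n + 1) → E) (i : Fin (n + 1)) :
    (fun j => (Fin.cons x a : Fin (n + 2) → E) (Equiv.swap 1 i.succ j))
      = Fin.cons x fun j => a (Equiv.swap 0 i j) := by
  funext j
  refine Fin.cases ?_ (fun l => ?_) j
  · rw [Equiv.swap_apply_of_ne_of_ne (by simp) (Fin.succ_ne_zero i).symm]
    simp
  · rw [← Fin.succ_zero_eq_one, (Fin.succ_injective _).swap_apply]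
    simp

/-- Exchanging the variables `1` and `i.succ` of `Φ` amounts to exchanging the copies `0` and `i` of
the coupling, which leaves the product measure unchanged. The displacement then involves only copy
`0`, and the other copies enter only through their first marginal `m`. -/
lemma integral_partialHess_succ {Φ : (Fin (n + 2) → M d) → ℝ} (h : HessModulus Φ r B)
    {m ν : P2 d} {γ : Measure (M d × M d)} (hγ : γ ∈ couplings m ν) (x : M d) (i : Fin (n + 1)) :
    ∫ p, partialHess Φ i.succ 0 (Fin.cons x fun j => (p j).1) ((p i).2 - (p i).1)
      ∂(Measure.pi fun _ : Fin (n + 1) => γ)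
    = ∫ q, (∫ y, partialHess Φ 1 0 (Fin.cons x (Fin.cons q.1 y))
        ∂(Measure.pi fun _ : Fin n => m.1)) (q.2 - q.1) ∂γ := by
  have := isProbabilityMeasure_of_mem_couplings hγ
  let f : (Fin (n + 1) → M d × M d) → M d := fun p =>
    partialHess Φ 1 0 (Fin.cons x fun j => (p j).1) ((p 0).2 - (p 0).1)
  have e1 : ∀ p : Fin (n + 1) → M d × M d,
      partialHess Φ i.succ 0 (Fin.cons x fun j => (p j).1) ((p i).2 - (p i).1)
        = f (fun j => p (Equiv.swap 0 i j)) := by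
    intro p
    have h1 := partialHess_perm h.symm (Equiv.swap 1 i.succ) 1 0 (Fin.cons x fun j => (p j).1)
    rw [Equiv.swap_apply_left, Equiv.swap_apply_of_ne_of_ne (by simp) (Fin.succ_ne_zero i).symm,
      cons_comp_swap] at h1
    rw [h1]
    simp [f]
  simp_rw [e1]
  rw [integral_pi_comp_perm γ (Equiv.swap 0 i) f, integral_pi_succ γ]
  · refine integral_congr_ae (ae_of_all _ fun q => ?_)
    have hX : Measurable fun y : Fin n → M d => (Fin.cons x (Fin.cons q.1 y) : Fin (n + 2) → M d) :=
      measurable_cons measurable_const (measurable_cons measurable_const measurable_id)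
    dsimp only [f]
    simp only [Fin.cons_zero]
    have e2 : ∀ y : Fin n → M d × M d,
        (fun j => ((Fin.cons q y : Fin (n + 1) → M d × M d) j).1)
          = Fin.cons q.1 fun j => (y j).1 := by
      intro y
      funext j
      refine Fin.cases ?_ (fun l => ?_) j <;> simp
    simp_rw [e2]
    rw [ContinuousLinearMap.integral_apply (h.integrable_partialHess 1 0 hX),
      integral_pi_comp_map γ measurable_fst
        (g := fun y => partialHess Φ 1 0 (Fin.cons x (Fin.cons q.1 y)) (q.2 - q.1)), hγ.1]
    rw [hγ.1]
    exact (h.integrable_partialHess_apply 1 0 hX (integrable_const _)).1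
  · refine h.integrable_partialHess_apply 1 0 (measurable_cons measurable_const (by fun_prop)) ?_
    exact integrable_comp_eval (μ := fun _ : Fin (n + 1) => γ) (i := 0) (integrable_sub_coupling hγ)

/-- The `n` summands are all equal, and this multiplicity is the factor $k-1$ in $A_{mm}$. For `n =
0` the empty sum matches the value `0` of `hessField`. -/
lemma sum_integral_partialHess_succ (h : HessModulus Φ r B) {m ν : P2 d}
    {γ : Measure (M d × M d)} (hγ : γ ∈ couplings m ν) (x : M d) :
    ∑ i : Fin n, ∫ p, partialHess Φ i.succ 0 (Fin.cons x fun j => (p j).1) ((p i).2 - (p i).1)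
      ∂(Measure.pi fun _ : Fin n => γ)
    = ∫ q, hessField Φ m x q.1 (q.2 - q.1) ∂γ := by
  cases n with
  | zero => simp [hessField]
  | succ n =>
    simp_rw [h.integral_partialHess_succ hγ x]
    simp only [hessField, Finset.sum_const, Finset.card_univ, Fintype.card_fin, smul_apply]
    rw [integral_smul, ← Nat.cast_smul_eq_nsmul ℝ]
    push_cast
    rfl

/-- The growth term of the second order expansion. -/
lemma mul_modulus_add_le (h : HessModulus Φ r B) {s t : ℝ} (hs : 0 ≤ s) (ht : 0 ≤ t) :
    (s + t) * r (s + t) ≤ 4 * (s * r s) + 4 * (t * r t) := by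
  -- The sum is at most twice the larger term, and subadditivity gives `r (2 * b) ≤ 2 * r b`; hence
  -- the factor 4.
  have key : ∀ a b : ℝ, 0 ≤ a → 0 ≤ b → a ≤ b → (a + b) * r (a + b) ≤ 4 * (b * r b) := by
    intro a b ha hb hab
    have h1 : r (a + b) ≤ 2 * r b :=
      (h.r_mono (by positivity) (by linarith)).trans (h.modulus.le_two_mul hb)
    have h2 := h.modulus.nonneg b hb
    calc (a + b) * r (a + b) ≤ (2 * b) * (2 * r b) := by
          have := h.modulus.nonneg (a + b) (by positivity)
          gcongr; linarith
      _ = _ := by ring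
  have h1 := mul_nonneg hs (h.modulus.nonneg s hs)
  have h2 := mul_nonneg ht (h.modulus.nonneg t ht)
  rcases le_total s t with hst | hst
  · linarith [key s t hs ht hst]
  · have := key t s ht hs hst
    rw [add_comm t s] at this
    linarith

lemma aestronglyMeasurable_modulus (h : HessModulus Φ r B) {Ω : Type*} [MeasurableSpace Ω]
    {μ : Measure Ω} {f : Ω → ℝ} (hf : AEStronglyMeasurable f μ) (hf0 : ∀ x, 0 ≤ f x) :
    AEStronglyMeasurable (fun x => r (f x)) μ := by
  -- The modulus is only known to be continuous on the half-line, so it is extended by its value at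
  -- `0`.
  have hc : Continuous fun t : ℝ => r (max t 0) := by
    refine h.modulus.cont.comp_continuous (by fun_prop) fun t => mem_Ici.2 (le_max_right _ _)
  have := hc.comp_aestronglyMeasurable hf
  refine this.congr (ae_of_all _ fun x => ?_)
  simp [max_eq_left (hf0 x)]

lemma integrable_modulus (h : HessModulus Φ r B) {Ω : Type*} [MeasurableSpace Ω]
    {μ : Measure Ω} [IsFiniteMeasure μ] {f : Ω → ℝ} (hf : AEStronglyMeasurable f μ)
    (hf0 : ∀ x, 0 ≤ f x) : Integrable (fun x => r (f x)) μ :=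
  Integrable.of_bound (h.aestronglyMeasurable_modulus hf hf0) B (ae_of_all _ fun x => by
    rw [Real.norm_eq_abs, abs_of_nonneg (h.modulus.nonneg _ (hf0 x))]; exact h.r_le _)

/-- Cauchy–Schwarz separates the displacement $H$ from $r(H)$. Since $r\le B$, one has $r^2\le Br$,
and Jensen bounds the mean of $r(H)$ by $r$ of the mean displacement. The outcome is $W_2$ times a
quantity tending to zero. -/
lemma integral_sum_mul_modulus_le (h : HessModulus Φ r B) {m ν : P2 d}
    {γ : Measure (M d × M d)} (hγ : γ ∈ optCouplings m ν) :
    Integrable (fun p : Fin n → M d × M d => (∑ i, ‖(p i).2 - (p i).1‖)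
      * r (∑ i, ‖(p i).2 - (p i).1‖)) (Measure.pi fun _ : Fin n => γ) ∧
    ∫ p, (∑ i, ‖(p i).2 - (p i).1‖) * r (∑ i, ‖(p i).2 - (p i).1‖)
      ∂(Measure.pi fun _ : Fin n => γ) ≤ W2 m ν * (n * √(B * r (n * W2 m ν))) := by
  have := isProbabilityMeasure_of_mem_couplings hγ.1
  have hB := h.nonneg
  set Γ := Measure.pi fun _ : Fin n => γ with hΓ
  let H : (Fin n → M d × M d) → ℝ := fun p => ∑ i, ‖(p i).2 - (p i).1‖
  have hH0 : ∀ p, 0 ≤ H p := fun p => Finset.sum_nonneg fun i _ => norm_nonneg _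
  have hH : MemLp H 2 Γ := memLp_sum_norm_pi (memLp_sub_coupling hγ.1)
  have hr0 : ∀ p, 0 ≤ r (H p) := fun p => h.modulus.nonneg _ (hH0 p)
  have hrm : MemLp (fun p => r (H p)) 2 Γ :=
    MemLp.of_bound (h.aestronglyMeasurable_modulus hH.1 hH0) B (ae_of_all _ fun p => by
      rw [Real.norm_eq_abs, abs_of_nonneg (hr0 p)]; exact h.r_le _)
  refine ⟨hH.integrable_mul hrm, ?_⟩
  refine (integral_mul_le_sqrt_mul_sqrt hH hrm hH0 hr0).trans ?_
  have hW := W2_nonneg m ν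
  have i1 : √(∫ p, H p ^ 2 ∂Γ) ≤ n * W2 m ν := by
    refine Real.sqrt_le_iff.2 ⟨by positivity, ?_⟩
    have := integral_sum_norm_sq_pi_le (k := n) (memLp_sub_coupling hγ.1)
    rw [W2_sq_eq hγ] at this
    rw [mul_pow]
    exact this
  have hHi : Integrable H Γ := hH.integrable (by norm_num)
  have i2 : ∫ p, r (H p) ∂Γ ≤ r (n * W2 m ν) := by
    refine integral_modulus_le h.modulus hHi hH0
      (h.integrable_modulus hH.1 hH0) ?_
    have := integral_sum_norm_pi (k := n) (integrable_sub_coupling hγ.1)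
    refine this.le.trans ?_
    have := integral_norm_sub_le_W2 hγ
    gcongr
  have i3 : ∫ p, r (H p) ^ 2 ∂Γ ≤ B * r (n * W2 m ν) := by
    calc ∫ p, r (H p) ^ 2 ∂Γ ≤ ∫ p, B * r (H p) ∂Γ := by
          refine integral_mono hrm.integrable_sq
            ((h.integrable_modulus hH.1 hH0).const_mul B) fun p => ?_
          dsimp only
          rw [sq]
          exact mul_le_mul_of_nonneg_right (h.r_le _) (hr0 p)
      _ ≤ _ := by rw [integral_const_mul]; gcongr
  calc √(∫ p, H p ^ 2 ∂Γ) * √(∫ p, r (H p) ^ 2 ∂Γ)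
      ≤ (n * W2 m ν) * √(B * r (n * W2 m ν)) := by gcongr
    _ = _ := by ring

/-- The second order expansion of `F_Φ`. -/
theorem norm_gradField_expansion_le (h : HessModulus Φ r B) {m ν : P2 d}
    {γ : Measure (M d × M d)} (hγ : γ ∈ optCouplings m ν) (x y : M d) :
    ‖gradField Φ ν y - gradField Φ m x
        - (diagField Φ m x (y - x) + ∫ p, hessField Φ m x p.1 (p.2 - p.1) ∂γ)‖
      ≤ ‖x - y‖ * (4 * r ‖x - y‖) + W2 m ν * (4 * (n * √(B * r (n * W2 m ν)))) := by
  have := isProbabilityMeasure_of_mem_couplings hγ.1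
  set Γ := Measure.pi fun _ : Fin n => γ with hΓ
  have hfm : Measurable fun p : Fin n → M d × M d => fun i => (p i).1 := by fun_prop
  have hX : Measurable fun p : Fin n → M d × M d =>
      (Fin.cons x fun i => (p i).1 : Fin (n + 1) → M d) :=
    measurable_cons measurable_const hfm
  have I1 := (h.memLp_partialGrad_cons 0 y (memLp_snd_coupling hγ.1) measurable_snd).integrable
    (by norm_num)
  have I2 := (h.memLp_partialGrad_cons 0 x (memLp_fst_coupling hγ.1) measurable_fst).integrable
    (by norm_num)
  have I3 : Integrable (fun p : Fin n → M d × M d =>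
      partialHess Φ 0 0 (Fin.cons x fun i => (p i).1) (y - x)) Γ :=
    h.integrable_partialHess_apply 0 0 hX (integrable_const _)
  have I4 : ∀ i : Fin n, Integrable (fun p : Fin n → M d × M d =>
      partialHess Φ i.succ 0 (Fin.cons x fun i => (p i).1) ((p i).2 - (p i).1)) Γ := fun i =>
    h.integrable_partialHess_apply i.succ 0 hX
      (integrable_comp_eval (μ := fun _ : Fin n => γ) (i := i) (integrable_sub_coupling hγ.1))
  -- All five terms become integrals over the same power of `γ`, so that the claim is the integral
  -- of the pointwise Taylor estimate for `partialGrad Φ 0`.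
  rw [h.gradField_eq_of_map measurable_snd hγ.1.2 y, h.gradField_eq_of_map measurable_fst hγ.1.1 x,
    h.diagField_eq_of_map measurable_fst hγ.1.1 x, ← h.sum_integral_partialHess_succ hγ.1 x,
    ContinuousLinearMap.integral_apply (h.integrable_partialHess 0 0 hX),
    ← integral_finsetSum _ fun i _ => I4 i]
  have I5 := integrable_finsetSum Finset.univ fun i _ => I4 i
  have e1 := integral_sub (I1.sub I2) (I3.add I5)
  rw [integral_add' I3 I5, integral_sub' I1 I2] at e1
  rw [← e1]
  obtain ⟨J, hJ⟩ := h.integral_sum_mul_modulus_le hγ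
  set s := ‖x - y‖ with hs
  have hs0 : 0 ≤ s := norm_nonneg _
  have hbound : ∀ p : Fin n → M d × M d,
      ‖partialGrad Φ 0 (Fin.cons y fun i => (p i).2) - partialGrad Φ 0 (Fin.cons x fun i => (p i).1)
        - (partialHess Φ 0 0 (Fin.cons x fun i => (p i).1) (y - x)
          + ∑ i : Fin n, partialHess Φ i.succ 0 (Fin.cons x fun i => (p i).1) ((p i).2 - (p i).1))‖
      ≤ 4 * (s * r s) + 4 * ((∑ i, ‖(p i).2 - (p i).1‖) * r (∑ i, ‖(p i).2 - (p i).1‖)) := by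
    intro p
    have h1 := h.norm_partialGrad_taylor_le 0 (Fin.cons x fun i => (p i).1)
      (Fin.cons y fun i => (p i).2)
    rw [sum_norm_cons_sub_cons, Fin.sum_univ_succ] at h1
    simp only [Fin.cons_zero, Fin.cons_succ] at h1
    rw [norm_sub_rev y x, ← hs] at h1
    exact h1.trans (h.mul_modulus_add_le hs0 (Finset.sum_nonneg fun i _ => norm_nonneg _))
  refine (norm_integral_le_of_norm_le ((integrable_const _).add (J.const_mul 4))
    (ae_of_all _ hbound)).trans ?_
  simp only [Pi.add_apply]
  rw [integral_add (integrable_const _) (J.const_mul 4), integral_const, integral_const_mul]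
  simp only [probReal_univ, one_smul]
  calc _ ≤ 4 * (s * r s) + 4 * (W2 m ν * (n * √(B * r (n * W2 m ν)))) := by gcongr
    _ = _ := by ring

end HessModulus

end Fields

end

noncomputable section

/-! ### Differentiability of `k`-polynomials -/

section KPoly

variable {d n k : ℕ}

namespace HessModulus

variable {Φ : (Fin (n + 1) → M d) → ℝ} {r : ℝ → ℝ} {B : ℝ}

/-- The Taylor expansion at the origin shows that `Φ` grows at most quadratically. -/
lemma integrable_comp_pi {Φ : (Fin k → M d) → ℝ} (h : HessModulus Φ r B) {Ω : Type*}
    [MeasurableSpace Ω] {μ : Measure Ω} [IsProbabilityMeasure μ] {u : Ω → M d} (hu : MemLp u 2 μ)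
    (hum : Measurable u) :
    Integrable (fun p : Fin k → Ω => Φ fun i => u (p i)) (Measure.pi fun _ : Fin k => μ) := by
  have hN : MemLp (fun p : Fin k → Ω => ∑ i, ‖u (p i)‖) 2 (Measure.pi fun _ : Fin k => μ) :=
    memLp_sum_norm_pi hu
  have h1 : Integrable (fun p : Fin k → Ω => (|Φ 0| + (∑ j, ‖partialGrad Φ j 0‖) *
      ∑ i, ‖u (p i)‖) + B * (∑ i, ‖u (p i)‖) ^ 2) (Measure.pi fun _ : Fin k => μ) :=
    ((integrable_const _).add ((hN.integrable (by norm_num)).const_mul _)).add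
      (hN.integrable_sq.const_mul B)
  refine h1.mono' ?_ (ae_of_all _ fun p => ?_)
  · have hm : Measurable fun (p : Fin k → Ω) i => u (p i) :=
      measurable_pi_lambda _ fun i => hum.comp (measurable_pi_apply i)
    exact (h.contDiff.continuous.measurable.comp hm).aestronglyMeasurable
  · set X : Fin k → M d := fun i => u (p i)
    have h2 := h.abs_taylor_le 0 X
    simp only [Pi.zero_apply, sub_zero] at h2
    have h3 : |∑ j, ⟪partialGrad Φ j 0, X j⟫| ≤ (∑ j, ‖partialGrad Φ j 0‖) * ∑ i, ‖X i‖ := by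
      rw [Finset.sum_mul]
      refine (Finset.abs_sum_le_sum_abs _ _).trans (Finset.sum_le_sum fun j _ => ?_)
      refine (abs_real_inner_le_norm _ _).trans ?_
      gcongr
      exact Finset.single_le_sum (f := fun i => ‖X i‖) (fun i _ => norm_nonneg _)
        (Finset.mem_univ j)
    rw [Real.norm_eq_abs]
    have h4 : Φ X = (Φ X - Φ 0 - ∑ j, ⟪partialGrad Φ j 0, X j⟫) + Φ 0
        + ∑ j, ⟪partialGrad Φ j 0, X j⟫ := by ring
    calc |Φ X| ≤ |Φ X - Φ 0 - ∑ j, ⟪partialGrad Φ j 0, X j⟫| + |Φ 0|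
          + |∑ j, ⟪partialGrad Φ j 0, X j⟫| := by
          conv_lhs => rw [h4]
          exact abs_add_three _ _ _
      _ ≤ _ := by linarith

lemma kPoly_eq_of_map {Φ : (Fin k → M d) → ℝ} (h : HessModulus Φ r B) {m : P2 d} {Ω : Type*}
    [MeasurableSpace Ω] {μ : Measure Ω} [IsProbabilityMeasure μ] {u : Ω → M d}
    (hu : Measurable u) (hm : μ.map u = m.1) :
    kPoly Φ m = (1 / (k : ℝ)) * ∫ p, Φ (fun i => u (p i)) ∂(Measure.pi fun _ : Fin k => μ) := by
  rw [integral_pi_comp_map μ hu h.contDiff.continuous.aestronglyMeasurable, hm]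
  rfl

lemma memLp_partialGrad_pi {Φ : (Fin k → M d) → ℝ} (h : HessModulus Φ r B) (j : Fin k) {Ω : Type*}
    [MeasurableSpace Ω] {μ : Measure Ω} [IsProbabilityMeasure μ] {u : Ω → M d} (hu : MemLp u 2 μ)
    (hum : Measurable u) :
    MemLp (fun p : Fin k → Ω => partialGrad Φ j fun i => u (p i)) 2
      (Measure.pi fun _ : Fin k => μ) := by
  have h2 : MemLp (fun p : Fin k → Ω => ∑ i, ‖u (p i)‖) 2 (Measure.pi fun _ : Fin k => μ) :=
    memLp_sum_norm_pi hu
  have h4 : MemLp (fun p : Fin k → Ω => B * ∑ i, ‖u (p i)‖) 2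
    (Measure.pi fun _ : Fin k => μ) := h2.const_mul B
  have h1 := (memLp_const (μ := Measure.pi fun _ : Fin k => μ) ‖partialGrad Φ j 0‖).add h4
  refine h1.of_le ?_ (ae_of_all _ fun p => ?_)
  · have hm : Measurable fun (p : Fin k → Ω) i => u (p i) :=
      measurable_pi_lambda _ fun i => hum.comp (measurable_pi_apply i)
    exact ((continuous_partialGrad h.contDiff j).measurable.comp hm).aestronglyMeasurable
  · exact (h.norm_partialGrad_le j _).trans (le_abs_self _)

lemma integrable_inner_partialGrad {Φ : (Fin k → M d) → ℝ} (h : HessModulus Φ r B) (j : Fin k)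
    {m ν : P2 d} {γ : Measure (M d × M d)} (hγ : γ ∈ couplings m ν) :
    Integrable (fun p : Fin k → M d × M d =>
      ⟪partialGrad Φ j (fun i => (p i).1), (p j).2 - (p j).1⟫) (Measure.pi fun _ : Fin k => γ) := by
  have := isProbabilityMeasure_of_mem_couplings hγ
  exact integrable_inner_of_memLp
    (h.memLp_partialGrad_pi j (memLp_fst_coupling hγ) measurable_fst)
    ((memLp_sub_coupling hγ).comp_measurePreserving
      (measurePreserving_eval (fun _ : Fin k => γ) j))

/-- Symmetry moves the index `j` to `0`; the remaining copies of the coupling then enter only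
through their first marginal, and integrating them out produces $A_m$. -/
lemma integral_inner_partialGrad (h : HessModulus Φ r B) (j : Fin (n + 1))
    {m ν : P2 d} {γ : Measure (M d × M d)} (hγ : γ ∈ couplings m ν) :
    ∫ p, ⟪partialGrad Φ j (fun i => (p i).1), (p j).2 - (p j).1⟫
      ∂(Measure.pi fun _ : Fin (n + 1) => γ) = ∫ q, ⟪gradField Φ m q.1, q.2 - q.1⟫ ∂γ := by
  have := isProbabilityMeasure_of_mem_couplings hγ
  let f : (Fin (n + 1) → M d × M d) → ℝ := fun p =>
    ⟪partialGrad Φ 0 (fun i => (p i).1), (p 0).2 - (p 0).1⟫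
  have e1 : ∀ p : Fin (n + 1) → M d × M d,
      ⟪partialGrad Φ j (fun i => (p i).1), (p j).2 - (p j).1⟫
        = f (fun i => p (Equiv.swap 0 j i)) := by
    intro p
    have h1 := partialGrad_perm h.symm (Equiv.swap 0 j) 0 (fun i => (p i).1)
    rw [Equiv.swap_apply_left] at h1
    rw [h1]
    simp [f]
  simp_rw [e1]
  rw [integral_pi_comp_perm γ (Equiv.swap 0 j) f,
    integral_pi_succ γ (h.integrable_inner_partialGrad 0 hγ)]
  refine integral_congr_ae (ae_of_all _ fun q => ?_)
  have e2 : ∀ y : Fin n → M d × M d,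
      (fun i => ((Fin.cons q y : Fin (n + 1) → M d × M d) i).1)
        = Fin.cons q.1 fun i => (y i).1 := by
    intro y
    funext i
    refine Fin.cases ?_ (fun l => ?_) i <;> simp
  have hi := (h.memLp_partialGrad_cons 0 q.1 (memLp_fst_coupling hγ) measurable_fst).integrable
    (by norm_num)
  dsimp only [f]
  simp only [Fin.cons_zero, e2]
  simp_rw [real_inner_comm (q.2 - q.1)]
  rw [integral_inner hi, h.gradField_eq_of_map measurable_fst hγ.1]

/-- Integrate the Taylor expansion of `Φ` over `n + 1` copies of the coupling. The linear terms all
coincide and cancel the normalisation $1/(n+1)$, while the remainder carries $(n+1)^2$, of which one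
factor is left. -/
theorem abs_kPoly_expansion_le (h : HessModulus Φ r B) {m ν : P2 d} {γ : Measure (M d × M d)}
    (hγ : γ ∈ optCouplings m ν) :
    |kPoly Φ ν - kPoly Φ m - ∫ p, ⟪gradField Φ m p.1, p.2 - p.1⟫ ∂γ|
      ≤ B * (n + 1) * W2 m ν ^ 2 := by
  have := isProbabilityMeasure_of_mem_couplings hγ.1
  have hB := h.nonneg
  set Γ := Measure.pi fun _ : Fin (n + 1) => γ with hΓ
  have I1 := h.integrable_comp_pi (memLp_snd_coupling hγ.1) measurable_snd
  have I2 := h.integrable_comp_pi (memLp_fst_coupling hγ.1) measurable_fst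
  have I3 := integrable_finsetSum Finset.univ fun j _ => h.integrable_inner_partialGrad j hγ.1
  have hN : MemLp (fun p : Fin (n + 1) → M d × M d => ∑ i, ‖(p i).2 - (p i).1‖) 2 Γ :=
    memLp_sum_norm_pi (memLp_sub_coupling hγ.1)
  have e1 : ((n : ℝ) + 1) * ∫ p, ⟪gradField Φ m p.1, p.2 - p.1⟫ ∂γ
      = ∫ p, ∑ j : Fin (n + 1), ⟪partialGrad Φ j (fun i => (p i).1), (p j).2 - (p j).1⟫ ∂Γ := by
    rw [integral_finsetSum _ fun j _ => h.integrable_inner_partialGrad j hγ.1]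
    simp_rw [h.integral_inner_partialGrad _ hγ.1]
    simp
  have hk : (0 : ℝ) < (n : ℝ) + 1 := by positivity
  rw [h.kPoly_eq_of_map measurable_snd hγ.1.2, h.kPoly_eq_of_map measurable_fst hγ.1.1]
  push_cast
  have e2 : 1 / ((n : ℝ) + 1) * ∫ p, Φ (fun i => (p i).2) ∂Γ
      - 1 / ((n : ℝ) + 1) * ∫ p, Φ (fun i => (p i).1) ∂Γ
      - ∫ p, ⟪gradField Φ m p.1, p.2 - p.1⟫ ∂γ
      = 1 / ((n : ℝ) + 1) * ∫ p, (Φ (fun i => (p i).2) - Φ (fun i => (p i).1)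
        - ∑ j : Fin (n + 1), ⟪partialGrad Φ j (fun i => (p i).1), (p j).2 - (p j).1⟫) ∂Γ := by
    have e3 := integral_sub (I1.sub I2) I3
    rw [integral_sub' I1 I2, ← e1] at e3
    simp only [Pi.sub_apply] at e3
    rw [e3]
    field_simp
    rfl
  rw [e2, abs_mul, abs_of_pos (by positivity : 0 < 1 / ((n : ℝ) + 1))]
  have e4 : |∫ p, (Φ (fun i => (p i).2) - Φ (fun i => (p i).1)
        - ∑ j : Fin (n + 1), ⟪partialGrad Φ j (fun i => (p i).1), (p j).2 - (p j).1⟫) ∂Γ|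
      ≤ B * (((n : ℝ) + 1) ^ 2 * W2 m ν ^ 2) := by
    rw [← Real.norm_eq_abs]
    refine (norm_integral_le_of_norm_le (hN.integrable_sq.const_mul B)
      (ae_of_all _ fun p => h.abs_taylor_le _ _)).trans ?_
    rw [integral_const_mul]
    gcongr
    have := integral_sum_norm_sq_pi_le (k := n + 1) (memLp_sub_coupling hγ.1)
    rw [W2_sq_eq hγ] at this
    exact_mod_cast this
  calc _ ≤ 1 / ((n : ℝ) + 1) * (B * (((n : ℝ) + 1) ^ 2 * W2 m ν ^ 2)) := by gcongr
    _ = _ := by field_simp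

theorem hasWExpansion (h : HessModulus Φ r B) (m : P2 d) :
    HasWExpansion (kPoly Φ) m (gradField Φ m) := by
  intro ε hε
  have hB := h.nonneg
  refine ⟨ε / (B * (n + 1) + 1), by positivity, fun ν hν γ hγ => ?_⟩
  refine (h.abs_kPoly_expansion_le hγ).trans ?_
  have hW := W2_nonneg m ν
  rw [lt_div_iff₀ (by positivity)] at hν
  have : B * (n + 1) * W2 m ν ≤ ε := by nlinarith
  rw [sq, ← mul_assoc]
  gcongr

/-- The bounded Hessian makes `partialGrad Φ 0` Lipschitz in all variables: moving the point costs
`‖y - x‖`, and each of the `n` integrated variables costs at most $W_2$ on average. -/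
lemma norm_gradField_sub_le (h : HessModulus Φ r B) {m ν : P2 d} (x y : M d) :
    ‖gradField Φ ν y - gradField Φ m x‖ ≤ B * (‖y - x‖ + n * W2 m ν) := by
  obtain ⟨γ, hγ⟩ := optCouplings_nonempty m ν
  have := isProbabilityMeasure_of_mem_couplings hγ.1
  have hB := h.nonneg
  have I1 := (h.memLp_partialGrad_cons 0 y (memLp_snd_coupling hγ.1) measurable_snd).integrable
    (by norm_num)
  have I2 := (h.memLp_partialGrad_cons 0 x (memLp_fst_coupling hγ.1) measurable_fst).integrable
    (by norm_num)
  have I3 : Integrable (fun p : Fin n → M d × M d => ∑ i, ‖(p i).2 - (p i).1‖)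
      (Measure.pi fun _ : Fin n => γ) :=
    (memLp_sum_norm_pi (memLp_sub_coupling hγ.1)).integrable (by norm_num)
  rw [h.gradField_eq_of_map measurable_snd hγ.1.2 y, h.gradField_eq_of_map measurable_fst hγ.1.1 x,
    ← integral_sub I1 I2]
  refine (norm_integral_le_of_norm_le (((integrable_const ‖y - x‖).add I3).const_mul B)
    (ae_of_all _ fun p => ?_)).trans ?_
  · refine (h.norm_partialGrad_sub_le 0 _ _).trans ?_
    rw [sum_norm_cons_sub_cons]
    exact le_rfl
  · rw [integral_const_mul, integral_add' (integrable_const _) I3, integral_const,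
      integral_sum_norm_pi (integrable_sub_coupling hγ.1)]
    simp only [probReal_univ, one_smul]
    have := integral_norm_sub_le_W2 hγ
    gcongr

lemma norm_gradField_sub_le_self (h : HessModulus Φ r B) (m : P2 d) (x y : M d) :
    ‖gradField Φ m y - gradField Φ m x‖ ≤ B * ‖y - x‖ := by
  simpa [W2_self] using h.norm_gradField_sub_le (m := m) (ν := m) x y

lemma continuous_gradField (h : HessModulus Φ r B) (m : P2 d) : Continuous (gradField Φ m) := by
  refine (LipschitzWith.of_dist_le_mul (K := ⟨B, h.nonneg⟩) fun x y => ?_).continuous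
  rw [dist_eq_norm, dist_eq_norm]
  exact h.norm_gradField_sub_le_self m y x

lemma norm_gradField_le (h : HessModulus Φ r B) (m ν : P2 d) (y : M d) :
    ‖gradField Φ ν y‖ ≤ ‖gradField Φ m 0‖ + B * (‖y‖ + n * W2 m ν) := by
  have h1 := h.norm_gradField_sub_le (m := m) (ν := ν) 0 y
  have h2 := norm_le_norm_add_norm_sub (gradField Φ m 0) (gradField Φ ν y)
  rw [norm_sub_rev] at h2
  rw [sub_zero] at h1
  linarith

lemma memLp_gradField (h : HessModulus Φ r B) (m : P2 d) : MemLp (gradField Φ m) 2 m.1 := by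
  have h1 : MemLp (fun y : M d => ‖gradField Φ m 0‖ + B * ‖y‖) 2 m.1 :=
    (memLp_const ‖gradField Φ m 0‖).add ((memLp_id m).norm.const_mul B)
  refine h1.of_le (h.continuous_gradField m).aestronglyMeasurable (ae_of_all _ fun y => ?_)
  refine (h.norm_gradField_le m m y).trans ?_
  rw [W2_self, mul_zero, add_zero]
  exact le_abs_self _

lemma gradient_comp_cons (Φ : (Fin (n + 1) → M d) → ℝ) (y : Fin n → M d) :
    gradient (fun a => Φ (Fin.cons a y)) = fun a => partialGrad Φ 0 (Fin.cons a y) := by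
  funext a
  simp [partialGrad, Fin.update_cons_zero]

lemma contDiff_cons_left (y : Fin n → M d) {N : WithTop ℕ∞} :
    ContDiff ℝ N fun a : M d => (Fin.cons a y : Fin (n + 1) → M d) := by
  refine contDiff_pi.2 fun i => ?_
  refine Fin.cases ?_ (fun j => ?_) i
  · exact contDiff_id
  · simpa using contDiff_const

/-- $A_m$ averages the gradients of the partial functions $a\mapsto\Phi(a,y)$ over $y$. Each of them
grows linearly with a constant that is integrable in $y$, so the tangent space is stable under this
average. -/
theorem gradField_mem_tangent (h : HessModulus Φ r B) {m : P2 d} {z : L2 m}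
    (hz : z =ᵐ[m.1] gradField Φ m) : z ∈ tangent m := by
  have hB := h.nonneg
  have hN : Integrable (fun p : Fin n → M d => ∑ i, ‖p i‖) (Measure.pi fun _ : Fin n => m.1) :=
    (memLp_sum_norm_pi (u := fun x : M d => x) (memLp_id m)).integrable (by norm_num)
  have hbound : ∀ (y : Fin n → M d) (a : M d), ‖partialGrad Φ 0 (Fin.cons a y)‖
      ≤ ((‖partialGrad Φ 0 0‖ + B) + B * ∑ i, ‖y i‖) * (1 + ‖a‖) := by
    intro y a
    refine (h.norm_partialGrad_le 0 _).trans ?_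
    rw [sum_norm_cons]
    have h1 := norm_nonneg a
    have h2 : 0 ≤ ∑ i, ‖y i‖ := Finset.sum_nonneg fun i _ => norm_nonneg _
    have h3 := norm_nonneg (partialGrad Φ 0 0)
    nlinarith [mul_nonneg h3 h1, mul_nonneg (mul_nonneg hB h2) h1]
  refine mem_tangent_of_integral (μ := Measure.pi fun _ : Fin n => m.1)
    (F := fun y a => partialGrad Φ 0 (Fin.cons a y))
    (b := fun y => (‖partialGrad Φ 0 0‖ + B) + B * ∑ i, ‖y i‖) (c := fun a => 1 + ‖a‖)
    ?_ ((integrable_const _).add (hN.const_mul B)) ((memLp_const (1 : ℝ)).add (memLp_id m).norm)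
    hbound (fun y => ?_) hz
  · exact (continuous_partialGrad h.contDiff 0).measurable.comp
      (measurable_cons measurable_snd measurable_fst)
  · have hc : ContDiff ℝ 1 fun a => Φ (Fin.cons a y) :=
      (h.contDiff.of_le (by norm_num)).comp (contDiff_cons_left y)
    have hmem : MemLp (fun a => partialGrad Φ 0 (Fin.cons a y)) 2 m.1 := by
      refine MemLp.of_le (((memLp_const (1 : ℝ)).add (memLp_id m).norm).const_mul
        ((‖partialGrad Φ 0 0‖ + B) + B * ∑ i, ‖y i‖)) ?_
        (ae_of_all _ fun a => (hbound y a).trans (le_abs_self _))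
      rw [← gradient_comp_cons]
      exact (continuous_gradient hc).aestronglyMeasurable
    refine ⟨hmem.toLp, mem_tangent_of_gradient hc (C := (‖partialGrad Φ 0 0‖ + B) + B * ∑ i, ‖y i‖)
      (fun a => ?_) (z := hmem.toLp) ?_, hmem.coeFn_toLp⟩
    · rw [gradient_comp_cons]; exact hbound y a
    · rw [gradient_comp_cons]; exact hmem.coeFn_toLp

theorem wDifferentiableAt (h : HessModulus Φ r B) (m : P2 d) : WDifferentiableAt (kPoly Φ) m :=
  ((h.hasWExpansion m).congr (h.memLp_gradField m).coeFn_toLp.symm).wDifferentiableAt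

theorem isWGrad_iff (h : HessModulus Φ r B) (m : P2 d) {ξ : L2 m} :
    IsWGrad (kPoly Φ) m ξ ↔ ξ = (h.memLp_gradField m).toLp :=
  ((h.hasWExpansion m).congr (h.memLp_gradField m).coeFn_toLp.symm).isWGrad_iff
    (h.gradField_mem_tangent (h.memLp_gradField m).coeFn_toLp)

theorem wGrad_eq (h : HessModulus Φ r B) (m : P2 d) :
    wGrad (kPoly Φ) m = (h.memLp_gradField m).toLp :=
  ((h.hasWExpansion m).congr (h.memLp_gradField m).coeFn_toLp.symm).wGrad_eq
    (h.gradField_mem_tangent (h.memLp_gradField m).coeFn_toLp)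

theorem wGrad_ae_eq (h : HessModulus Φ r B) (m : P2 d) :
    wGrad (kPoly Φ) m =ᵐ[m.1] gradField Φ m := by
  rw [h.wGrad_eq m]
  exact (h.memLp_gradField m).coeFn_toLp

lemma continuous_diagField (h : HessModulus Φ r B) (m : P2 d) : Continuous (diagField Φ m) := by
  refine continuous_of_dominated (bound := fun _ => B) (fun x => ?_)
    (fun x => ae_of_all _ fun y => h.norm_hess_le 0 0 _) (integrable_const B)
    (ae_of_all _ fun y => ?_)
  · exact ((continuous_partialHess h.contDiff 0 0).comp (continuous_cons x)).aestronglyMeasurable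
  · exact (continuous_partialHess h.contDiff 0 0).comp
      (continuous_finCons continuous_id continuous_const)

lemma norm_diagField_le (h : HessModulus Φ r B) (m : P2 d) (x : M d) : ‖diagField Φ m x‖ ≤ B := by
  refine (norm_integral_le_of_norm_le_const (ae_of_all _ fun y => h.norm_hess_le 0 0 _)).trans ?_
  simp

lemma continuous_hessField (h : HessModulus Φ r B) (m : P2 d) :
    Continuous fun p : M d × M d => hessField Φ m p.1 p.2 := by
  cases n with
  | zero => exact continuous_const
  | succ n =>
    refine Continuous.const_smul (c := (n : ℝ) + 1) ?_
    refine continuous_of_dominated (bound := fun _ => B) (fun p => ?_)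
      (fun p => ae_of_all _ fun y => h.norm_hess_le 1 0 _) (integrable_const B)
      (ae_of_all _ fun y => ?_)
    · exact ((continuous_partialHess h.contDiff 1 0).comp ((continuous_cons p.1).comp
        (continuous_cons p.2))).aestronglyMeasurable
    · exact (continuous_partialHess h.contDiff 1 0).comp
        (continuous_finCons continuous_fst (continuous_finCons continuous_snd continuous_const))

lemma norm_hessField_le (h : HessModulus Φ r B) (m : P2 d) (x a : M d) :
    ‖hessField Φ m x a‖ ≤ n * B := by
  cases n with
  | zero => simp [hessField]
  | succ n =>
    rw [hessField, norm_smul, Real.norm_eq_abs, abs_of_pos (by positivity)]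
    push_cast
    gcongr
    refine (norm_integral_le_of_norm_le_const (ae_of_all _ fun y => h.norm_hess_le 1 0 _)).trans ?_
    simp

/-- `F_Φ` has a second order expansion with coefficients `diagField` and `hessField`. -/
theorem hasSecondOrderExpansion (h : HessModulus Φ r B) (m : P2 d) :
    HasSecondOrderExpansion (kPoly Φ) m (diagField Φ m) (hessField Φ m) := by
  have hB := h.nonneg
  refine ⟨(h.continuous_diagField m).measurable, ⟨B, h.norm_diagField_le m⟩,
    (h.continuous_hessField m).measurable, ⟨n * B, h.norm_hessField_le m⟩,
    gradField Φ, fun t => 4 * r t, fun t => 4 * (n * √(B * r (n * t))),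
    fun ν _ => h.wGrad_ae_eq ν, ⟨1, one_pos, ‖gradField Φ m 0‖ + B * (1 + n), fun ν hν =>
      ⟨h.wDifferentiableAt ν, h.continuous_gradField ν, fun x => ?_⟩⟩,
    h.modulus.comp_const_mul_nonneg (by norm_num), fun t _ => by positivity, ?_,
    fun ν _ γ hγ x y => h.norm_gradField_expansion_le hγ x y⟩
  · refine (h.norm_gradField_le m ν x).trans ?_
    have h1 := norm_nonneg x
    have h2 := norm_nonneg (gradField Φ m 0)
    have h3 : (n : ℝ) * W2 m ν ≤ n := mul_le_of_le_one_right (by positivity) hν.le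
    have h4 : B * (n * W2 m ν) ≤ B * n := by gcongr
    nlinarith [mul_nonneg h2 h1, mul_nonneg (mul_nonneg hB (Nat.cast_nonneg (α := ℝ) n)) h1]
  · have h1 := h.modulus.tendsto_zero (c := (n : ℝ)) (by positivity)
    have h2 := (((h1.const_mul B).sqrt).const_mul (n : ℝ)).const_mul 4
    simpa using h2

end HessModulus

end KPoly

end

noncomputable section

/-! ### Rows of `A_{mm}` and uniqueness of the second order coefficients -/

section Rows

variable {d n k : ℕ}

lemma matRow_eq_adjoint (L : M d →L[ℝ] M d) (i : Fin d) :
    matRow L i = ContinuousLinearMap.adjoint L (EuclideanSpace.single i 1) := by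
  ext j
  have h : (ContinuousLinearMap.adjoint L (EuclideanSpace.single i 1)) j
      = ⟪(EuclideanSpace.single j (1 : ℝ) : M d),
        ContinuousLinearMap.adjoint L (EuclideanSpace.single i 1)⟫ := by
    rw [EuclideanSpace.inner_single_left]; simp
  rw [h, ContinuousLinearMap.adjoint_inner_right, EuclideanSpace.inner_single_right]
  simp [matRow]

lemma continuous_adjoint_apply (v : M d) :
    Continuous fun L : M d →L[ℝ] M d => ContinuousLinearMap.adjoint L v :=
  (ContinuousLinearMap.adjoint (𝕜 := ℝ) (E := M d) (F := M d)).continuous.clm_apply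
    continuous_const

lemma norm_adjoint_apply_le (L : M d →L[ℝ] M d) (v : M d) :
    ‖ContinuousLinearMap.adjoint L v‖ ≤ ‖L‖ * ‖v‖ := by
  refine (ContinuousLinearMap.le_opNorm _ _).trans ?_
  rw [LinearIsometryEquiv.norm_map]

lemma contDiff_partialGrad {Φ : (Fin k → M d) → ℝ} (hΦ : ContDiff ℝ 2 Φ) (j : Fin k) :
    ContDiff ℝ 1 (partialGrad Φ j) := by
  have h1 : partialGrad Φ j = fun x => gradProj d k j (fderiv ℝ Φ x) :=
    funext fun x => partialGrad_eq (hΦ.differentiable (by norm_num)) j x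
  rw [h1]
  exact (gradProj d k j).contDiff.comp (hΦ.fderiv_right (by norm_num))

lemma contDiff_cons_right (x : M d) {N : WithTop ℕ∞} :
    ContDiff ℝ N fun y : Fin n → M d => (Fin.cons x y : Fin (n + 1) → M d) := by
  refine contDiff_pi.2 fun i => ?_
  refine Fin.cases ?_ (fun j => ?_) i
  · simpa using contDiff_const
  · exact contDiff_apply ℝ (M d) j

lemma hasFDerivAt_partialGrad_cons_cons {Φ : (Fin (n + 2) → M d) → ℝ} (hΦ : ContDiff ℝ 2 Φ)
    (x a : M d) (y : Fin n → M d) :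
    HasFDerivAt (fun z => partialGrad Φ 0 (Fin.cons x (Fin.cons z y)))
      (partialHess Φ 1 0 (Fin.cons x (Fin.cons a y))) a := by
  have hc : ContDiff ℝ 1 fun z => partialGrad Φ 0 (Fin.cons x (Fin.cons z y)) :=
    (contDiff_partialGrad hΦ 0).comp ((contDiff_cons_right x).comp (HessModulus.contDiff_cons_left y))
  have hu : ∀ z, Function.update (Fin.cons x (Fin.cons a y) : Fin (n + 2) → M d) 1 z
      = Fin.cons x (Fin.cons z y) := by
    intro z
    rw [← Fin.succ_zero_eq_one, ← Fin.cons_update, Fin.update_cons_zero]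
  have h := (hc.differentiable (by norm_num) a).hasFDerivAt
  have e : partialHess Φ 1 0 (Fin.cons x (Fin.cons a y))
      = fderiv ℝ (fun z => partialGrad Φ 0 (Fin.cons x (Fin.cons z y))) a := by
    unfold partialHess
    simp_rw [hu]
    rfl
  rw [e]
  exact h

/-- The rows of `a ↦ A_{mm}(x, a)` are tangent. -/
theorem HessModulus.adjoint_hessField_mem_tangent {Φ : (Fin (n + 1) → M d) → ℝ} {r : ℝ → ℝ}
    {B : ℝ} (h : HessModulus Φ r B) {m : P2 d} (x v : M d) {z : L2 m}
    (hz : z =ᵐ[m.1] fun a => ContinuousLinearMap.adjoint (hessField Φ m x a) v) :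
    z ∈ tangent m := by
  have hB := h.nonneg
  cases n with
  | zero =>
    have : z = 0 := by
      refine Lp.ext (hz.trans (EventuallyEq.trans ?_ (Lp.coeFn_zero _ _ _).symm))
      exact ae_of_all _ fun a => by simp [hessField]
    rw [this]
    exact zero_mem _
  | succ n =>
    let T : (Fin n → M d) → M d → M d →L[ℝ] M d := fun y a =>
      partialHess Φ 1 0 (Fin.cons x (Fin.cons a y))
    let F : (Fin n → M d) → M d → M d := fun y a =>
      ((n : ℝ) + 1) • ContinuousLinearMap.adjoint (T y a) v
    have hbound : ∀ y a, ‖F y a‖ ≤ (((n : ℝ) + 1) * (B * ‖v‖)) * 1 := by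
      intro y a
      rw [mul_one, norm_smul, Real.norm_eq_abs, abs_of_pos (by positivity)]
      gcongr
      refine (norm_adjoint_apply_le _ _).trans ?_
      gcongr
      exact h.norm_hess_le 1 0 _
    have hFc : Continuous (Function.uncurry F) := by
      refine Continuous.const_smul (c := (n : ℝ) + 1) ((continuous_adjoint_apply v).comp ?_)
      exact (continuous_partialHess h.contDiff 1 0).comp
        (continuous_finCons continuous_const (continuous_finCons continuous_snd continuous_fst))
    -- A combination of rows of $\nabla^2_{x_2x_1}\Phi$ is the gradient in $x_2$ of a component of
    -- $\nabla_{x_1}\Phi$; this is the source of tangency.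
    have hgrad : ∀ y, gradient (fun a =>
        ((n : ℝ) + 1) * ⟪v, partialGrad Φ 0 (Fin.cons x (Fin.cons a y))⟫) = F y := by
      intro y
      funext a
      have h1 : HasFDerivAt (fun a => ((n : ℝ) + 1) *
          ⟪v, partialGrad Φ 0 (Fin.cons x (Fin.cons a y))⟫)
          (((n : ℝ) + 1) • ((innerSL ℝ v).comp (T y a))) a :=
        (((innerSL ℝ v).hasFDerivAt (𝕜 := ℝ)
          (x := partialGrad Φ 0 (Fin.cons x (Fin.cons a y)))).comp a
          (hasFDerivAt_partialGrad_cons_cons h.contDiff x a y)).const_mul _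
      refine ext_inner_right ℝ fun w => ?_
      rw [inner_gradient_apply, h1.fderiv]
      simp [F, real_inner_smul_left, ContinuousLinearMap.adjoint_inner_left]
    refine mem_tangent_of_integral (μ := Measure.pi fun _ : Fin n => m.1) (F := F)
      (b := fun _ => ((n : ℝ) + 1) * (B * ‖v‖)) (c := fun _ => 1) hFc.measurable
      (integrable_const _) (memLp_const _) hbound (fun y => ?_) (hz.trans (ae_of_all _ fun a => ?_))
    · have hcd : ContDiff ℝ 1 fun a =>
          ((n : ℝ) + 1) * ⟪v, partialGrad Φ 0 (Fin.cons x (Fin.cons a y))⟫ :=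
        contDiff_const.mul (contDiff_const.inner ℝ ((contDiff_partialGrad h.contDiff 0).comp
          ((contDiff_cons_right x).comp (contDiff_cons_left y))))
      have hmem : MemLp (F y) 2 m.1 := by
        refine MemLp.of_bound ?_ ((((n : ℝ) + 1) * (B * ‖v‖)) * 1) (ae_of_all _ (hbound y))
        rw [← hgrad]
        exact (continuous_gradient hcd).aestronglyMeasurable
      refine ⟨hmem.toLp, mem_tangent_of_gradient hcd (C := ((n : ℝ) + 1) * (B * ‖v‖)) (fun a => ?_)
        (z := hmem.toLp) ?_, hmem.coeFn_toLp⟩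
      · rw [hgrad]
        refine (hbound y a).trans ?_
        gcongr
        linarith [norm_nonneg a]
      · rw [hgrad]; exact hmem.coeFn_toLp
    · have hX : Measurable fun y : Fin n → M d =>
          (Fin.cons x (Fin.cons a y) : Fin (n + 2) → M d) :=
        measurable_cons measurable_const (measurable_cons measurable_const measurable_id)
      have hi : Integrable (fun y => T y a) (Measure.pi fun _ : Fin n => m.1) :=
        h.integrable_partialHess 1 0 hX
      have hiF : Integrable (fun y => F y a) (Measure.pi fun _ : Fin n => m.1) :=
        Integrable.of_bound (hFc.comp (continuous_id.prodMk continuous_const)).aestronglyMeasurable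
          _ (ae_of_all _ fun y => hbound y a)
      refine ext_inner_right ℝ fun w => ?_
      dsimp only
      rw [ContinuousLinearMap.adjoint_inner_left, real_inner_comm w, ← integral_inner hiF]
      have e1 : hessField Φ m x a w = ((n : ℝ) + 1) • ∫ y, T y a w
          ∂(Measure.pi fun _ : Fin n => m.1) := by
        rw [← ContinuousLinearMap.integral_apply hi]; rfl
      have hiw : Integrable (fun y => T y a w) (Measure.pi fun _ : Fin n => m.1) :=
        h.integrable_partialHess_apply 1 0 hX (integrable_const w)
      rw [e1, real_inner_smul_right, ← integral_inner hiw, ← integral_const_mul]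
      refine integral_congr_ae (ae_of_all _ fun y => ?_)
      simp [F, real_inner_smul_right, ContinuousLinearMap.adjoint_inner_right, real_inner_comm]

/-! ### Uniqueness of the second order coefficients -/

lemma hasFDerivAt_of_modulus {E : Type*} [NormedAddCommGroup E] [NormedSpace ℝ E] {f : E → E}
    {L : E →L[ℝ] E} {x : E} {ρ : ℝ → ℝ} (hρ : IsConcaveModulus ρ)
    (h : ∀ y, ‖f y - f x - L (y - x)‖ ≤ ‖x - y‖ * ρ ‖x - y‖) : HasFDerivAt f L x := by
  rw [hasFDerivAt_iff_isLittleO, Asymptotics.isLittleO_iff]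
  intro c hc
  have h1 := hρ.cont 0 self_mem_Ici
  rw [ContinuousWithinAt, hρ.zero] at h1
  have h2 : Tendsto (fun y => ‖x - y‖) (𝓝 x) (𝓝[Ici 0] 0) := by
    refine tendsto_nhdsWithin_iff.2 ⟨?_, Eventually.of_forall fun y => norm_nonneg _⟩
    have : Continuous fun y => ‖x - y‖ := by fun_prop
    simpa using this.tendsto x
  filter_upwards [(h1.comp h2).eventually (gt_mem_nhds hc)] with y hy
  refine (h y).trans ?_
  rw [mul_comm, norm_sub_rev x y]
  rw [Function.comp_apply, norm_sub_rev x y] at hy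
  gcongr

lemma exists_mul_le_of_tendsto {e : ℝ → ℝ} (he : Tendsto e (𝓝[>] 0) (𝓝 0)) {η : ℝ} (hη : 0 < η) :
    ∃ δ > 0, ∀ w, 0 ≤ w → w < δ → w * e w ≤ w * η := by
  have h1 := he.eventually (gt_mem_nhds hη)
  rw [eventually_nhdsWithin_iff, Metric.eventually_nhds_iff] at h1
  obtain ⟨δ, hδ, H⟩ := h1
  refine ⟨δ, hδ, fun w hw hwδ => ?_⟩
  rcases hw.eq_or_lt with rfl | hw0
  · simp
  · have := H (y := w) (by rwa [Real.dist_eq, sub_zero, abs_of_pos hw0]) hw0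
    gcongr

/-- Take $\nu=(1-t)m+t\delta_y$; sending the fraction $t$ of all mass to $y$ costs
$t\int|y-x|^2\,dm$. An identity valid only $\nu$-almost everywhere then holds at the point $y$. -/
lemma exists_W2_lt_and_atom (m : P2 d) (y : M d) {δ : ℝ} (hδ : 0 < δ) :
    ∃ ν : P2 d, W2 m ν < δ ∧ ν.1 {y} ≠ 0 := by
  set K := ∫ x, ‖y - x‖ ^ 2 ∂m.1 with hK
  have hK0 : 0 ≤ K := integral_nonneg fun x => by positivity
  obtain ⟨t, ht0, ht⟩ : ∃ t, 0 < t ∧ t < min 1 (δ ^ 2 / (K + 1)) :=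
    exists_between (lt_min one_pos (by positivity))
  have ht1 : t < 1 := ht.trans_le (min_le_left _ _)
  have htK : t * K < δ ^ 2 := by
    have := (lt_div_iff₀ (by positivity)).1 (ht.trans_le (min_le_right _ _))
    nlinarith
  set a := ENNReal.ofReal (1 - t) with ha
  set b := ENNReal.ofReal t with hb
  have hab : a + b = 1 := by
    rw [ha, hb, ← ENNReal.ofReal_add (by linarith) ht0.le]
    simp
  have hb0 : b ≠ 0 := by rw [hb]; simpa using ht0
  let ν₀ : Measure (M d) := a • m.1 + b • Measure.dirac y
  have hν : IsProbabilityMeasure ν₀ ∧ ∫⁻ x, ‖x‖ₑ ^ 2 ∂ν₀ < ⊤ := by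
    constructor
    · refine ⟨?_⟩
      simp [ν₀, hab]
    · rw [lintegral_add_measure, lintegral_smul_measure, lintegral_smul_measure, lintegral_dirac]
      refine ENNReal.add_lt_top.2 ⟨?_, ?_⟩
      · exact ENNReal.mul_lt_top ENNReal.ofReal_lt_top m.2.2
      · exact ENNReal.mul_lt_top ENNReal.ofReal_lt_top (ENNReal.pow_lt_top enorm_lt_top)
  let ν : P2 d := ⟨ν₀, hν⟩
  let γ : Measure (M d × M d) := a • m.1.map (fun x => (x, x)) + b • m.1.map (fun x => (x, y))
  have hγ : γ ∈ couplings m ν := by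
    constructor
    · rw [Measure.map_add _ _ measurable_fst, Measure.map_smul, Measure.map_smul,
        Measure.map_map measurable_fst (by fun_prop), Measure.map_map measurable_fst (by fun_prop)]
      have e : ∀ g : M d → M d × M d, (∀ x, (g x).1 = x) → m.1.map (Prod.fst ∘ g) = m.1 := by
        intro g hg
        have : Prod.fst ∘ g = id := funext hg
        rw [this, Measure.map_id]
      rw [e _ fun _ => rfl, e _ fun _ => rfl, ← add_smul, hab, one_smul]
    · rw [Measure.map_add _ _ measurable_snd, Measure.map_smul, Measure.map_smul,
        Measure.map_map measurable_snd (by fun_prop), Measure.map_map measurable_snd (by fun_prop)]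
      have e1 : m.1.map (Prod.snd ∘ fun x : M d => (x, x)) = m.1 := Measure.map_id
      have e2 : m.1.map (Prod.snd ∘ fun x : M d => (x, y)) = Measure.dirac y := by
        change m.1.map (fun _ => y) = _
        simp [Measure.map_const]
      rw [e1, e2]
  refine ⟨ν, ?_, ?_⟩
  · have h1 := W2_sq_le hγ
    have hi1 : Integrable (fun p : M d × M d => ‖p.2 - p.1‖ ^ 2)
        (a • m.1.map (fun x => (x, x))) := (integrable_norm_sub_sq_coupling hγ).mono_measure
          (Measure.le_add_right le_rfl)
    have hi2 : Integrable (fun p : M d × M d => ‖p.2 - p.1‖ ^ 2)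
        (b • m.1.map (fun x => (x, y))) := (integrable_norm_sub_sq_coupling hγ).mono_measure
          (Measure.le_add_left le_rfl)
    rw [integral_add_measure hi1 hi2, integral_smul_measure, integral_smul_measure,
      integral_map (by fun_prop) (by fun_prop), integral_map (by fun_prop) (by fun_prop)] at h1
    have h2 : W2 m ν ^ 2 ≤ t * K := by
      simpa [hb, ht0.le, ENNReal.toReal_ofReal] using h1
    exact lt_of_pow_lt_pow_left₀ 2 hδ.le (h2.trans_lt htK)
  · change ν₀ {y} ≠ 0
    simp only [ν₀, Measure.add_apply, Measure.smul_apply, smul_eq_mul]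
    simp [hb0]

lemma eq_of_ae_eq_of_atom {E : Type*} {μ : Measure (M d)} {f g : M d → E} (h : f =ᵐ[μ] g) {y : M d}
    (hy : μ {y} ≠ 0) : f y = g y := by
  by_contra hne
  refine hy (measure_mono_null ?_ (ae_iff.1 h))
  rintro _ rfl
  exact hne

namespace HessModulus

variable {Φ : (Fin (n + 1) → M d) → ℝ} {r : ℝ → ℝ} {B : ℝ}

/-- At `ν = m` with the diagonal coupling, the second order expansion reduces to the statement of
differentiability in the point. -/
lemma hasFDerivAt_gradField (h : HessModulus Φ r B) (m : P2 d) (x : M d) :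
    HasFDerivAt (gradField Φ m) (diagField Φ m x) x := by
  refine hasFDerivAt_of_modulus (h.modulus.comp_const_mul_nonneg (c := 4) (by norm_num))
    fun y => ?_
  have := h.norm_gradField_expansion_le (diagCoupling_mem m) x y
  rw [W2_self, zero_mul, add_zero] at this
  have hz : ∫ p, hessField Φ m x p.1 (p.2 - p.1) ∂(diagCoupling m) = 0 := by
    rw [diagCoupling, integral_map (by fun_prop)]
    · simp
    · exact (((h.continuous_hessField m).comp (continuous_const.prodMk continuous_fst)).clm_apply
        (continuous_snd.sub continuous_fst)).aestronglyMeasurable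
  rwa [hz, add_zero] at this

lemma integrable_coeff_apply {A : M d → M d →L[ℝ] M d} (hA : Measurable A)
    {C : ℝ} (hC : ∀ a, ‖A a‖ ≤ C) {m ν : P2 d} {γ : Measure (M d × M d)}
    (hγ : γ ∈ couplings m ν) : Integrable (fun p : M d × M d => A p.1 (p.2 - p.1)) γ := by
  refine ((integrable_sub_coupling hγ).norm.const_mul C).mono' ?_ (ae_of_all _ fun p => ?_)
  · have hc : Continuous fun q : (M d →L[ℝ] M d) × M d => q.1 q.2 :=
      continuous_fst.clm_apply continuous_snd
    exact (hc.measurable.comp ((hA.comp measurable_fst).prodMk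
      (measurable_snd.sub measurable_fst))).aestronglyMeasurable
  · refine (ContinuousLinearMap.le_opNorm _ _).trans ?_
    gcongr
    exact hC _

lemma norm_integral_coeff_apply_le {A : M d → M d →L[ℝ] M d}
    {C : ℝ} (hC : ∀ a, ‖A a‖ ≤ C) {m ν : P2 d} {γ : Measure (M d × M d)}
    (hγ : γ ∈ optCouplings m ν) : ‖∫ p, A p.1 (p.2 - p.1) ∂γ‖ ≤ C * W2 m ν := by
  refine (norm_integral_le_of_norm_le ((integrable_sub_coupling hγ.1).norm.const_mul C)
    (ae_of_all _ fun p => ?_)).trans ?_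
  · refine (ContinuousLinearMap.le_opNorm _ _).trans ?_
    gcongr
    exact hC _
  · rw [integral_const_mul]
    have := (norm_nonneg _).trans (hC 0)
    gcongr
    exact integral_norm_sub_le_W2 hγ

/-- The representative of the gradient in a second order expansion of `F_Φ` is `A_m`. -/
theorem eq_gradField_of_expansion (h : HessModulus Φ r B) {m : P2 d}
    {Amm : M d → M d → M d →L[ℝ] M d} {At : M d → M d →L[ℝ] M d} {G : P2 d → M d → M d}
    {ρ e : ℝ → ℝ} {C : ℝ} (hC : ∀ x a, ‖Amm x a‖ ≤ C)
    (hG : ∀ ν, WDifferentiableAt (kPoly Φ) ν → wGrad (kPoly Φ) ν =ᵐ[ν.1] G ν)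
    (he : Tendsto e (𝓝[>] 0) (𝓝 0))
    (H : ∀ ν, WDifferentiableAt (kPoly Φ) ν → ∀ γ ∈ optCouplings m ν, ∀ x y : M d,
      ‖G ν y - G m x - (At x (y - x) + ∫ p, Amm x p.1 (p.2 - p.1) ∂γ)‖
        ≤ ‖x - y‖ * ρ ‖x - y‖ + W2 m ν * e (W2 m ν)) (y : M d) :
    G m y = gradField Φ m y := by
  have hB := h.nonneg
  have hC0 : 0 ≤ C := (norm_nonneg _).trans (hC 0 0)
  obtain ⟨δ, hδ, hδ'⟩ := exists_mul_le_of_tendsto he one_pos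
  have key : ∀ η > 0, ‖G m y - gradField Φ m y‖ ≤ 0 + η := by
    intro η hη
    -- At `x = y` three errors remain, each linear in $W_2$: the remainder (constant 1), the
    -- nonlocal term (constant `C`) and the variation of $A_\nu(y)$ in $\nu$ (constant `B * n`).
    obtain ⟨ν, hν, hat⟩ := exists_W2_lt_and_atom m y
      (δ := min δ (η / (C + 1 + B * n))) (lt_min hδ (by positivity))
    have h1 : G ν y = gradField Φ ν y :=
      eq_of_ae_eq_of_atom ((hG ν (h.wDifferentiableAt ν)).symm.trans (h.wGrad_ae_eq ν)) hat
    obtain ⟨γ, hγ⟩ := optCouplings_nonempty m ν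
    have h2 := H ν (h.wDifferentiableAt ν) γ hγ y y
    have h3 := hδ' (W2 m ν) (W2_nonneg _ _) (hν.trans_le (min_le_left _ _))
    have h4 := h.norm_gradField_sub_le (m := m) (ν := ν) y y
    have h5 := norm_integral_coeff_apply_le (hC y) hγ
    have h6 := (lt_div_iff₀ (by positivity)).1 (hν.trans_le (min_le_right _ _))
    simp only [sub_self, map_zero, zero_add, norm_zero, zero_mul] at h2 h4
    have e1 : G m y - gradField Φ m y = -(G ν y - G m y - ∫ p, Amm y p.1 (p.2 - p.1) ∂γ)
        - (∫ p, Amm y p.1 (p.2 - p.1) ∂γ) + (gradField Φ ν y - gradField Φ m y) := by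
      rw [h1]; abel
    rw [e1]
    refine (norm_add_le _ _).trans ?_
    have h7 := norm_sub_le (-(G ν y - G m y - ∫ p, Amm y p.1 (p.2 - p.1) ∂γ))
      (∫ p, Amm y p.1 (p.2 - p.1) ∂γ)
    rw [norm_neg] at h7
    linarith
  exact sub_eq_zero.1 (norm_le_zero_iff.1 (le_of_forall_pos_le_add key))

/-- The coefficient `Ã[m]` of `F_Φ` is unique. -/
theorem eq_diagField_of_expansion (h : HessModulus Φ r B) {m : P2 d}
    {Amm : M d → M d → M d →L[ℝ] M d} {At : M d → M d →L[ℝ] M d}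
    (H : HasSecondOrderExpansion (kPoly Φ) m At Amm) (x : M d) : At x = diagField Φ m x := by
  obtain ⟨-, -, hAm, ⟨C, hC⟩, G, ρ, e, hG, -, hρ, -, he, H⟩ := H
  have hGA := h.eq_gradField_of_expansion hC hG he H
  -- Along the diagonal coupling the given expansion says that `At x` is a derivative of $A_m$ at
  -- `x`.
  refine HasFDerivAt.unique (hasFDerivAt_of_modulus hρ fun y => ?_) (h.hasFDerivAt_gradField m x)
  have := H m (h.wDifferentiableAt m) _ (diagCoupling_mem m) x y
  rw [W2_self, zero_mul, add_zero, hGA, hGA] at this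
  have hz : ∫ p, Amm x p.1 (p.2 - p.1) ∂(diagCoupling m) = 0 := by
    have := norm_integral_coeff_apply_le (hC x) (diagCoupling_mem m)
    rw [W2_self, mul_zero] at this
    exact norm_le_zero_iff.1 this
  rwa [hz, add_zero] at this

/-- Two coefficients `A_{mm}` of `F_Φ` have the same action on gradients. -/
theorem integral_sub_hessField_eq_zero (h : HessModulus Φ r B) {m : P2 d}
    {Amm : M d → M d → M d →L[ℝ] M d} {At : M d → M d →L[ℝ] M d}
    (H : HasSecondOrderExpansion (kPoly Φ) m At Amm) {x : M d} (hx : x ∈ m.1.support)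
    {φ : M d → ℝ} (hφ : IsTest φ) :
    ∫ a, (Amm x a - hessField Φ m x a) (gradient φ a) ∂m.1 = 0 := by
  have hAt := h.eq_diagField_of_expansion H x
  obtain ⟨-, -, hAm, ⟨C, hC⟩, G, ρ, e, hG, ⟨r₀, hr₀, D, hD⟩, hρ, -, he, H⟩ := H
  have hGA := h.eq_gradField_of_expansion hC hG he H
  have hAx : Measurable (Amm x) := hAm.comp (measurable_const.prodMk measurable_id)
  have hHx : Continuous (hessField Φ m x) :=
    (h.continuous_hessField m).comp (continuous_const.prodMk continuous_id)
  obtain ⟨t₀, ht₀, hgraph⟩ := eq_perturb_of_mem_optCouplings hφ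
  set K := √(∫ x, ‖gradient φ x‖ ^ 2 ∂m.1) with hK
  have hK0 : 0 ≤ K := Real.sqrt_nonneg _
  set I := ∫ a, (Amm x a - hessField Φ m x a) (gradient φ a) ∂m.1 with hI
  set u := ‖gradient φ x‖ with hu
  have hu0 : 0 ≤ u := norm_nonneg _
  clear_value K I u
  have key : ∀ η > 0, ‖I‖ ≤ 2 * η * (u + K) := by
    intro η hη
    obtain ⟨δ₁, hδ₁, H₁⟩ := exists_mul_le_of_tendsto he hη
    obtain ⟨δ₂, hδ₂, H₂⟩ := exists_mul_le_of_tendsto (e := fun t => 4 * (n * √(B * r (n * t))))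
      (by
        have h1 := h.modulus.tendsto_zero (c := (n : ℝ)) (by positivity)
        have h2 := (((h1.const_mul B).sqrt).const_mul (n : ℝ)).const_mul 4
        simpa using h2) hη
    obtain ⟨δ₃, hδ₃, H₃⟩ := exists_mul_le_of_tendsto (e := ρ)
      (by simpa using hρ.tendsto_zero (c := 1) zero_le_one) hη
    obtain ⟨δ₄, hδ₄, H₄⟩ := exists_mul_le_of_tendsto (e := fun t => 4 * r t)
      (by simpa using (h.modulus.tendsto_zero (c := 1) zero_le_one).const_mul 4) hη
    obtain ⟨δ, hδ, hδlt⟩ : ∃ δ, 0 < δ ∧ δ < min (min (min δ₁ δ₂) (min δ₃ δ₄)) r₀ :=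
      exists_between (lt_min (lt_min (lt_min hδ₁ hδ₂) (lt_min hδ₃ hδ₄)) hr₀)
    have hKu : 0 < K + u + 1 := by linarith
    obtain ⟨t, ht, htlt⟩ : ∃ t, 0 < t ∧ t < min t₀ (δ / (K + u + 1)) :=
      exists_between (lt_min ht₀ (div_pos hδ hKu))
    have hsmall := (lt_div_iff₀ hKu).1 (htlt.trans_le (min_le_right _ _))
    have htK : 0 ≤ t * K := mul_nonneg ht.le hK0
    have htu : 0 ≤ t * u := mul_nonneg ht.le hu0
    have hlt : ∀ w, w ≤ t * K ∨ w ≤ t * u → w < min (min (min δ₁ δ₂) (min δ₃ δ₄)) r₀ := by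
      have e : t * (K + u + 1) = t * K + t * u + t := by ring
      rintro w (hw | hw) <;> refine lt_trans ?_ hδlt <;> linarith
    have hW := W2_pushGradient_le m hφ ht.le
    rw [← hK] at hW
    set ν := m.pushGradient hφ t with hν
    have hW' := hlt _ (Or.inl hW)
    simp only [lt_min_iff] at hW'
    obtain ⟨γ, hγ⟩ := optCouplings_nonempty m ν
    have hg := hgraph t ht (htlt.trans_le (min_le_left _ _)) m γ hγ
    -- Transporting `x` by the same map keeps $|x-y|$ of order $t$ and places $y$ where $\nu$
    -- charges every neighbourhood.
    set y := perturb φ t x with hy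
    have hyx : ‖x - y‖ = t * u := by
      rw [hy, perturb, sub_add_cancel_left, norm_neg, norm_smul, Real.norm_eq_abs, abs_of_pos ht, hu]
    have hs := hlt _ (Or.inr hyx.le)
    simp only [lt_min_iff] at hs
    -- Two continuous fields that differ at `y` differ on an open set. Its preimage is a
    -- neighbourhood of `x`, of positive mass because `x` lies in the support of `m`, which
    -- contradicts equality $\nu$-almost everywhere.
    have hGy : G ν y = gradField Φ ν y := by
      have hGc := (hD ν hW'.2).2.1
      by_contra hne
      have hopen : IsOpen {z | G ν z ≠ gradField Φ ν z} :=
        isOpen_ne_fun hGc (h.continuous_gradField ν)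
      have hnull : ν.1 {z | G ν z ≠ gradField Φ ν z} = 0 :=
        ae_iff.1 ((hG ν (h.wDifferentiableAt ν)).symm.trans (h.wGrad_ae_eq ν))
      have hTc := continuous_perturb hφ t
      have hpos := (Measure.mem_support_iff_forall x).1 hx _
        ((hopen.preimage hTc).mem_nhds (show x ∈ perturb φ t ⁻¹' {z | G ν z ≠ gradField Φ ν z} from hne))
      have : ν.1 {z | G ν z ≠ gradField Φ ν z}
          = m.1 (perturb φ t ⁻¹' {z | G ν z ≠ gradField Φ ν z}) :=
        Measure.map_apply hTc.measurable hopen.measurableSet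
      rw [← this, hnull] at hpos
      exact lt_irrefl _ hpos
    have E1 := H ν (h.wDifferentiableAt ν) γ hγ x y
    have E2 := h.norm_gradField_expansion_le hγ x y
    rw [hGA, hGy, hAt, hyx] at E1
    rw [hyx] at E2
    -- The two expansions share the gradients and the local coefficient, so they differ only in the
    -- nonlocal term. On the graph coupling that difference is `t • I`, whereas the remainders are
    -- $o(t)$.
    have hdiff : ∫ p, Amm x p.1 (p.2 - p.1) ∂γ - ∫ p, hessField Φ m x p.1 (p.2 - p.1) ∂γ
        = t • I := by
      rw [← integral_sub (integrable_coeff_apply hAx (hC x) hγ.1)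
        (integrable_coeff_apply hHx.measurable (h.norm_hessField_le m x) hγ.1)]
      have e1 : ∀ p : M d × M d, Amm x p.1 (p.2 - p.1) - hessField Φ m x p.1 (p.2 - p.1)
          = (fun a b => (Amm x a - hessField Φ m x a) (b - a)) p.1 p.2 := fun p => rfl
      simp_rw [e1]
      have hc : Continuous fun q : (M d →L[ℝ] M d) × M d => q.1 q.2 :=
        continuous_fst.clm_apply continuous_snd
      rw [integral_of_ae_eq_graph hγ.1 hg (fun a b => (Amm x a - hessField Φ m x a) (b - a)),
        hI, ← integral_smul]
      · refine integral_congr_ae (ae_of_all _ fun a => ?_)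
        simp [perturb]
      · exact (hc.measurable.comp ((hAx.sub hHx.measurable).prodMk
          ((continuous_perturb hφ t).measurable.sub measurable_id))).aestronglyMeasurable
    have E3 : ‖t • I‖ ≤ (t * u * ρ (t * u) + W2 m ν * e (W2 m ν))
        + (t * u * (4 * r (t * u)) + W2 m ν * (4 * (n * √(B * r (n * W2 m ν))))) := by
      rw [← hdiff]
      refine le_trans (le_of_eq ?_) ((norm_sub_le _ _).trans (add_le_add E2 E1 |>.trans_eq
        (add_comm _ _)))
      congr 1
      abel
    rw [norm_smul, Real.norm_eq_abs, abs_of_pos ht] at E3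
    have F1 := H₁ _ (W2_nonneg m ν) hW'.1.1.1
    have F2 := H₂ _ (W2_nonneg m ν) hW'.1.1.2
    have F3 := H₃ _ htu (hyx ▸ hs.1.2.1)
    have F4 := H₄ _ htu (hyx ▸ hs.1.2.2)
    have F5 : W2 m ν * η ≤ t * K * η := by gcongr
    have : t * ‖I‖ ≤ t * (2 * η * (u + K)) := by
      nlinarith
    exact le_of_mul_le_mul_left this ht
  refine norm_le_zero_iff.1 (le_of_forall_pos_le_add fun η hη => ?_)
  refine (key (η / (2 * (u + K + 1))) (by positivity)).trans ?_
  rw [zero_add, mul_div_assoc', div_mul_eq_mul_div, div_le_iff₀ (by positivity)]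
  nlinarith

/-- The second order Wasserstein gradient of `F_Φ`. -/
theorem projTangent_matRow_ae_eq (h : HessModulus Φ r B) {m : P2 d}
    {Amm : M d → M d → M d →L[ℝ] M d} {At : M d → M d →L[ℝ] M d}
    (H : HasSecondOrderExpansion (kPoly Φ) m At Amm) {x : M d} (hx : x ∈ m.1.support)
    (i : Fin d) :
    projTangent m (fun a => matRow (Amm x a) i) =ᵐ[m.1] fun a => matRow (hessField Φ m x a) i := by
  have hzero := fun φ (hφ : IsTest φ) => h.integral_sub_hessField_eq_zero H hx hφ
  obtain ⟨-, -, hAm, ⟨C, hC⟩, -⟩ := H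
  have hAx : Measurable (Amm x) := hAm.comp (measurable_const.prodMk measurable_id)
  have hHx : Continuous (hessField Φ m x) :=
    (h.continuous_hessField m).comp (continuous_const.prodMk continuous_id)
  simp_rw [matRow_eq_adjoint]
  set v : M d := EuclideanSpace.single i 1
  have m1 : MemLp (fun a => ContinuousLinearMap.adjoint (Amm x a) v) 2 m.1 :=
    MemLp.of_bound ((continuous_adjoint_apply v).measurable.comp hAx).aestronglyMeasurable
      (C * ‖v‖) (ae_of_all _ fun a => (norm_adjoint_apply_le _ _).trans (by gcongr; exact hC x a))
  have m2 : MemLp (fun a => ContinuousLinearMap.adjoint (hessField Φ m x a) v) 2 m.1 :=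
    MemLp.of_bound ((continuous_adjoint_apply v).comp hHx).aestronglyMeasurable
      (n * B * ‖v‖) (ae_of_all _ fun a => (norm_adjoint_apply_le _ _).trans
        (by gcongr; exact h.norm_hessField_le m x a))
  -- The row of `hessField` is tangent and the difference of the rows is orthogonal to every
  -- gradient, which characterises the projection.
  have hp : (tangent m).starProjection m1.toLp = m2.toLp := by
    refine Submodule.eq_starProjection_of_mem_orthogonal
      (h.adjoint_hessField_mem_tangent x v m2.coeFn_toLp) (mem_orthogonal_tangent fun φ hφ => ?_)
    have hi : Integrable (fun a => (Amm x a - hessField Φ m x a) (gradient φ a)) m.1 := by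
      obtain ⟨b, -, hb⟩ := hφ.gradient.exists_bound
      have hc : Continuous fun q : (M d →L[ℝ] M d) × M d => q.1 q.2 :=
        continuous_fst.clm_apply continuous_snd
      refine Integrable.of_bound (hc.measurable.comp ((hAx.sub hHx.measurable).prodMk
        hφ.gradient.1.continuous.measurable)).aestronglyMeasurable ((C + n * B) * b)
        (ae_of_all _ fun a => ?_)
      refine (ContinuousLinearMap.le_opNorm _ _).trans ?_
      have h1 := (norm_sub_le (Amm x a) (hessField Φ m x a)).trans
        (add_le_add (hC x a) (h.norm_hessField_le m x a))
      have h2 := (norm_nonneg _).trans h1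
      exact mul_le_mul h1 (hb a) (norm_nonneg _) h2
    have e1 : ∫ a, ⟪gradient φ a, (m1.toLp - m2.toLp : L2 m) a⟫ ∂m.1
        = ∫ a, ⟪v, (Amm x a - hessField Φ m x a) (gradient φ a)⟫ ∂m.1 := by
      refine integral_congr_ae ?_
      filter_upwards [Lp.coeFn_sub m1.toLp m2.toLp, m1.coeFn_toLp, m2.coeFn_toLp] with a h1 h2 h3
      rw [h1, Pi.sub_apply, h2, h3, inner_sub_right, ContinuousLinearMap.adjoint_inner_right,
        ContinuousLinearMap.adjoint_inner_right, ← inner_sub_left, real_inner_comm]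
      rfl
    rw [e1, integral_inner hi, hzero φ hφ, inner_zero_right]
  rw [projTangent, dif_pos m1, hp]
  exact m2.coeFn_toLp

end HessModulus

end Rows

end

noncomputable section

/-! ### The Hessian of `F_Φ` -/

section Hessian

variable {d n : ℕ}

lemma IsTest.exists_taylor {ζ : M d → M d} (hζ : IsTest ζ) :
    ∃ L, 0 ≤ L ∧ (∀ x, ‖ζ x‖ ≤ L) ∧ (∀ x, ‖_root_.fderiv ℝ ζ x‖ ≤ L) ∧
      (∀ x y, ‖ζ y - ζ x‖ ≤ L * ‖y - x‖) ∧
      ∀ x y, ‖ζ y - ζ x - _root_.fderiv ℝ ζ x (y - x)‖ ≤ L * ‖y - x‖ ^ 2 := by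
  obtain ⟨a, ha, ha'⟩ := hζ.exists_bound
  obtain ⟨b, hb, hb'⟩ := hζ.fderiv.exists_bound
  obtain ⟨c, hc, hc'⟩ := hζ.fderiv.fderiv.exists_bound
  have hd : Differentiable ℝ ζ := hζ.1.differentiable (by simp)
  have hd' : Differentiable ℝ (_root_.fderiv ℝ ζ) := hζ.fderiv.1.differentiable (by simp)
  refine ⟨a + b + c, by positivity, fun x => (ha' x).trans (by linarith),
    fun x => (hb' x).trans (by linarith), fun x y => ?_, fun x y => ?_⟩
  · refine (convex_univ.norm_image_sub_le_of_norm_fderiv_le (𝕜 := ℝ) (fun z _ => hd z)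
      (fun z _ => hb' z) (mem_univ x) (mem_univ y)).trans ?_
    gcongr
    linarith
  · have h1 : ∀ z ∈ segment ℝ x y, ‖_root_.fderiv ℝ ζ z - _root_.fderiv ℝ ζ x‖ ≤ c * ‖y - x‖ := by
      intro z hz
      refine (convex_univ.norm_image_sub_le_of_norm_fderiv_le (𝕜 := ℝ) (fun z _ => hd' z)
        (fun z _ => hc' z) (mem_univ x) (mem_univ z)).trans ?_
      gcongr
      exact norm_sub_le_of_mem_segment hz
    refine ((convex_segment x y).norm_image_sub_le_of_norm_fderiv_le' (𝕜 := ℝ) (fun z _ => hd z)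
      h1 (left_mem_segment ℝ x y) (right_mem_segment ℝ x y)).trans ?_
    rw [mul_assoc, ← sq]
    gcongr
    linarith

lemma integral_sub_sub_sub {Ω : Type*} [MeasurableSpace Ω] {μ : Measure Ω} {f₁ f₂ f₃ f₄ : Ω → ℝ}
    (h₁ : Integrable f₁ μ) (h₂ : Integrable f₂ μ) (h₃ : Integrable f₃ μ) (h₄ : Integrable f₄ μ) :
    ∫ x, (f₁ x - f₂ x - f₃ x - f₄ x) ∂μ
      = ∫ x, f₁ x ∂μ - ∫ x, f₂ x ∂μ - ∫ x, f₃ x ∂μ - ∫ x, f₄ x ∂μ := by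
  rw [integral_sub (f := fun x => f₁ x - f₂ x - f₃ x) ((h₁.sub h₂).sub h₃) h₄,
    integral_sub (f := fun x => f₁ x - f₂ x) (h₁.sub h₂) h₃, integral_sub h₁ h₂]

lemma abs_integral_le_of_le_add {Ω : Type*} [MeasurableSpace Ω] {μ : Measure Ω}
    [IsProbabilityMeasure μ] {f f₁ f₂ f₃ : Ω → ℝ} {a b c e : ℝ}
    (h₁ : Integrable f₁ μ) (h₂ : Integrable f₂ μ) (h₃ : Integrable f₃ μ)
    (h : ∀ x, |f x| ≤ a * f₁ x + b * f₂ x + c * f₃ x + e) :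
    |∫ x, f x ∂μ| ≤ a * ∫ x, f₁ x ∂μ + b * ∫ x, f₂ x ∂μ + c * ∫ x, f₃ x ∂μ + e := by
  have hi : Integrable (fun x => a * f₁ x + b * f₂ x) μ := (h₁.const_mul a).add (h₂.const_mul b)
  have hi' : Integrable (fun x => a * f₁ x + b * f₂ x + c * f₃ x) μ := hi.add (h₃.const_mul c)
  have hi2 : Integrable (fun x => a * f₁ x + b * f₂ x + c * f₃ x + e) μ :=
    hi'.add (integrable_const e)
  refine (norm_integral_le_of_norm_le (f := f) hi2 (ae_of_all _ h)).trans_eq ?_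
  rw [integral_add hi' (integrable_const e), integral_add hi (h₃.const_mul c),
    integral_add (h₁.const_mul a) (h₂.const_mul b), integral_const_mul, integral_const_mul,
    integral_const_mul, integral_const, probReal_univ, one_smul]

namespace HessModulus

variable {Φ : (Fin (n + 1) → M d) → ℝ} {r : ℝ → ℝ} {B : ℝ}

lemma contDiff_gradField (h : HessModulus Φ r B) (m : P2 d) : ContDiff ℝ 1 (gradField Φ m) := by
  refine contDiff_one_iff_fderiv.2
    ⟨fun x => (h.hasFDerivAt_gradField m x).differentiableAt, ?_⟩
  have : fderiv ℝ (gradField Φ m) = diagField Φ m :=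
    funext fun x => (h.hasFDerivAt_gradField m x).fderiv
  rw [this]
  exact h.continuous_diagField m

/-- `∇ ⟨A_m, ζ⟩`, tested against a vector. -/
lemma inner_gradient_inner_gradField (h : HessModulus Φ r B) (m : P2 d) {ζ : M d → M d}
    (hζ : IsTest ζ) (x v : M d) :
    ⟪gradient (fun x => ⟪gradField Φ m x, ζ x⟫) x, v⟫
      = ⟪gradField Φ m x, fderiv ℝ ζ x v⟫ + ⟪diagField Φ m x v, ζ x⟫ := by
  have h1 := (h.hasFDerivAt_gradField m x).inner ℝ (hζ.1.differentiable (by simp) x).hasFDerivAt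
  rw [inner_gradient_apply, h1.fderiv]
  simp

lemma contDiff_inner_gradField (h : HessModulus Φ r B) (m : P2 d) {ζ : M d → M d}
    (hζ : IsTest ζ) : ContDiff ℝ 1 fun x => ⟪gradField Φ m x, ζ x⟫ :=
  (h.contDiff_gradField m).inner ℝ (hζ.1.of_le (by simp))

lemma exists_norm_gradient_inner_gradField_le (h : HessModulus Φ r B) (m : P2 d) {ζ : M d → M d}
    (hζ : IsTest ζ) : ∃ C, 0 ≤ C ∧ ∀ x, ‖gradient (fun x => ⟪gradField Φ m x, ζ x⟫) x‖ ≤ C := by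
  have hc : HasCompactSupport fun x => ⟪gradField Φ m x, ζ x⟫ :=
    hζ.2.mono fun x hx hx' => hx (by simp [show ζ x = 0 from hx'])
  obtain ⟨C, hC⟩ := (hc.fderiv (𝕜 := ℝ)).exists_bound_of_continuous
    ((h.contDiff_inner_gradField m hζ).continuous_fderiv (by norm_num))
  exact ⟨C, (norm_nonneg _).trans (hC 0), fun x => by rw [norm_gradient]; exact hC x⟩

/-- $A_m$ may be unbounded, so a Taylor bound for `ζ` alone does not suffice. If both points avoid
the support of `ζ` the remainder vanishes. Otherwise $|A_m(x)|$ is at most a constant plus $B|y-x|$,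
and the second summand is paired with a linear bound on the remainder. -/
lemma exists_abs_inner_taylor_le (h : HessModulus Φ r B) (m : P2 d) {ζ : M d → M d}
    (hζ : IsTest ζ) : ∃ C, 0 ≤ C ∧ ∀ x y,
      |⟪gradField Φ m x, ζ y - ζ x - fderiv ℝ ζ x (y - x)⟫| ≤ C * ‖y - x‖ ^ 2 := by
  obtain ⟨L, hL, -, hL1, hL2, hL3⟩ := hζ.exists_taylor
  have hB := h.nonneg
  obtain ⟨a, ha⟩ := hζ.2.exists_bound_of_continuousOn (h.continuous_gradField m).continuousOn
  refine ⟨|a| * L + B * (2 * L), by positivity, fun x y => ?_⟩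
  set R := ζ y - ζ x - fderiv ℝ ζ x (y - x) with hR
  have hR1 : ‖R‖ ≤ 2 * L * ‖y - x‖ := by
    refine (norm_sub_le _ _).trans ?_
    have := (fderiv ℝ ζ x).le_of_opNorm_le (hL1 x) (y - x)
    linarith [hL2 x y]
  by_cases hxy : x ∈ tsupport ζ ∨ y ∈ tsupport ζ
  · have hA : ‖gradField Φ m x‖ ≤ |a| + B * ‖y - x‖ := by
      rcases hxy with hx | hy
      · have := (ha x hx).trans (le_abs_self a)
        have := mul_nonneg hB (norm_nonneg (y - x))
        linarith
      · have h1 := (ha y hy).trans (le_abs_self a)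
        have h2 := h.norm_gradField_sub_le_self m y x
        rw [norm_sub_rev x y] at h2
        have h3 := norm_sub_norm_le (gradField Φ m x) (gradField Φ m y)
        linarith
    calc |⟪gradField Φ m x, R⟫| ≤ ‖gradField Φ m x‖ * ‖R‖ := abs_real_inner_le_norm _ _
      _ ≤ (|a| + B * ‖y - x‖) * ‖R‖ := by gcongr
      _ = |a| * ‖R‖ + B * ‖y - x‖ * ‖R‖ := by ring
      _ ≤ |a| * (L * ‖y - x‖ ^ 2) + B * ‖y - x‖ * (2 * L * ‖y - x‖) := by
        gcongr
        exact hL3 x y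
      _ = (|a| * L + B * (2 * L)) * ‖y - x‖ ^ 2 := by ring
  · push Not at hxy
    have : R = 0 := by
      rw [hR, image_eq_zero_of_notMem_tsupport hxy.1, image_eq_zero_of_notMem_tsupport hxy.2,
        fderiv_of_notMem_tsupport ℝ hxy.1]
      simp
    rw [this, inner_zero_right, abs_zero]
    positivity

/-- The nonlocal part `a ↦ ∫ A_{mm}(z, a)ᵀ ζ(z) m(dz)` of the gradient of `ν ↦ ζ · (F_Φ[ν])`. -/
def nonlocalField (Φ : (Fin (n + 1) → M d) → ℝ) (m : P2 d) (ζ : M d → M d) (a : M d) : M d :=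
  ∫ z, ContinuousLinearMap.adjoint (hessField Φ m z a) (ζ z) ∂m.1

lemma continuous_adjoint_hessField (h : HessModulus Φ r B) (m : P2 d) {ζ : M d → M d}
    (hζ : Continuous ζ) : Continuous fun p : M d × M d =>
      ContinuousLinearMap.adjoint (hessField Φ m p.1 p.2) (ζ p.1) :=
  ((ContinuousLinearMap.adjoint (𝕜 := ℝ) (E := M d) (F := M d)).continuous.comp
    (h.continuous_hessField m)).clm_apply (hζ.comp continuous_fst)

lemma norm_adjoint_hessField_le (h : HessModulus Φ r B) (m : P2 d) {ζ : M d → M d} {L : ℝ}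
    (hL : ∀ x, ‖ζ x‖ ≤ L) (z a : M d) :
    ‖ContinuousLinearMap.adjoint (hessField Φ m z a) (ζ z)‖ ≤ n * B * L := by
  have hB := h.nonneg
  refine (norm_adjoint_apply_le _ _).trans ?_
  gcongr
  · exact h.norm_hessField_le m z a
  · exact hL z

lemma memLp_nonlocalField (h : HessModulus Φ r B) (m : P2 d) {ζ : M d → M d} (hζ : IsTest ζ) :
    MemLp (nonlocalField Φ m ζ) 2 m.1 := by
  obtain ⟨L, -, hL⟩ := hζ.exists_bound
  refine MemLp.of_bound ?_ (n * B * L) (ae_of_all _ fun a => ?_)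
  · have h1 := ((h.continuous_adjoint_hessField m hζ.1.continuous).comp
      continuous_swap).stronglyMeasurable
    exact (h1.integral_prod_right' (ν := m.1)).aestronglyMeasurable
  · have := norm_integral_le_of_norm_le_const (μ := m.1)
      (ae_of_all _ fun z => h.norm_adjoint_hessField_le m hL z a)
    simpa [nonlocalField] using this

lemma nonlocalField_mem_tangent (h : HessModulus Φ r B) {m : P2 d} {ζ : M d → M d}
    (hζ : IsTest ζ) {z : L2 m} (hz : z =ᵐ[m.1] nonlocalField Φ m ζ) : z ∈ tangent m := by
  obtain ⟨L, -, hL⟩ := hζ.exists_bound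
  have hc := h.continuous_adjoint_hessField m hζ.1.continuous
  refine mem_tangent_of_integral (μ := m.1)
    (F := fun z a => ContinuousLinearMap.adjoint (hessField Φ m z a) (ζ z))
    (b := fun _ => n * B * L) (c := fun _ => 1) hc.measurable (integrable_const _) (memLp_const _)
    (fun z a => by rw [mul_one]; exact h.norm_adjoint_hessField_le m hL z a) (fun z => ?_) hz
  have hm : MemLp (fun a => ContinuousLinearMap.adjoint (hessField Φ m z a) (ζ z)) 2 m.1 :=
    MemLp.of_bound (hc.comp (continuous_const.prodMk continuous_id)).aestronglyMeasurable
      (n * B * L) (ae_of_all _ fun a => h.norm_adjoint_hessField_le m hL z a)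
  exact ⟨hm.toLp, h.adjoint_hessField_mem_tangent z (ζ z) hm.coeFn_toLp, hm.coeFn_toLp⟩

lemma memLp_gradient_inner_gradField (h : HessModulus Φ r B) (m : P2 d) {ζ : M d → M d}
    (hζ : IsTest ζ) : MemLp (gradient fun x => ⟪gradField Φ m x, ζ x⟫) 2 m.1 := by
  obtain ⟨C, -, hC⟩ := h.exists_norm_gradient_inner_gradField_le m hζ
  exact MemLp.of_bound (continuous_gradient
    (h.contDiff_inner_gradField m hζ)).aestronglyMeasurable C (ae_of_all _ hC)

lemma integrable_hessField_apply_inner (h : HessModulus Φ r B) (m : P2 d) {ζ : M d → M d}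
    (hζ : Continuous ζ) {L : ℝ} (hL : ∀ x, ‖ζ x‖ ≤ L) {Ω : Type*} [MeasurableSpace Ω]
    {μ : Measure Ω} [IsProbabilityMeasure μ] {X w : Ω → M d} (hX : Measurable X)
    (hw : Integrable w μ) :
    Integrable (fun p : M d × Ω => ⟪hessField Φ m p.1 (X p.2) (w p.2), ζ p.1⟫) (m.1.prod μ) := by
  have hB := h.nonneg
  have hL0 := (norm_nonneg _).trans (hL 0)
  have hwp : Integrable (fun p : M d × Ω => w p.2) (m.1.prod μ) :=
    hw.comp_snd m.1
  refine (hwp.norm.const_mul (n * B * L)).mono' ?_ (ae_of_all _ fun p => ?_)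
  · have hc : Continuous fun q : (M d →L[ℝ] M d) × M d => q.1 q.2 :=
      continuous_fst.clm_apply continuous_snd
    have h1 : Measurable fun p : M d × Ω => hessField Φ m p.1 (X p.2) :=
      (h.continuous_hessField m).measurable.comp
        (measurable_fst.prodMk (hX.comp measurable_snd))
    exact (hc.comp_aestronglyMeasurable (h1.aestronglyMeasurable.prodMk
      hwp.aestronglyMeasurable)).inner (hζ.measurable.comp measurable_fst).aestronglyMeasurable
  · calc ‖⟪hessField Φ m p.1 (X p.2) (w p.2), ζ p.1⟫‖
        ≤ ‖hessField Φ m p.1 (X p.2) (w p.2)‖ * ‖ζ p.1‖ := norm_inner_le_norm _ _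
      _ ≤ (n * B * ‖w p.2‖) * L := by
        gcongr
        · exact (hessField Φ m p.1 (X p.2)).le_of_opNorm_le (h.norm_hessField_le m _ _) _
        · exact hL _
      _ = n * B * L * ‖w p.2‖ := by ring

/-- Fubini's theorem for the nonlocal part. -/
lemma integral_inner_nonlocalField (h : HessModulus Φ r B) (m : P2 d) {ζ : M d → M d}
    (hζ : IsTest ζ) {Ω : Type*} [MeasurableSpace Ω]
    {μ : Measure Ω} [IsProbabilityMeasure μ] {X w : Ω → M d} (hX : Measurable X)
    (hw : Integrable w μ) (hwm : Measurable w) :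
    Integrable (fun x => ⟪∫ p, hessField Φ m x (X p) (w p) ∂μ, ζ x⟫) m.1 ∧
    ∫ x, ⟪∫ p, hessField Φ m x (X p) (w p) ∂μ, ζ x⟫ ∂m.1
      = ∫ p, ⟪nonlocalField Φ m ζ (X p), w p⟫ ∂μ := by
  obtain ⟨L, -, hL⟩ := hζ.exists_bound
  have hi := h.integrable_hessField_apply_inner m hζ.1.continuous hL hX hw
  have hB := h.nonneg
  have hc : Continuous fun q : (M d →L[ℝ] M d) × M d => q.1 q.2 :=
    continuous_fst.clm_apply continuous_snd
  have h1 : ∀ x, ⟪∫ p, hessField Φ m x (X p) (w p) ∂μ, ζ x⟫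
      = ∫ p, ⟪hessField Φ m x (X p) (w p), ζ x⟫ ∂μ := by
    intro x
    have hi' : Integrable (fun p => hessField Φ m x (X p) (w p)) μ := by
      refine (hw.norm.const_mul (n * B)).mono' ?_ (ae_of_all _ fun p =>
        (hessField Φ m x (X p)).le_of_opNorm_le (h.norm_hessField_le m _ _) _)
      exact (hc.measurable.comp (((h.continuous_hessField m).measurable.comp
        (measurable_const.prodMk hX)).prodMk hwm)).aestronglyMeasurable
    rw [real_inner_comm, ← integral_inner hi']
    simp_rw [real_inner_comm]
  simp_rw [h1]
  refine ⟨hi.integral_prod_left, ?_⟩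
  rw [integral_integral_swap hi]
  refine integral_congr_ae (ae_of_all _ fun p => ?_)
  have hi2 : Integrable (fun z => ContinuousLinearMap.adjoint (hessField Φ m z (X p)) (ζ z)) m.1 :=
    Integrable.of_bound ((h.continuous_adjoint_hessField m hζ.1.continuous).comp
      (continuous_id.prodMk continuous_const)).aestronglyMeasurable (n * B * L)
      (ae_of_all _ fun z => h.norm_adjoint_hessField_le m hL z _)
  dsimp only
  rw [nonlocalField, real_inner_comm, ← integral_inner hi2]
  simp_rw [ContinuousLinearMap.adjoint_inner_right]

/-- Same argument as for `integral_sum_mul_modulus_le`, with a single copy of the coupling; it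
controls the displacement of the point at which the gradient is evaluated. -/
lemma integral_norm_mul_modulus_le (h : HessModulus Φ r B) {m ν : P2 d}
    {γ : Measure (M d × M d)} (hγ : γ ∈ optCouplings m ν) :
    Integrable (fun p : M d × M d => ‖p.2 - p.1‖ * r ‖p.2 - p.1‖) γ ∧
    ∫ p, ‖p.2 - p.1‖ * r ‖p.2 - p.1‖ ∂γ ≤ W2 m ν * √(B * r (W2 m ν)) := by
  have := isProbabilityMeasure_of_mem_couplings hγ.1
  have hn : MemLp (fun p : M d × M d => ‖p.2 - p.1‖) 2 γ := (memLp_sub_coupling hγ.1).norm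
  have hr0 : ∀ p : M d × M d, 0 ≤ r ‖p.2 - p.1‖ := fun p => h.modulus.nonneg _ (norm_nonneg _)
  have hri : Integrable (fun p : M d × M d => r ‖p.2 - p.1‖) γ :=
    h.integrable_modulus hn.aestronglyMeasurable fun p => norm_nonneg _
  have hrm : MemLp (fun p : M d × M d => r ‖p.2 - p.1‖) 2 γ :=
    MemLp.of_bound hri.aestronglyMeasurable B (ae_of_all _ fun p => by
      rw [Real.norm_eq_abs, abs_of_nonneg (hr0 p)]; exact h.r_le _)
  refine ⟨hn.integrable_mul hrm, ?_⟩
  refine (integral_mul_le_sqrt_mul_sqrt hn hrm (fun p => norm_nonneg _) hr0).trans ?_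
  rw [W2_sq_eq hγ, Real.sqrt_sq (W2_nonneg _ _)]
  refine mul_le_mul_of_nonneg_left (Real.sqrt_le_sqrt ?_) (W2_nonneg _ _)
  calc ∫ p, r ‖p.2 - p.1‖ ^ 2 ∂γ ≤ ∫ p, B * r ‖p.2 - p.1‖ ∂γ := by
        refine integral_mono hrm.integrable_sq (hri.const_mul B) fun p => ?_
        simp only [sq]
        exact mul_le_mul_of_nonneg_right (h.r_le _) (hr0 p)
    _ = B * ∫ p, r ‖p.2 - p.1‖ ∂γ := integral_const_mul _ _
    _ ≤ B * r (W2 m ν) := mul_le_mul_of_nonneg_left (integral_modulus_le h.modulus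
        (integrable_sub_coupling hγ.1).norm (fun p => norm_nonneg _) hri
        (integral_norm_sub_le_W2 hγ)) h.nonneg

lemma wDeriv_eq (h : HessModulus Φ r B) (ν : P2 d) (ζ : M d → M d) :
    wDeriv (kPoly Φ) ν ζ = ∫ x, ⟪gradField Φ ν x, ζ x⟫ ∂ν.1 := by
  refine integral_congr_ae ?_
  filter_upwards [h.wGrad_ae_eq ν] with x hx
  rw [hx]

/-- Write $A_\nu(y)=A_m(x)+D+J+R$ with $D$ local, $J$ nonlocal and $R$ the second order remainder,
and expand the product with $\zeta(y)$. The linear terms in $D$ and $J$ at $\zeta(x)$, together with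
the derivative of $\zeta$, make up the subtracted terms; the rest is a product of two increments or
a Taylor remainder. -/
lemma exists_abs_wDeriv_pointwise_le (h : HessModulus Φ r B) (m : P2 d) {ζ : M d → M d}
    (hζ : IsTest ζ) : ∃ C L, 0 ≤ C ∧ 0 ≤ L ∧ ∀ ν, ∀ γ ∈ optCouplings m ν, ∀ x y,
      |⟪gradField Φ ν y, ζ y⟫ - ⟪gradField Φ m x, ζ x⟫
        - ⟪gradient (fun x => ⟪gradField Φ m x, ζ x⟫) x, y - x⟫
        - ⟪∫ p, hessField Φ m x p.1 (p.2 - p.1) ∂γ, ζ x⟫|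
      ≤ C * ‖y - x‖ ^ 2 + L * (n * B * W2 m ν) * ‖y - x‖ + L * 4 * (‖y - x‖ * r ‖y - x‖)
        + W2 m ν * (L * (4 * (n * √(B * r (n * W2 m ν))))) := by
  have hB := h.nonneg
  obtain ⟨C, hC0, hC⟩ := h.exists_abs_inner_taylor_le m hζ
  obtain ⟨L, hL, hL0, hL1, hL2, hL3⟩ := hζ.exists_taylor
  refine ⟨C + L * B, L, by positivity, hL, fun ν γ hγ x y => ?_⟩
  set J := ∫ p, hessField Φ m x p.1 (p.2 - p.1) ∂γ
  set D := diagField Φ m x (y - x)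
  set R := gradField Φ ν y - gradField Φ m x - (D + J) with hR
  have hRb := h.norm_gradField_expansion_le hγ x y
  rw [norm_sub_rev x y] at hRb
  have hJ : ‖J‖ ≤ n * B * W2 m ν := norm_integral_coeff_apply_le (h.norm_hessField_le m x) hγ
  have hD : ‖D‖ ≤ B * ‖y - x‖ :=
    (diagField Φ m x).le_of_opNorm_le (h.norm_diagField_le m x) _
  have e : ⟪gradField Φ ν y, ζ y⟫ - ⟪gradField Φ m x, ζ x⟫
        - ⟪gradient (fun x => ⟪gradField Φ m x, ζ x⟫) x, y - x⟫ - ⟪J, ζ x⟫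
      = ⟪gradField Φ m x, ζ y - ζ x - fderiv ℝ ζ x (y - x)⟫ + ⟪D + J, ζ y - ζ x⟫ + ⟪R, ζ y⟫ := by
    rw [h.inner_gradient_inner_gradField m hζ, hR]
    simp only [inner_sub_left, inner_sub_right, inner_add_left]
    ring
  rw [e]
  have h1 : |⟪D + J, ζ y - ζ x⟫| ≤ (B * ‖y - x‖ + n * B * W2 m ν) * (L * ‖y - x‖) :=
    (abs_real_inner_le_norm _ _).trans (mul_le_mul ((norm_add_le _ _).trans (add_le_add hD hJ))
      (hL2 x y) (norm_nonneg _) (by have := W2_nonneg m ν; positivity))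
  have h2 : |⟪R, ζ y⟫| ≤ (‖y - x‖ * (4 * r ‖y - x‖)
      + W2 m ν * (4 * (n * √(B * r (n * W2 m ν))))) * L :=
    (abs_real_inner_le_norm _ _).trans (mul_le_mul hRb (hL0 y) (norm_nonneg _)
      ((norm_nonneg _).trans hRb))
  refine (abs_add_three _ _ _).trans ((add_le_add_three (hC x y) h1 h2).trans_eq ?_)
  ring

/-- The expansion of `ν ↦ ζ · (F_Φ[ν])`. -/
theorem hasWExpansion_wDeriv (h : HessModulus Φ r B) (m : P2 d) {ζ : M d → M d} (hζ : IsTest ζ) :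
    HasWExpansion (fun ν => wDeriv (kPoly Φ) ν ζ) m
      (fun x => gradient (fun x => ⟪gradField Φ m x, ζ x⟫) x + nonlocalField Φ m ζ x) := by
  obtain ⟨C, L, hC, hL, H⟩ := h.exists_abs_wDeriv_pointwise_le m hζ
  have hB := h.nonneg
  intro ε hε
  -- This function collects the integrated errors divided by $t=W_2(m,\nu)$.
  have htend : Tendsto (fun t => C * t + L * (n * B) * t + L * 4 * √(B * r t)
      + L * (4 * (n * √(B * r (n * t))))) (𝓝[>] 0) (𝓝 0) := by
    have h0 : Tendsto (fun t : ℝ => t) (𝓝[>] 0) (𝓝 0) := tendsto_id.mono_left nhdsWithin_le_nhds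
    have h1 := h.modulus.tendsto_zero (c := (n : ℝ)) (by positivity)
    have h2 := h.modulus.tendsto_zero (c := 1) zero_le_one
    simp_rw [one_mul] at h2
    have h3 := (((h0.const_mul C).add (h0.const_mul (L * (n * B)))).add
      (((h2.const_mul B).sqrt).const_mul (L * 4))).add
      ((((h1.const_mul B).sqrt.const_mul (n : ℝ)).const_mul 4).const_mul L)
    simpa using h3
  obtain ⟨δ, hδ, hδ'⟩ := exists_mul_le_of_tendsto htend hε
  refine ⟨δ, hδ, fun ν hν γ hγ => ?_⟩
  have := isProbabilityMeasure_of_mem_couplings hγ.1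
  have hW := W2_nonneg m ν
  have i1 : Integrable (fun p : M d × M d => ⟪gradField Φ ν p.2, ζ p.2⟫) γ :=
    (measurePreserving_snd_coupling hγ.1).integrable_comp_of_integrable
      (integrable_inner_of_memLp (h.memLp_gradField ν) (hζ.memLp ν))
  have i2 : Integrable (fun p : M d × M d => ⟪gradField Φ m p.1, ζ p.1⟫) γ :=
    (measurePreserving_fst_coupling hγ.1).integrable_comp_of_integrable
      (integrable_inner_of_memLp (h.memLp_gradField m) (hζ.memLp m))
  have i3 : Integrable (fun p : M d × M d =>
      ⟪gradient (fun x => ⟪gradField Φ m x, ζ x⟫) p.1, p.2 - p.1⟫) γ :=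
    integrable_inner_of_memLp ((h.memLp_gradient_inner_gradField m hζ).comp_measurePreserving
      (measurePreserving_fst_coupling hγ.1)) (memLp_sub_coupling hγ.1)
  have i3' : Integrable (fun p : M d × M d => ⟪nonlocalField Φ m ζ p.1, p.2 - p.1⟫) γ :=
    integrable_inner_of_memLp ((h.memLp_nonlocalField m hζ).comp_measurePreserving
      (measurePreserving_fst_coupling hγ.1)) (memLp_sub_coupling hγ.1)
  obtain ⟨j1, j2⟩ := h.integral_inner_nonlocalField m hζ (μ := γ) (X := Prod.fst)
    (w := fun p => p.2 - p.1) measurable_fst (integrable_sub_coupling hγ.1)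
    (measurable_snd.sub measurable_fst)
  have i4 : Integrable (fun p : M d × M d =>
      ⟪∫ q, hessField Φ m p.1 q.1 (q.2 - q.1) ∂γ, ζ p.1⟫) γ :=
    (measurePreserving_fst_coupling hγ.1).integrable_comp_of_integrable j1
  obtain ⟨k1, k2⟩ := h.integral_norm_mul_modulus_le hγ
  have k3 := integrable_norm_sub_sq_coupling hγ.1
  have k4 := (integrable_sub_coupling hγ.1).norm
  have e1 : wDeriv (kPoly Φ) ν ζ = ∫ p, ⟪gradField Φ ν p.2, ζ p.2⟫ ∂γ := by
    rw [h.wDeriv_eq, ← (measurePreserving_snd_coupling hγ.1).map_eq, integral_map (by fun_prop)]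
    exact ((h.continuous_gradField ν).inner hζ.1.continuous).aestronglyMeasurable
  have e2 : wDeriv (kPoly Φ) m ζ = ∫ p, ⟪gradField Φ m p.1, ζ p.1⟫ ∂γ := by
    rw [h.wDeriv_eq, ← (measurePreserving_fst_coupling hγ.1).map_eq, integral_map (by fun_prop)]
    exact ((h.continuous_gradField m).inner hζ.1.continuous).aestronglyMeasurable
  have e3 : ∫ p, ⟪∫ q, hessField Φ m p.1 q.1 (q.2 - q.1) ∂γ, ζ p.1⟫ ∂γ
      = ∫ p, ⟪nonlocalField Φ m ζ p.1, p.2 - p.1⟫ ∂γ := by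
    rw [← j2, ← (measurePreserving_fst_coupling hγ.1).map_eq, integral_map (by fun_prop)]
    rw [(measurePreserving_fst_coupling hγ.1).map_eq]
    exact j1.aestronglyMeasurable
  have e4 : wDeriv (kPoly Φ) ν ζ - wDeriv (kPoly Φ) m ζ
      - ∫ p, ⟪gradient (fun x => ⟪gradField Φ m x, ζ x⟫) p.1 + nonlocalField Φ m ζ p.1,
          p.2 - p.1⟫ ∂γ
      = ∫ p, (⟪gradField Φ ν p.2, ζ p.2⟫ - ⟪gradField Φ m p.1, ζ p.1⟫
        - ⟪gradient (fun x => ⟪gradField Φ m x, ζ x⟫) p.1, p.2 - p.1⟫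
        - ⟪∫ q, hessField Φ m p.1 q.1 (q.2 - q.1) ∂γ, ζ p.1⟫) ∂γ := by
    rw [integral_sub_sub_sub i1 i2 i3 i4, e3, e1, e2]
    simp_rw [inner_add_left]
    rw [integral_add i3 i3']
    ring
  rw [e4]
  refine (abs_integral_le_of_le_add k3 k4 k1 fun p => H ν γ hγ p.1 p.2).trans ?_
  rw [W2_sq_eq hγ]
  have h1 := integral_norm_sub_le_W2 hγ
  have h2 : L * (n * B * W2 m ν) * ∫ p, ‖p.2 - p.1‖ ∂γ ≤ L * (n * B * W2 m ν) * W2 m ν := by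
    gcongr
  have h3 := mul_le_mul_of_nonneg_left k2 (by positivity : 0 ≤ L * 4)
  have h4 := hδ' _ hW hν
  nlinarith

end HessModulus

end Hessian

end

noncomputable section

/-! ### The bounded extension of the Hessian form -/

section HessianForm

variable {d n : ℕ}

namespace HessModulus

variable {Φ : (Fin (n + 1) → M d) → ℝ} {r : ℝ → ℝ} {B : ℝ}

lemma memLp_wDerivField (h : HessModulus Φ r B) (m : P2 d) {ζ : M d → M d} (hζ : IsTest ζ) :
    MemLp (fun x => gradient (fun x => ⟪gradField Φ m x, ζ x⟫) x + nonlocalField Φ m ζ x) 2 m.1 :=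
  (h.memLp_gradient_inner_gradField m hζ).add (h.memLp_nonlocalField m hζ)

lemma wDerivField_mem_tangent (h : HessModulus Φ r B) (m : P2 d) {ζ : M d → M d} (hζ : IsTest ζ) :
    (h.memLp_wDerivField m hζ).toLp ∈ tangent m := by
  obtain ⟨C, hC0, hC⟩ := h.exists_norm_gradient_inner_gradField_le m hζ
  have h1 := h.memLp_gradient_inner_gradField m hζ
  have h2 := h.memLp_nonlocalField m hζ
  have e : (h.memLp_wDerivField m hζ).toLp = h1.toLp + h2.toLp := MemLp.toLp_add h1 h2
  rw [e]
  refine add_mem (mem_tangent_of_gradient (h.contDiff_inner_gradField m hζ) (C := C) (fun x => ?_)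
    h1.coeFn_toLp) (h.nonlocalField_mem_tangent hζ h2.coeFn_toLp)
  refine (hC x).trans (le_mul_of_one_le_right hC0 ?_)
  linarith [norm_nonneg x]

lemma hasWExpansion_wDeriv_toLp (h : HessModulus Φ r B) (m : P2 d) {ζ : M d → M d}
    (hζ : IsTest ζ) :
    HasWExpansion (fun ν => wDeriv (kPoly Φ) ν ζ) m (h.memLp_wDerivField m hζ).toLp :=
  (h.hasWExpansion_wDeriv m hζ).congr (h.memLp_wDerivField m hζ).coeFn_toLp.symm

/-- In the gradient of $\langle A_m,\zeta_2\rangle$ the product rule produces $\langle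
A_m,\nabla\zeta_2\,\zeta_1\rangle$, exactly the term subtracted in the definition. No derivative of
a test field is left, so the formula makes sense on $L^2(m)$. -/
theorem barHess_eq (h : HessModulus Φ r B) (m : P2 d) {ζ₁ ζ₂ : M d → M d} (h₁ : IsTest ζ₁)
    (h₂ : IsTest ζ₂) : barHess (kPoly Φ) m ζ₁ ζ₂
      = ∫ x, ⟪diagField Φ m x (ζ₁ x), ζ₂ x⟫ ∂m.1
        + ∫ x, ⟪∫ a, hessField Φ m x a (ζ₁ a) ∂m.1, ζ₂ x⟫ ∂m.1 := by
  have hG := h.memLp_wDerivField m h₂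
  have e1 : wDeriv (fun ν => wDeriv (kPoly Φ) ν ζ₂) m ζ₁
      = ∫ x, ⟪gradient (fun x => ⟪gradField Φ m x, ζ₂ x⟫) x + nonlocalField Φ m ζ₂ x, ζ₁ x⟫
        ∂m.1 := by
    rw [wDeriv, (h.hasWExpansion_wDeriv_toLp m h₂).wGrad_eq (h.wDerivField_mem_tangent m h₂)]
    refine integral_congr_ae ?_
    filter_upwards [hG.coeFn_toLp] with x hx
    rw [hx]
  have hc2 : Continuous fun x => fderiv ℝ ζ₂ x (ζ₁ x) :=
    h₂.fderiv.1.continuous.clm_apply h₁.1.continuous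
  have i1 : Integrable (fun x => ⟪gradField Φ m x, fderiv ℝ ζ₂ x (ζ₁ x)⟫) m.1 := by
    obtain ⟨a, ha, ha'⟩ := h₁.exists_bound
    obtain ⟨b, hb, hb'⟩ := h₂.fderiv.exists_bound
    exact integrable_inner_of_memLp (h.memLp_gradField m) (MemLp.of_bound
      hc2.aestronglyMeasurable (b * a) (ae_of_all _ fun x =>
        (fderiv ℝ ζ₂ x).le_of_opNorm_le_of_le (hb' x) (ha' x)))
  have i2 : Integrable (fun x => ⟪diagField Φ m x (ζ₁ x), ζ₂ x⟫) m.1 := by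
    obtain ⟨a, ha, ha'⟩ := h₁.exists_bound
    exact integrable_inner_of_memLp (MemLp.of_bound
      ((h.continuous_diagField m).clm_apply h₁.1.continuous).aestronglyMeasurable (B * a)
      (ae_of_all _ fun x => (diagField Φ m x).le_of_opNorm_le_of_le (h.norm_diagField_le m x)
        (ha' x))) (h₂.memLp m)
  have i3 : Integrable (fun x => ⟪nonlocalField Φ m ζ₂ x, ζ₁ x⟫) m.1 :=
    integrable_inner_of_memLp (h.memLp_nonlocalField m h₂) (h₁.memLp m)
  have e2 : ∫ x, ⟪∫ a, hessField Φ m x a (ζ₁ a) ∂m.1, ζ₂ x⟫ ∂m.1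
      = ∫ a, ⟪nonlocalField Φ m ζ₂ a, ζ₁ a⟫ ∂m.1 :=
    (h.integral_inner_nonlocalField m h₂ (μ := m.1) (X := fun a => a) (w := ζ₁) measurable_id
      ((h₁.memLp m).integrable (by norm_num)) h₁.1.continuous.measurable).2
  rw [barHess, e1, h.wDeriv_eq, e2]
  simp_rw [inner_add_left, h.inner_gradient_inner_gradField m h₂]
  rw [integral_add (f := fun x => ⟪gradField Φ m x, fderiv ℝ ζ₂ x (ζ₁ x)⟫
    + ⟪diagField Φ m x (ζ₁ x), ζ₂ x⟫) (i1.add i2) i3, integral_add i1 i2]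
  ring

lemma memLp_diagField_apply (h : HessModulus Φ r B) (m : P2 d) (w : L2 m) :
    MemLp (fun x => diagField Φ m x (w x)) 2 m.1 := by
  have hc : Continuous fun q : (M d →L[ℝ] M d) × M d => q.1 q.2 :=
    continuous_fst.clm_apply continuous_snd
  exact (Lp.memLp w).of_le_mul (c := B) (hc.comp_aestronglyMeasurable
    ((h.continuous_diagField m).aestronglyMeasurable.prodMk (Lp.aestronglyMeasurable w)))
    (ae_of_all _ fun x => (diagField Φ m x).le_of_opNorm_le (h.norm_diagField_le m x) _)

/-- Pointwise multiplication by `Ã[m]`, as an operator on `L²(m)`. -/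
def diagOp (h : HessModulus Φ r B) (m : P2 d) : L2 m →L[ℝ] L2 m :=
  LinearMap.mkContinuous
    { toFun := fun w => (h.memLp_diagField_apply m w).toLp
      map_add' := fun v w => by
        rw [← MemLp.toLp_add, MemLp.toLp_eq_toLp_iff]
        filter_upwards [Lp.coeFn_add v w] with x hx
        rw [hx, Pi.add_apply, map_add, Pi.add_apply]
      map_smul' := fun c w => by
        rw [← MemLp.toLp_const_smul, MemLp.toLp_eq_toLp_iff]
        filter_upwards [Lp.coeFn_smul c w] with x hx
        rw [hx, Pi.smul_apply, map_smul, Pi.smul_apply, RingHom.id_apply] } B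
    fun w => by
      refine Lp.norm_le_mul_norm_of_ae_le_mul ?_
      filter_upwards [(h.memLp_diagField_apply m w).coeFn_toLp] with x hx
      exact (congrArg norm hx).trans_le
        ((diagField Φ m x).le_of_opNorm_le (h.norm_diagField_le m x) _)

lemma diagOp_ae_eq (h : HessModulus Φ r B) (m : P2 d) (w : L2 m) :
    h.diagOp m w =ᵐ[m.1] fun x => diagField Φ m x (w x) :=
  (h.memLp_diagField_apply m w).coeFn_toLp

lemma aestronglyMeasurable_hessField_apply (h : HessModulus Φ r B) (m : P2 d) (x : M d)
    {w : M d → M d} (hw : AEStronglyMeasurable w m.1) :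
    AEStronglyMeasurable (fun a => hessField Φ m x a (w a)) m.1 := by
  have hc : Continuous fun q : (M d →L[ℝ] M d) × M d => q.1 q.2 :=
    continuous_fst.clm_apply continuous_snd
  exact hc.comp_aestronglyMeasurable (((h.continuous_hessField m).comp
    (continuous_const.prodMk continuous_id)).aestronglyMeasurable.prodMk hw)

lemma integrable_hessField_apply (h : HessModulus Φ r B) (m : P2 d) (x : M d)
    {w : M d → M d} (hw : Integrable w m.1) : Integrable (fun a => hessField Φ m x a (w a)) m.1 :=
  (hw.norm.const_mul (n * B)).mono'
    (h.aestronglyMeasurable_hessField_apply m x hw.aestronglyMeasurable)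
    (ae_of_all _ fun a => (hessField Φ m x a).le_of_opNorm_le (h.norm_hessField_le m x a) _)

lemma integral_norm_le_norm_L2 {m : P2 d} (w : L2 m) : ∫ x, ‖w x‖ ∂m.1 ≤ ‖w‖ := by
  have h1 := integral_mul_le_sqrt_mul_sqrt (Lp.memLp w).norm
    (memLp_const (μ := m.1) (p := 2) (1 : ℝ)) (fun x => norm_nonneg _) fun _ => zero_le_one
  have h2 : ‖w‖ ^ 2 = ∫ x, ‖w x‖ ^ 2 ∂m.1 := by
    simpa using norm_sub_sq_eq_integral (z := w) (w := 0) (ae_eq_refl _) (Lp.coeFn_zero _ _ _)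
  rw [← h2, Real.sqrt_sq (norm_nonneg _)] at h1
  simpa using h1

lemma norm_integral_hessField_apply_le (h : HessModulus Φ r B) (m : P2 d) (w : L2 m) (x : M d) :
    ‖∫ a, hessField Φ m x a (w a) ∂m.1‖ ≤ n * B * ‖w‖ := by
  have hB := h.nonneg
  refine (norm_integral_le_of_norm_le (((Lp.memLp w).integrable (by norm_num)).norm.const_mul
    (n * B)) (ae_of_all _ fun a =>
      (hessField Φ m x a).le_of_opNorm_le (h.norm_hessField_le m x a) _)).trans ?_
  rw [integral_const_mul]
  gcongr
  exact integral_norm_le_norm_L2 w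

lemma memLp_integral_hessField_apply (h : HessModulus Φ r B) (m : P2 d) (w : L2 m) :
    MemLp (fun x => ∫ a, hessField Φ m x a (w a) ∂m.1) 2 m.1 := by
  refine MemLp.of_bound ?_ (n * B * ‖w‖)
    (ae_of_all _ fun x => h.norm_integral_hessField_apply_le m w x)
  have hc : Continuous fun q : (M d →L[ℝ] M d) × M d => q.1 q.2 :=
    continuous_fst.clm_apply continuous_snd
  have h1 : AEStronglyMeasurable (fun p : M d × M d => hessField Φ m p.1 p.2 (w p.2))
      (m.1.prod m.1) := hc.comp_aestronglyMeasurable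
    ((h.continuous_hessField m).aestronglyMeasurable.prodMk (Lp.aestronglyMeasurable w).comp_snd)
  exact h1.integral_prod_right'

/-- The integral operator on `L²(m)` with kernel `A_{mm}`. -/
def hessOp (h : HessModulus Φ r B) (m : P2 d) : L2 m →L[ℝ] L2 m :=
  LinearMap.mkContinuous
    { toFun := fun w => (h.memLp_integral_hessField_apply m w).toLp
      map_add' := fun v w => by
        rw [← MemLp.toLp_add, MemLp.toLp_eq_toLp_iff]
        refine ae_of_all _ fun x => ?_
        rw [Pi.add_apply, ← integral_add
          (h.integrable_hessField_apply m x ((Lp.memLp v).integrable (by norm_num)))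
          (h.integrable_hessField_apply m x ((Lp.memLp w).integrable (by norm_num)))]
        refine integral_congr_ae ?_
        filter_upwards [Lp.coeFn_add v w] with a ha
        rw [ha, Pi.add_apply, map_add]
      map_smul' := fun c w => by
        rw [← MemLp.toLp_const_smul, MemLp.toLp_eq_toLp_iff]
        refine ae_of_all _ fun x => ?_
        rw [Pi.smul_apply, RingHom.id_apply, ← integral_smul]
        refine integral_congr_ae ?_
        filter_upwards [Lp.coeFn_smul c w] with a ha
        rw [ha, Pi.smul_apply, map_smul] } (n * B)
    fun w => by
      have hB := h.nonneg
      refine (Lp.norm_le_of_ae_bound (C := n * B * ‖w‖) (by positivity) ?_).trans_eq ?_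
      · filter_upwards [(h.memLp_integral_hessField_apply m w).coeFn_toLp] with x hx
        exact (congrArg norm hx).trans_le (h.norm_integral_hessField_apply_le m w x)
      · simp [measureUnivNNReal]

lemma hessOp_ae_eq (h : HessModulus Φ r B) (m : P2 d) (w : L2 m) :
    h.hessOp m w =ᵐ[m.1] fun x => ∫ a, hessField Φ m x a (w a) ∂m.1 :=
  (h.memLp_integral_hessField_apply m w).coeFn_toLp

/-- The bounded bilinear form which extends `barHess`. -/
def hessForm (h : HessModulus Φ r B) (m : P2 d) : tangent m →L[ℝ] tangent m →L[ℝ] ℝ :=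
  (innerSL ℝ).bilinearComp ((h.diagOp m + h.hessOp m).comp (tangent m).subtypeL)
    (tangent m).subtypeL

lemma hessForm_apply (h : HessModulus Φ r B) (m : P2 d) (z w : tangent m) {f g : M d → M d}
    (hf : (z : L2 m) =ᵐ[m.1] f) (hg : (w : L2 m) =ᵐ[m.1] g) :
    h.hessForm m z w = ∫ x, ⟪diagField Φ m x (f x), g x⟫ ∂m.1
      + ∫ x, ⟪∫ a, hessField Φ m x a (f a) ∂m.1, g x⟫ ∂m.1 := by
  have e : h.hessForm m z w = ⟪h.diagOp m z, (w : L2 m)⟫ + ⟪h.hessOp m z, (w : L2 m)⟫ := by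
    rw [← inner_add_left]; rfl
  rw [e, inner_L2_eq_integral (f := fun x => diagField Φ m x (f x)) ?_ hg,
    inner_L2_eq_integral (f := fun x => ∫ a, hessField Φ m x a (f a) ∂m.1) ?_ hg]
  · refine (h.hessOp_ae_eq m z).trans (ae_of_all _ fun x => integral_congr_ae ?_)
    filter_upwards [hf] with a ha
    rw [ha]
  · filter_upwards [h.diagOp_ae_eq m z, hf] with x hx hx'
    rw [hx, hx']

theorem hasWHess_hessForm (h : HessModulus Φ r B) (m : P2 d) :
    HasWHess (kPoly Φ) m (h.hessForm m) :=
  ⟨⟨1, one_pos, fun ν _ => h.wDifferentiableAt ν⟩,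
    fun _ hζ => (h.hasWExpansion_wDeriv_toLp m hζ).wDifferentiableAt,
    fun _ _ h₁ h₂ _ _ hz₁ hz₂ => by
      rw [h.barHess_eq m h₁.gradient h₂.gradient, h.hessForm_apply m _ _ hz₁ hz₂]⟩

theorem hasWHess_wHess (h : HessModulus Φ r B) (m : P2 d) :
    HasWHess (kPoly Φ) m (wHess (kPoly Φ) m) := by
  have hex : ∃ H, HasWHess (kPoly Φ) m H := ⟨_, h.hasWHess_hessForm m⟩
  rw [wHess, dif_pos hex]
  exact hex.choose_spec

end HessModulus

/-- Two Hessians agree on the diagonal at limits of gradients of test functions. -/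
lemma HasWHess.apply_self_eq {U : P2 d → ℝ} {m : P2 d} {H H' : tangent m →L[ℝ] tangent m →L[ℝ] ℝ}
    (h : HasWHess U m H) (h' : HasWHess U m H') {z : tangent m}
    (hz : (z : L2 m) ∈ closure {z : L2 m | ∃ φ : M d → ℝ, IsTest φ ∧ z =ᵐ[m.1] gradient φ}) :
    H z z = H' z z := by
  obtain ⟨u, hu, hlim⟩ := mem_closure_iff_seq_limit.1 hz
  choose φ hφ hφu using hu
  let v : ℕ → tangent m := fun k =>
    ⟨u k, subset_closure (Submodule.subset_span ⟨φ k, hφ k, hφu k⟩)⟩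
  have hv : Tendsto v atTop (𝓝 z) := tendsto_subtype_rng.2 hlim
  have hlimH : ∀ T : tangent m →L[ℝ] tangent m →L[ℝ] ℝ,
      Tendsto (fun k => T (v k) (v k)) atTop (𝓝 (T z z)) := fun T =>
    ((T.continuous.clm_apply continuous_id).tendsto z).comp hv
  refine tendsto_nhds_unique (hlimH H) ((hlimH H').congr fun k => ?_)
  rw [h.2.2 _ _ (hφ k) (hφ k) (v k) (v k) (hφu k) (hφu k),
    h'.2.2 _ _ (hφ k) (hφ k) (v k) (v k) (hφu k) (hφu k)]

/-! ### The moments, their gradients and the Hessian evaluated on them -/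

lemma gradient_coord (i : Fin d) :
    gradient (fun x : M d => x i) = fun _ => (EuclideanSpace.single i 1 : M d) := by
  funext x
  have h1 : HasFDerivAt (fun x : M d => x i) (EuclideanSpace.proj i : M d →L[ℝ] ℝ) x :=
    (EuclideanSpace.proj i : M d →L[ℝ] ℝ).hasFDerivAt
  refine ext_inner_right ℝ fun w => ?_
  rw [inner_gradient_apply, h1.fderiv, EuclideanSpace.inner_single_left]
  simp

lemma contDiff_coord (i : Fin d) : ContDiff ℝ 1 fun x : M d => x i :=
  (EuclideanSpace.proj i : M d →L[ℝ] ℝ).contDiff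

lemma norm_gradient_coord_le (i : Fin d) (x : M d) :
    ‖gradient (fun x : M d => x i) x‖ ≤ 1 * (1 + ‖x‖) := by
  rw [gradient_coord]
  simp

lemma hasWExpansion_moment (i : Fin d) (m : P2 d) :
    HasWExpansion (moment i) m fun _ => EuclideanSpace.single i 1 := by
  intro ε hε
  -- The moment is linear in the measure, so the expansion is exact and any radius works.
  refine ⟨1, one_pos, fun ν _ γ hγ => ?_⟩
  have := isProbabilityMeasure_of_mem_couplings hγ.1
  have hc : Continuous fun x : M d => x i := (contDiff_coord i).continuous
  have i1 : Integrable (fun p : M d × M d => p.1 i) γ :=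
    (EuclideanSpace.proj i : M d →L[ℝ] ℝ).integrable_comp
      ((memLp_fst_coupling hγ.1).integrable (by norm_num))
  have i2 : Integrable (fun p : M d × M d => p.2 i) γ :=
    (EuclideanSpace.proj i : M d →L[ℝ] ℝ).integrable_comp
      ((memLp_snd_coupling hγ.1).integrable (by norm_num))
  have e1 : moment i m = ∫ p, p.1 i ∂γ := by
    rw [moment, ← hγ.1.1, integral_map (by fun_prop) hc.aestronglyMeasurable]
  have e2 : moment i ν = ∫ p, p.2 i ∂γ := by
    rw [moment, ← hγ.1.2, integral_map (by fun_prop) hc.aestronglyMeasurable]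
  have e3 : ∀ p : M d × M d, ⟪(EuclideanSpace.single i (1 : ℝ) : M d), p.2 - p.1⟫
      = p.2 i - p.1 i := by
    intro p
    rw [EuclideanSpace.inner_single_left]
    simp
  simp_rw [e3]
  rw [integral_sub i2 i1, e1, e2, sub_self, abs_zero]
  exact mul_nonneg hε.le (W2_nonneg _ _)

lemma coe_momentGrad (i : Fin d) (m : P2 d) :
    (momentGrad i m : L2 m) = (memLp_const (EuclideanSpace.single i 1)).toLp := by
  have hm : MemLp (fun _ : M d => (EuclideanSpace.single i 1 : M d)) 2 m.1 := memLp_const _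
  have ht : hm.toLp ∈ tangent m := mem_tangent_of_gradient (contDiff_coord i)
    (norm_gradient_coord_le i) (by rw [gradient_coord]; exact hm.coeFn_toLp)
  rw [momentGrad, ((hasWExpansion_moment i m).congr hm.coeFn_toLp.symm).wGrad_eq ht]
  exact Submodule.starProjection_eq_self_iff.2 ht

lemma momentGrad_ae_eq (i : Fin d) (m : P2 d) :
    (momentGrad i m : L2 m) =ᵐ[m.1] fun _ => EuclideanSpace.single i 1 := by
  rw [coe_momentGrad]
  exact MemLp.coeFn_toLp _

/-- A constant field need not be the gradient of a test function, but it is an $L^2(m)$-limit of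
such gradients. The chosen Hessian therefore agrees there with the explicit form. -/
theorem HessModulus.wHess_momentGrad {Φ : (Fin (n + 1) → M d) → ℝ} {r : ℝ → ℝ} {B : ℝ}
    (h : HessModulus Φ r B) (m : P2 d) (i : Fin d) :
    wHess (kPoly Φ) m (momentGrad i m) (momentGrad i m)
      = ∫ x, diagField Φ m x (EuclideanSpace.single i 1) i ∂m.1
        + ∫ x, (∫ a, hessField Φ m x a (EuclideanSpace.single i 1) ∂m.1) i ∂m.1 := by
  have hcl := mem_closure_gradient_isTest (contDiff_coord i) (norm_gradient_coord_le i)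
    (z := (momentGrad i m : L2 m)) (by rw [gradient_coord]; exact momentGrad_ae_eq i m)
  rw [(h.hasWHess_wHess m).apply_self_eq (h.hasWHess_hessForm m) hcl,
    h.hessForm_apply m _ _ (momentGrad_ae_eq i m) (momentGrad_ae_eq i m)]
  simp [EuclideanSpace.inner_single_right]

end HessianForm

end

noncomputable section

/-! ### The Wasserstein Laplacian of `F_Φ` -/

section Laplacian

variable {d n k : ℕ}

/-- The trace of a matrix, as a continuous linear form. -/
def traceCLM (d : ℕ) : (M d →L[ℝ] M d) →L[ℝ] ℝ :=
  ∑ i : Fin d, (EuclideanSpace.proj i : M d →L[ℝ] ℝ).comp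
    (ContinuousLinearMap.apply ℝ (M d) (EuclideanSpace.single i 1 : M d))

lemma traceCLM_apply (L : M d →L[ℝ] M d) :
    traceCLM d L = ∑ i : Fin d, L (EuclideanSpace.single i 1) i := by
  simp [traceCLM]

lemma divGrad_eq_traceCLM (Φ : (Fin k → M d) → ℝ) (i j : Fin k) (x : Fin k → M d) :
    divGrad Φ i j x = traceCLM d (partialHess Φ i j x) := (traceCLM_apply _).symm

namespace HessModulus

lemma integrable_partialHess_pi {Φ : (Fin k → M d) → ℝ} {r : ℝ → ℝ} {B : ℝ}
    (h : HessModulus Φ r B) (i j : Fin k) (m : P2 d) :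
    Integrable (partialHess Φ i j) (Measure.pi fun _ : Fin k => m.1) :=
  Integrable.of_bound (continuous_partialHess h.contDiff i j).aestronglyMeasurable B
    (ae_of_all _ fun x => h.norm_hess_le i j x)

lemma integrable_divGrad {Φ : (Fin k → M d) → ℝ} {r : ℝ → ℝ} {B : ℝ}
    (h : HessModulus Φ r B) (i j : Fin k) (m : P2 d) :
    Integrable (divGrad Φ i j) (Measure.pi fun _ : Fin k => m.1) := by
  have e : divGrad Φ i j = fun x => traceCLM d (partialHess Φ i j x) :=
    funext fun x => divGrad_eq_traceCLM Φ i j x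
  rw [e]
  exact (traceCLM d).integrable_comp (h.integrable_partialHess_pi i j m)

lemma integral_divGrad_perm {Φ : (Fin k → M d) → ℝ} {r : ℝ → ℝ} {B : ℝ}
    (h : HessModulus Φ r B) (σ : Equiv.Perm (Fin k)) (i j : Fin k) (m : P2 d) :
    ∫ x, divGrad Φ (σ i) (σ j) x ∂(Measure.pi fun _ : Fin k => m.1)
      = ∫ x, divGrad Φ i j x ∂(Measure.pi fun _ : Fin k => m.1) := by
  rw [← integral_pi_comp_perm m.1 σ (divGrad Φ i j)]
  simp_rw [divGrad_eq_traceCLM, partialHess_perm h.symm]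

lemma kPoly_thetaFun {Φ : (Fin k → M d) → ℝ} {r : ℝ → ℝ} {B : ℝ} (h : HessModulus Φ r B)
    (ε : ℝ) (m : P2 d) : kPoly (thetaFun ε Φ) m
      = (1 / (k : ℝ)) * ((1 + ε) * ∑ j, ∫ x, divGrad Φ j j x ∂(Measure.pi fun _ => m.1)
        + ∑ j, ∑ i ∈ Finset.univ.filter (fun i => i ≠ j),
          ∫ x, divGrad Φ i j x ∂(Measure.pi fun _ => m.1)) := by
  rw [kPoly]
  congr 1
  simp only [thetaFun]
  rw [integral_add, integral_const_mul, integral_finsetSum, integral_finsetSum]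
  · congr 1
    exact Finset.sum_congr rfl fun j _ => integral_finsetSum _ fun i _ => h.integrable_divGrad i j m
  · exact fun j _ => integrable_finsetSum _ fun i _ => h.integrable_divGrad i j m
  · exact fun j _ => h.integrable_divGrad j j m
  · exact (integrable_finsetSum _ fun j _ => h.integrable_divGrad j j m).const_mul _
  · exact integrable_finsetSum _ fun j _ => integrable_finsetSum _ fun i _ =>
      h.integrable_divGrad i j m

variable {Φ : (Fin (n + 1) → M d) → ℝ} {r : ℝ → ℝ} {B : ℝ}

/-- Symmetry gives all diagonal blocks the same integral; for the block `(0, 0)`, integrating out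
every variable but the first produces `diagField`. -/
lemma integral_traceCLM_diagField (h : HessModulus Φ r B) (m : P2 d) (j : Fin (n + 1)) :
    ∫ x, traceCLM d (diagField Φ m x) ∂m.1
      = ∫ x, divGrad Φ j j x ∂(Measure.pi fun _ => m.1) := by
  have e := h.integral_divGrad_perm (Equiv.swap 0 j) 0 0 m
  rw [Equiv.swap_apply_left] at e
  rw [e, integral_pi_succ m.1 (h.integrable_divGrad 0 0 m)]
  refine integral_congr_ae (ae_of_all _ fun x => ?_)
  have hi : Integrable (fun y => partialHess Φ 0 0 (Fin.cons x y))
      (Measure.pi fun _ : Fin n => m.1) :=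
    h.integrable_partialHess 0 0 (measurable_cons measurable_const measurable_id)
  dsimp only
  simp_rw [divGrad_eq_traceCLM]
  rw [(traceCLM d).integral_comp_comm hi]
  rfl

lemma exists_perm_zero_one {i j : Fin (n + 2)} (hij : i ≠ j) :
    ∃ σ : Equiv.Perm (Fin (n + 2)), σ 0 = j ∧ σ 1 = i := by
  refine ⟨Equiv.swap (Equiv.swap 0 j 1) i * Equiv.swap 0 j, ?_, ?_⟩
  · rw [Equiv.Perm.mul_apply, Equiv.swap_apply_left]
    refine Equiv.swap_apply_of_ne_of_ne (fun e => ?_) hij.symm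
    have : Equiv.swap 0 j 1 = Equiv.swap 0 j 0 := by rw [← e, Equiv.swap_apply_left]
    exact absurd ((Equiv.swap 0 j).injective this) (by simp)
  · rw [Equiv.Perm.mul_apply, Equiv.swap_apply_left]

/-- There are $k(k-1)$ ordered pairs, each contributing the same integral by symmetry. The factor
$k-1$ is contained in $A_{mm}$ and the factor $k$ stands in front on the left. -/
lemma integral_traceCLM_hessField (h : HessModulus Φ r B) (m : P2 d) :
    ((n + 1 : ℕ) : ℝ) * ∫ x, ∫ a, traceCLM d (hessField Φ m x a) ∂m.1 ∂m.1
      = ∑ j, ∑ i ∈ Finset.univ.filter (fun i => i ≠ j),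
          ∫ x, divGrad Φ i j x ∂(Measure.pi fun _ => m.1) := by
  cases n with
  | zero =>
    have h1 : ∀ j : Fin 1, Finset.univ.filter (fun i : Fin 1 => i ≠ j) = ∅ := by
      intro j
      exact Finset.filter_eq_empty_iff.2 fun i _ => not_not.2 (Subsingleton.elim _ _)
    simp [h1, hessField]
  | succ n =>
    have e0 : ∫ x, ∫ a, traceCLM d (hessField Φ m x a) ∂m.1 ∂m.1
        = ((n : ℝ) + 1) * ∫ x, divGrad Φ 1 0 x ∂(Measure.pi fun _ => m.1) := by
      rw [integral_pi_succ m.1 (h.integrable_divGrad 1 0 m), ← integral_const_mul]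
      refine integral_congr_ae (ae_of_all _ fun x => ?_)
      have hX : Measurable fun y : Fin (n + 1) → M d => (Fin.cons x y : Fin (n + 2) → M d) :=
        measurable_cons measurable_const measurable_id
      have hi : Integrable (fun y => divGrad Φ 1 0 (Fin.cons x y))
          (Measure.pi fun _ : Fin (n + 1) => m.1) := by
        simp_rw [divGrad_eq_traceCLM]
        exact (traceCLM d).integrable_comp (h.integrable_partialHess 1 0 hX)
      dsimp only
      rw [integral_pi_succ m.1 hi, ← integral_const_mul]
      refine integral_congr_ae (ae_of_all _ fun a => ?_)
      have hi' : Integrable (fun y => partialHess Φ 1 0 (Fin.cons x (Fin.cons a y)))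
          (Measure.pi fun _ : Fin n => m.1) :=
        h.integrable_partialHess 1 0 (measurable_cons measurable_const
          (measurable_cons measurable_const measurable_id))
      dsimp only
      simp_rw [divGrad_eq_traceCLM]
      rw [(traceCLM d).integral_comp_comm hi', hessField, map_smul, smul_eq_mul]
    have e1 : ∀ j : Fin (n + 2), ∀ i ∈ Finset.univ.filter (fun i => i ≠ j),
        ∫ x, divGrad Φ i j x ∂(Measure.pi fun _ => m.1)
          = ∫ x, divGrad Φ 1 0 x ∂(Measure.pi fun _ => m.1) := by
      intro j i hi
      obtain ⟨σ, h0, h1⟩ := exists_perm_zero_one (Finset.mem_filter.1 hi).2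
      rw [← h0, ← h1]
      exact h.integral_divGrad_perm σ 1 0 m
    have hcard : ∀ j : Fin (n + 2), (Finset.univ.filter (fun i => i ≠ j)).card = n + 1 := by
      intro j
      rw [Finset.filter_ne', Finset.card_erase_of_mem (Finset.mem_univ j)]
      simp
    rw [e0, Finset.sum_congr rfl fun j _ => Finset.sum_congr rfl (e1 j)]
    simp only [Finset.sum_const, hcard, Finset.card_univ, Fintype.card_fin, nsmul_eq_mul]
    push_cast
    ring

lemma integrable_diagField (h : HessModulus Φ r B) (m : P2 d) : Integrable (diagField Φ m) m.1 :=
  Integrable.of_bound (h.continuous_diagField m).aestronglyMeasurable B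
    (ae_of_all _ (h.norm_diagField_le m))

lemma integrable_hessField (h : HessModulus Φ r B) (m : P2 d) (x : M d) :
    Integrable (hessField Φ m x) m.1 :=
  Integrable.of_bound ((h.continuous_hessField m).comp
    (continuous_const.prodMk continuous_id)).aestronglyMeasurable (n * B)
    (ae_of_all _ (h.norm_hessField_le m x))

lemma integrable_integral_hessField (h : HessModulus Φ r B) (m : P2 d) :
    Integrable (fun x => ∫ a, hessField Φ m x a ∂m.1) m.1 := by
  have hi : Integrable (fun p : M d × M d => hessField Φ m p.1 p.2) (m.1.prod m.1) :=
    Integrable.of_bound (h.continuous_hessField m).aestronglyMeasurable (n * B)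
      (ae_of_all _ fun p => h.norm_hessField_le m p.1 p.2)
  exact hi.integral_prod_left

lemma sum_integral_apply_single {μ : Measure (M d)} {A : M d → M d →L[ℝ] M d}
    (hA : Integrable A μ) :
    ∑ i : Fin d, ∫ x, A x (EuclideanSpace.single i 1) i ∂μ = ∫ x, traceCLM d (A x) ∂μ := by
  simp_rw [traceCLM_apply]
  rw [integral_finsetSum]
  intro i _
  exact (EuclideanSpace.proj i : M d →L[ℝ] ℝ).integrable_comp (hA.apply_continuousLinearMap _)

theorem wLaplacian_eq (h : HessModulus Φ r B) (m : P2 d) :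
    wLaplacian (kPoly Φ) m = kPoly (thetaFun 0 Φ) m := by
  have e1 : ∀ i : Fin d, ∀ x,
      (∫ a, hessField Φ m x a (EuclideanSpace.single i 1) ∂m.1) i
        = (∫ a, hessField Φ m x a ∂m.1) (EuclideanSpace.single i 1) i := fun i x => by
    rw [ContinuousLinearMap.integral_apply (h.integrable_hessField m x)]
  have e2 : ∀ x, traceCLM d (∫ a, hessField Φ m x a ∂m.1)
      = ∫ a, traceCLM d (hessField Φ m x a) ∂m.1 := fun x =>
    ((traceCLM d).integral_comp_comm (h.integrable_hessField m x)).symm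
  rw [wLaplacian]
  simp_rw [h.wHess_momentGrad m, e1]
  rw [Finset.sum_add_distrib, sum_integral_apply_single (h.integrable_diagField m),
    sum_integral_apply_single (h.integrable_integral_hessField m), h.kPoly_thetaFun,
    ← h.integral_traceCLM_hessField]
  simp_rw [e2, ← h.integral_traceCLM_diagField m]
  have hn : ((n + 1 : ℕ) : ℝ) ≠ 0 := by positivity
  rw [Finset.sum_const, Finset.card_univ, Fintype.card_fin, nsmul_eq_mul]
  field_simp
  ring

theorem twiceWDifferentiableAt (h : HessModulus Φ r B) (m : P2 d) :
    TwiceWDifferentiableAt (kPoly Φ) m := ⟨_, _, h.hasSecondOrderExpansion m⟩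

lemma hasSecondOrderExpansion_wAt (h : HessModulus Φ r B) (m : P2 d) :
    HasSecondOrderExpansion (kPoly Φ) m (wAt (kPoly Φ) m) (wAmm (kPoly Φ) m) := by
  rw [wAt, wAmm, dif_pos (h.twiceWDifferentiableAt m), dif_pos (h.twiceWDifferentiableAt m)]
  exact (h.twiceWDifferentiableAt m).choose_spec.choose_spec

/-- The perturbation involves the chosen coefficient `wAt`, which by uniqueness equals `diagField`;
its trace thus adds `ε` further copies of the diagonal part of `thetaFun`. -/
theorem wLaplacianEps_eq (h : HessModulus Φ r B) (ε : ℝ) (m : P2 d) :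
    wLaplacianEps ε (kPoly Φ) m = kPoly (thetaFun ε Φ) m := by
  have e1 : ∀ i : Fin d,
      ∫ x, ⟪wAt (kPoly Φ) m x ((momentGrad i m : L2 m) x), (momentGrad i m : L2 m) x⟫ ∂m.1
        = ∫ x, diagField Φ m x (EuclideanSpace.single i 1) i ∂m.1 := by
    intro i
    refine integral_congr_ae ?_
    filter_upwards [momentGrad_ae_eq i m] with x hx
    rw [hx, h.eq_diagField_of_expansion (h.hasSecondOrderExpansion_wAt m) x]
    simp [EuclideanSpace.inner_single_right]
  have e2 : wLaplacianEps ε (kPoly Φ) m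
      = wLaplacian (kPoly Φ) m + ε * ∫ x, traceCLM d (diagField Φ m x) ∂m.1 := by
    rw [wLaplacianEps, Finset.sum_add_distrib, ← Finset.mul_sum, wLaplacian]
    simp_rw [e1]
    rw [sum_integral_apply_single (h.integrable_diagField m)]
  rw [e2, h.wLaplacian_eq, h.kPoly_thetaFun, h.kPoly_thetaFun]
  simp_rw [← h.integral_traceCLM_diagField m]
  have hn : ((n + 1 : ℕ) : ℝ) ≠ 0 := by positivity
  rw [Finset.sum_const, Finset.card_univ, Fintype.card_fin, nsmul_eq_mul]
  field_simp
  ring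

end HessModulus

end Laplacian

end

theorem mainTheorem4 (d k : ℕ) (hk : 1 ≤ k) (Φ : (Fin k → M d) → ℝ) (hΦ : IsSymTwo Φ) :
    (∀ m : P2 d,
      TwiceWDifferentiableAt (kPoly Φ) m ∧
      IsWGrad (kPoly Φ) m (wGrad (kPoly Φ) m) ∧
      wGrad (kPoly Φ) m =ᵐ[m.1] gradField Φ m ∧
      (∀ᵐ x ∂m.1, ∀ i : Fin d,
        wGrad2 (kPoly Φ) m x i =ᵐ[m.1] fun a => matRow (hessField Φ m x a) i) ∧
      HasWHess (kPoly Φ) m (wHess (kPoly Φ) m)) ∧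
    (∀ m : P2 d, wLaplacian (kPoly Φ) m = kPoly (thetaFun 0 Φ) m) ∧
    (∀ ε : ℝ, 0 < ε → ∀ m : P2 d, wLaplacianEps ε (kPoly Φ) m = kPoly (thetaFun ε Φ) m) := by
  obtain ⟨n, rfl⟩ : ∃ n, k = n + 1 := ⟨k - 1, by omega⟩
  obtain ⟨r, B, h⟩ := hΦ.exists_hessModulus
  refine ⟨fun m => ⟨h.twiceWDifferentiableAt m, (h.isWGrad_iff m).2 (h.wGrad_eq m),
    h.wGrad_ae_eq m, ?_, h.hasWHess_wHess m⟩, h.wLaplacian_eq, fun ε _ => h.wLaplacianEps_eq ε⟩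
  -- The coefficient is identified only at points of the support of `m`, which has full measure.
  filter_upwards [Measure.support_mem_ae (μ := m.1)] with x hx i
  exact h.projTangent_matRow_ae_eq (h.hasSecondOrderExpansion_wAt m) hx i
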